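/- Let $\mathcal H_A,\mathcal H_B$ be separable complex Hilbert spaces (of finite or infinite dimension), $\mathcal H_{AB}=\mathcal H_A\otimes\mathcal H_B$ their Hilbert space tensor product. A state is a positive trace-class operator of unit trace; pure states are the extreme points of the set of states; $\omega_A=\mathrm{Tr}_B\,\omega_{AB}$ etc. denote marginals. Let $H(\rho)=\mathrm{Tr}(-\rho\log\rho)\in[0,+\infty]$ be the von Neumann entropy, $H(\rho\|\sigma)$ the quantum relative entropy, and $I(A\!:\!B)_\omega=H(\omega_{AB}\|\omega_A\otimes\omega_B)$ the mutual information, extended to positive trace-class operators by $I(A\!:\!B)_{\omega}=[\mathrm{Tr}\,\omega]\,I(A\!:\!B)_{\omega/\mathrm{Tr}\,\omega}$ (and $0$ at $\omega=0$). For a state $\omega_{ABE}$ of a tripartite system the (extended) conditional mutual information is $$I(A\!:\!B|E)_\omega=\sup_{P_A}\big[I(A\!:\!BE)_{Q_A\omega Q_A}-I(A\!:\!E)_{Q_A\omega Q_A}\big],\qquad Q_A=P_A\otimes I_{BE},$$ the supremum being over all finite rank projectors $P_A$ on $\mathcal H_A$. Define, for a state $\omega_{AB}$: * $E_{sq}(\omega_{AB})=\frac12\inf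 I(A\!:\!B|E)_{\omega_{ABE}}$, the infimum over all states $\omega_{ABE}$ with $\mathrm{Tr}_E\,\omega_{ABE}=\omega_{AB}$, where $\mathcal H_E$ is an infinite-dimensional separable Hilbert space; * $\widehat E_{sq}(\omega_{AB})=\sup_{P_A,P_B}E^{\rm fin}_{sq}(P_A\otimes P_B\,\omega_{AB}\,P_A\otimes P_B)$, the supremum over all finite rank projectors $P_A,P_B$ on $\mathcal H_A,\mathcal H_B$, where $E^{\rm fin}_{sq}$ is the squashed entanglement of finite-dimensional bipartite systems, i.e. $\frac12\inf[H(\omega_{AE})+H(\omega_{BE})-H(\omega_E)-H(\omega_{ABE})]$ over all extensions $\omega_{ABE}$ of the state with $\mathcal H_E$ of finite but unbounded dimension, extended to positive operators by $E^{\rm fin}_{sq}(\omega)=[\mathrm{Tr}\,\omega]\,E^{\rm fin}_{sq}(\omega/\mathrm{Tr}\,\omega)$ (and $0$ at $\omega=0$); * $E_F^d(\omega_{AB})=\inf\sum_i\pi_iH(\omega^i_A)$, the infimum over all countable convex decompositions $\omega_{AB}=\sum_i\pi_i\omega^i_{AB}$ into pure states $\omega^i_{AB}$; * $E_F^c(\omega_{AB})=\inf\int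 H(\omega_A)\,\mu(d\omega)$, the infimum over all Borel probability measures $\mu$ on the set of pure states on $\mathcal H_{AB}$ with barycenter $\int\omega\,\mu(d\omega)=\omega_{AB}$. Then for every state $\omega_{AB}$ on $\mathcal H_{AB}$ $$E_{sq}(\omega_{AB})\le E_F^d(\omega_{AB}),\qquad \widehat E_{sq}(\omega_{AB})\le E_F^c(\omega_{AB}),$$ as inequalities in $[0,+\infty]$. -/

import Mathlib

noncomputable section

open scoped TensorProduct ENNReal NNReal
open UniformSpace MeasureTheory

namespace Squashed

universe u v w w'

/-! ## Hilbert space preliminaries -/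

section Hilbert

/-- Bounded operators on a Hilbert space. -/
abbrev Op (H : Type u) [NormedAddCommGroup H] [InnerProductSpace ℂ H] : Type u := H →L[ℂ] H

/-- The Hilbert space tensor product: the completion of the algebraic tensor product with respect
to the inner product `⟪a ⊗ b, c ⊗ d⟫ = ⟪a, c⟫ * ⟪b, d⟫`. -/
abbrev HTensor (HA : Type u) (HB : Type v) [NormedAddCommGroup HA] [InnerProductSpace ℂ HA]
    [NormedAddCommGroup HB] [InnerProductSpace ℂ HB] : Type (max u v) :=
  Completion (HA ⊗[ℂ] HB)

variable {HA : Type u} {HB : Type v} {KA : Type w} {KB : Type w'}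
  [NormedAddCommGroup HA] [InnerProductSpace ℂ HA]
  [NormedAddCommGroup HB] [InnerProductSpace ℂ HB]
  [NormedAddCommGroup KA] [InnerProductSpace ℂ KA]
  [NormedAddCommGroup KB] [InnerProductSpace ℂ KB]

/-- The bounded operator `S ⊗ T` between Hilbert space tensor products. -/
def opTensor (S : HA →L[ℂ] KA) (T : HB →L[ℂ] KB) : HTensor HA HB →L[ℂ] HTensor KA KB :=
  (TensorProduct.mapL S T).completion

/-- The map `x ↦ x ⊗ b`. -/
def tmulRight (HA : Type u) [NormedAddCommGroup HA] [InnerProductSpace ℂ HA] (b : HB) :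
    HA →L[ℂ] HTensor HA HB :=
  (Completion.toComplL : HA ⊗[ℂ] HB →L[ℂ] HTensor HA HB) ∘L (TensorProduct.mkL ℂ HA HB).flip b

/-- The map `y ↦ a ⊗ y`. -/
def tmulLeft (HB : Type v) [NormedAddCommGroup HB] [InnerProductSpace ℂ HB] (a : HA) :
    HB →L[ℂ] HTensor HA HB :=
  (Completion.toComplL : HA ⊗[ℂ] HB →L[ℂ] HTensor HA HB) ∘L TensorProduct.mkL ℂ HA HB a

end Hilbert

section Trace

variable (H : Type u) [NormedAddCommGroup H] [InnerProductSpace ℂ H] [CompleteSpace H]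

/-- Index set of a fixed orthonormal (Hilbert) basis of `H`. -/
def onbIndex : Set H := (exists_hilbertBasis ℂ H).choose

/-- A fixed orthonormal (Hilbert) basis of `H`; traces and partial traces of positive trace-class
operators do not depend on it. -/
def onb : HilbertBasis (onbIndex H) ℂ H := (exists_hilbertBasis ℂ H).choose_spec.choose

variable {H}

/-- The trace of a positive bounded operator, with values in `[0, ∞]`. -/
def trace (T : Op H) : ℝ≥0∞ := ∑' i, ENNReal.ofReal (inner ℂ (onb H i) (T (onb H i))).re

/-- Quantum states (density operators): positive trace-class operators with unit trace. -/
def states (H : Type u) [NormedAddCommGroup H] [InnerProductSpace ℂ H] [CompleteSpace H] :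
    Set (Op H) :=
  {ρ | ρ.IsPositive ∧ trace ρ = 1}

/-- Pure states: the extreme points of the convex set of states. (The operator norm and the trace
norm define the same topology, hence the same Borel sets, on pure states.) -/
def pureStates (H : Type u) [NormedAddCommGroup H] [InnerProductSpace ℂ H] [CompleteSpace H] :
    Set (Op H) :=
  Set.extremePoints ℝ (states H)

/-- The homogeneous extension of a `[0, ∞]`-valued function `F` of states to all positive
trace-class operators: `F ω = (Tr ω) * F (ω / Tr ω)`, and `0` at `ω = 0`. -/
def homExt (F : Op H → ℝ≥0∞) (ω : Op H) : ℝ≥0∞ := trace ω * F ((trace ω).toReal⁻¹ • ω)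

/-- Projectors (orthogonal projections) of finite rank. -/
def finiteRankProj (H : Type u) [NormedAddCommGroup H] [InnerProductSpace ℂ H] [CompleteSpace H] :
    Set (Op H) :=
  {P | IsStarProjection P ∧ FiniteDimensional ℂ (LinearMap.range (P : H →ₗ[ℂ] H))}

end Trace

section PartialTrace

variable {HA : Type u} {HB : Type v} {HE : Type w}
  [NormedAddCommGroup HA] [InnerProductSpace ℂ HA] [CompleteSpace HA]
  [NormedAddCommGroup HB] [InnerProductSpace ℂ HB] [CompleteSpace HB]
  [NormedAddCommGroup HE] [InnerProductSpace ℂ HE] [CompleteSpace HE]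

/-- `ω_A = Tr_B ω_{AB}`: `⟪x, ω_A y⟫ = ∑ⱼ ⟪x ⊗ bⱼ, ω_{AB} (y ⊗ bⱼ)⟫` for an orthonormal basis `b`
of `H_B`. The series converges absolutely in norm for trace-class operators. -/
def margFst (ω : Op (HTensor HA HB)) : Op HA :=
  ∑' j, (tmulRight HA (onb HB j)).adjoint ∘L ω ∘L tmulRight HA (onb HB j)

/-- `ω_B = Tr_A ω_{AB}`. -/
def margSnd (ω : Op (HTensor HA HB)) : Op HB :=
  ∑' j, (tmulLeft HB (onb HA j)).adjoint ∘L ω ∘L tmulLeft HB (onb HA j)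

/-- `ω_{AB} = Tr_E ω_{ABE}` for an operator on `H_A ⊗ (H_B ⊗ H_E)`. -/
def margAB (ω : Op (HTensor HA (HTensor HB HE))) : Op (HTensor HA HB) :=
  ∑' j, (opTensor (.id ℂ HA) (tmulRight HB (onb HE j))).adjoint ∘L ω ∘L
    opTensor (.id ℂ HA) (tmulRight HB (onb HE j))

/-- `ω_{AE} = Tr_B ω_{ABE}` for an operator on `H_A ⊗ (H_B ⊗ H_E)`. -/
def margAE (ω : Op (HTensor HA (HTensor HB HE))) : Op (HTensor HA HE) :=
  ∑' j, (opTensor (.id ℂ HA) (tmulLeft HE (onb HB j))).adjoint ∘L ω ∘L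
    opTensor (.id ℂ HA) (tmulLeft HE (onb HB j))

end PartialTrace

/-! ## Entropic quantities -/

section Entropy

variable {H : Type u} [NormedAddCommGroup H] [InnerProductSpace ℂ H] [CompleteSpace H]

/-- The von Neumann entropy `Tr η(ρ)`, `η(x) = -x log x`, of a state. -/
def entropy (ρ : Op H) : ℝ≥0∞ := trace (cfc Real.negMulLog ρ)

/-- A Hilbert basis consisting of eigenvectors of `T`, with its (real) eigenvalues. -/
structure EigenBasis (T : Op H) where
  /-- the index type -/
  ι : Type u
  /-- the orthonormal basis -/
  vec : HilbertBasis ι ℂ H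
  /-- the eigenvalues -/
  val : ι → ℝ
  /-- the eigenvector equation -/
  apply_vec : ∀ i, T (vec i) = (val i : ℂ) • vec i

/-- `x log x - x log y + y - x` for `x, y ≥ 0`, equal to `+∞` if `y = 0 < x`. -/
def relTerm (x y : ℝ) : ℝ≥0∞ :=
  if y = 0 ∧ x ≠ 0 then ∞
  else ENNReal.ofReal (x * Real.log x - x * Real.log y + y - x)

/-- The relative entropy `H(ρ‖σ) = ∑ᵢ ⟨i| ρ log ρ - ρ log σ + σ - ρ |i⟩` of positive trace-class
operators, `|i⟩` running over an orthonormal basis of eigenvectors of `ρ`; the diagonal matrix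
elements are expanded in an orthonormal basis of eigenvectors of `σ`. All summands are nonnegative,
the value is `+∞` if `supp ρ` is not contained in `supp σ`, and the double sum does not depend on
the two eigenbases (so that the infimum is over equal values). -/
def relEntropy (ρ σ : Op H) : ℝ≥0∞ :=
  ⨅ (e : EigenBasis ρ) (f : EigenBasis σ),
    ∑' i, ∑' j, ENNReal.ofReal (‖inner ℂ (e.vec i) (f.vec j)‖ ^ 2) * relTerm (e.val i) (f.val j)

end Entropy

section Information

variable {HA : Type u} {HB : Type v} {HE : Type w}
  [NormedAddCommGroup HA] [InnerProductSpace ℂ HA] [CompleteSpace HA]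
  [NormedAddCommGroup HB] [InnerProductSpace ℂ HB] [CompleteSpace HB]
  [NormedAddCommGroup HE] [InnerProductSpace ℂ HE] [CompleteSpace HE]

/-- The quantum mutual information `I(A:B)_ω = H(ω_{AB} ‖ ω_A ⊗ ω_B)`, extended homogeneously to
positive trace-class operators. -/
def mutualInfo (ω : Op (HTensor HA HB)) : ℝ≥0∞ :=
  homExt (fun ρ => relEntropy ρ (opTensor (margFst ρ) (margSnd ρ))) ω

/-- The extended quantum conditional mutual information
`I(A:B|E)_ω = sup_{P_A} [I(A:BE)_{QωQ} - I(A:E)_{QωQ}]`, `Q = P_A ⊗ I_{BE}`, over all finite rank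
projectors `P_A`. Both terms are finite and the difference is nonnegative (monotonicity of the
mutual information), so subtraction in `[0, ∞]` is the ordinary one. -/
def condMutualInfo (ω : Op (HTensor HA (HTensor HB HE))) : ℝ≥0∞ :=
  ⨆ P ∈ finiteRankProj HA,
    let Q : Op (HTensor HA (HTensor HB HE)) := opTensor P (.id ℂ (HTensor HB HE))
    mutualInfo (Q ∘L ω ∘L Q) - mutualInfo (margAE (Q ∘L ω ∘L Q))

/-- The conditional mutual information `H(AE) + H(BE) - H(E) - H(ABE)` of a state all of whose
marginals have finite rank. All entropies are finite and the difference is nonnegative (strong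
subadditivity), so subtraction in `[0, ∞]` is the ordinary one. -/
def condMutualInfoFin (ω : Op (HTensor HA (HTensor HB HE))) : ℝ≥0∞ :=
  (entropy (margAE ω) + entropy (margSnd ω)) - (entropy (margSnd (margSnd ω)) + entropy ω)

/-- `ω_{ABE}` is a state extending `ω_{AB}`. -/
def IsExtension (ω : Op (HTensor HA HB)) (τ : Op (HTensor HA (HTensor HB HE))) : Prop :=
  τ ∈ states (HTensor HA (HTensor HB HE)) ∧ margAB τ = ω

/-! ## Entanglement measures -/

/-- The squashed entanglement `E_sq(ω_{AB}) = ½ inf I(A:B|E)`, the infimum over all extensions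
`ω_{ABE}` with `H_E` the infinite-dimensional separable Hilbert space `ℓ²(ℕ)`. -/
def squashed (ω : Op (HTensor HA HB)) : ℝ≥0∞ :=
  2⁻¹ * ⨅ (τ : Op (HTensor HA (HTensor HB (lp (fun _ : ℕ => ℂ) 2)))) (_ : IsExtension ω τ),
    condMutualInfo τ

/-- The finite-dimensional squashed entanglement `½ inf I(A:B|E)`, the infimum over all extensions
`ω_{ABE}` with `H_E` of finite but unbounded dimension, of a state `ω_{AB}` with finite rank
marginals, i.e. of a state of a finite-dimensional bipartite system `K_A ⊗ K_B ⊆ H_A ⊗ H_B`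
(extensions of such a state live on `K_A ⊗ K_B ⊗ H_E`). -/
def squashedFin (ω : Op (HTensor HA HB)) : ℝ≥0∞ :=
  2⁻¹ * ⨅ (n : ℕ) (τ : Op (HTensor HA (HTensor HB (EuclideanSpace ℂ (Fin n)))))
    (_ : IsExtension ω τ), condMutualInfoFin τ

/-- The universal extension of the finite-dimensional squashed entanglement:
`Ê_sq(ω) = sup E_sq (P_A ⊗ P_B ω P_A ⊗ P_B)` over all finite rank projectors `P_A`, `P_B`, where
`E_sq` is extended homogeneously to positive trace-class operators. -/
def squashedHat (ω : Op (HTensor HA HB)) : ℝ≥0∞ :=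
  ⨆ PA ∈ finiteRankProj HA, ⨆ PB ∈ finiteRankProj HB,
    homExt squashedFin (opTensor PA PB ∘L ω ∘L opTensor PA PB)

/-- The discrete entanglement of formation: the infimum of `∑ πᵢ H(ωⁱ_A)` over all countable convex
decompositions `∑ πᵢ ωⁱ_{AB} = ω_{AB}` into pure states. -/
def formationDiscrete (ω : Op (HTensor HA HB)) : ℝ≥0∞ :=
  ⨅ (π : ℕ → ℝ≥0) (φ : ℕ → pureStates (HTensor HA HB)) (_ : HasSum π 1)
    (_ : HasSum (fun i => (π i : ℝ) • (φ i : Op (HTensor HA HB))) ω),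
    ∑' i, (π i : ℝ≥0∞) * entropy (margFst (φ i : Op (HTensor HA HB)))

/-- The continuous entanglement of formation: the infimum of `∫ H(φ_A) μ(dφ)` over all Borel
probability measures `μ` on the set of pure states with barycenter `ω_{AB}`. -/
def formationContinuous (ω : Op (HTensor HA HB)) : ℝ≥0∞ :=
  ⨅ (μ : Measure (pureStates (HTensor HA HB))) (_ : IsProbabilityMeasure μ)
    (_ : ∫ φ, (φ : Op (HTensor HA HB)) ∂μ = ω),
    ∫⁻ φ, entropy (margFst (φ : Op (HTensor HA HB))) ∂μ

end Information

end Squashed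

end

-- Both inequalities rest on one construction. Given a square summable family of vectors `ψ k` in
-- the AB space, attach to each its own basis vector of E, forming ∑ |ψ k⟩⟨ψ k| ⊗ |k⟩⟨k| (`flag`).
-- Tracing out E gives back ∑ |ψ k⟩⟨ψ k|, and the marginals AE, BE and E are block diagonal along
-- the flags. The blocks are pure, so their A and B marginals have the same nonzero spectrum. With H
-- extended homogeneously and H_k the entropy of the A marginal of `ψ k`, a normalised flagged state
-- has I(A:BE) = H(A) + ∑ H_k and I(A:E) + ∑ H_k = H(A). Hence I(A:BE) = I(A:E) + 2 ∑ H_k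
-- (`relEntropy_flag_eq`, `mutualInfo_flag`), and the factor ½ in the squashed entanglement leaves ∑
-- H_k, the cost of the ensemble.
--
-- A projector P_A in the extended conditional mutual information merely replaces `ψ k` by (P_A ⊗
-- 1)`ψ k`. This does not increase ∑ H_k (`homExt_entropy_opTensor_le`): a contraction on one factor
-- lowers the marginal on the other factor in the operator order, and the homogeneous entropy is
-- monotone (`homExt_entropy_mono`, from Klein's inequality). Flagging the vectors √πᵢ vᵢ of a
-- countable decomposition in ℓ² proves the discrete inequality.
--
-- A continuous ensemble may need uncountably many flags, but the second inequality only involves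
-- compressions to finite dimension. There the pair (compressed pure state, entropy cost of its
-- compression) lives in a finite-dimensional real space, where a barycenter lies in the convex hull
-- itself, not just in its closure (`integral_mem_convexHull`). So a finite ensemble reproduces both
-- the compressed state and the mean cost (`exists_finite_ensemble`), and finitely many flags
-- suffice.
--
-- Entropies may be infinite, so identities are kept additive in `[0, ∞]`. Quadratic forms and
-- squared overlaps of eigenbases take values there as well, and double sums are exchanged without
-- any convergence condition.

noncomputable section

open scoped TensorProduct ENNReal NNReal
open UniformSpace MeasureTheory InnerProductSpace

namespace Squashed

set_option linter.unusedSectionVars false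

universe u v w w'

/-! ## Squared norms, overlaps and quadratic forms with values in `[0, ∞]` -/

section Overlap

variable {H : Type u} [NormedAddCommGroup H] [InnerProductSpace ℂ H]
  {K : Type v} [NormedAddCommGroup K] [InnerProductSpace ℂ K]

/-- The squared norm, with values in `[0, ∞]`. -/
def nsq (x : H) : ℝ≥0∞ := ENNReal.ofReal (‖x‖ ^ 2)

/-- The squared overlap `|⟪x, y⟫|²`, with values in `[0, ∞]`. -/
def ov (x y : H) : ℝ≥0∞ := ENNReal.ofReal (‖inner ℂ x y‖ ^ 2)

/-- The quadratic form `⟪x, T x⟫`, with values in `[0, ∞]`. -/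
def qf (T : Op H) (x : H) : ℝ≥0∞ := ENNReal.ofReal (inner ℂ x (T x)).re

lemma ov_comm (x y : H) : ov x y = ov y x := by
  rw [ov, ov, norm_inner_symm]

lemma ov_adjoint_right [CompleteSpace H] [CompleteSpace K] (T : H →L[ℂ] K) (x : K) (y : H) :
    ov (T.adjoint x) y = ov x (T y) := by
  rw [ov, ov, ContinuousLinearMap.adjoint_inner_left]

lemma ov_adjoint_left [CompleteSpace H] [CompleteSpace K] (T : H →L[ℂ] K) (x : H) (y : K) :
    ov x (T.adjoint y) = ov (T x) y := by
  rw [ov, ov, ContinuousLinearMap.adjoint_inner_right]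

lemma ov_smul_left (c : ℂ) (x y : H) : ov (c • x) y = ENNReal.ofReal (‖c‖ ^ 2) * ov x y := by
  rw [ov, ov, inner_smul_left, norm_mul, mul_pow, ENNReal.ofReal_mul (by positivity)]
  simp

lemma nsq_smul (c : ℂ) (x : H) : nsq (c • x) = ENNReal.ofReal (‖c‖ ^ 2) * nsq x := by
  rw [nsq, nsq, norm_smul, mul_pow, ENNReal.ofReal_mul (by positivity)]

@[simp] lemma ov_zero_left (y : H) : ov 0 y = 0 := by simp [ov]

@[simp] lemma nsq_zero : nsq (0 : H) = 0 := by simp [nsq]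

lemma nsq_eq_zero {x : H} : nsq x = 0 ↔ x = 0 := by
  simp [nsq]

lemma ov_eq_zero {x y : H} : ov x y = 0 ↔ inner ℂ x y = 0 := by
  simp [ov]

lemma nsq_ne_top (x : H) : nsq x ≠ ∞ := ENNReal.ofReal_ne_top

lemma nsq_map_le (T : H →L[ℂ] K) (x : H) : nsq (T x) ≤ ENNReal.ofReal (‖T‖ ^ 2) * nsq x := by
  rw [nsq, nsq, ← ENNReal.ofReal_mul (by positivity), ← mul_pow]
  exact ENNReal.ofReal_le_ofReal (by gcongr; exact T.le_opNorm x)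

lemma nsq_basis {ι : Type*} (b : HilbertBasis ι ℂ H) (i : ι) : nsq (b i) = 1 := by
  simp [nsq, b.orthonormal.1 i]

/-- Parseval. Applied to unit vectors of another basis, it makes the matrix of squared overlaps
doubly stochastic. -/
lemma tsum_ov_basis {ι : Type*} (b : HilbertBasis ι ℂ H) (x : H) :
    ∑' i, ov (b i) x = nsq x := by
  have h := (b.hasSum_inner_mul_inner x x).mapL (RCLike.reCLM (K := ℂ))
  have h2 : ∀ i, RCLike.reCLM (K := ℂ) (inner ℂ x (b i) * inner ℂ (b i) x)
      = ‖inner ℂ (b i) x‖ ^ 2 := by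
    intro i
    rw [← inner_conj_symm x (b i), RCLike.conj_mul]
    simp [← Complex.ofReal_pow]
  simp only [h2] at h
  rw [nsq, ← inner_self_eq_norm_sq (𝕜 := ℂ) x]
  rw [show RCLike.re (inner ℂ x x) = RCLike.reCLM (K := ℂ) (inner ℂ x x) from rfl, ← h.tsum_eq,
    ENNReal.ofReal_tsum_of_nonneg (fun _ => by positivity) h.summable]
  rfl

lemma tsum_ov_basis' {ι : Type*} (b : HilbertBasis ι ℂ H) (x : H) :
    ∑' i, ov x (b i) = nsq x := by
  simp_rw [ov_comm x, tsum_ov_basis]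

lemma ov_self (x : H) : ov x x = nsq x * nsq x := by
  rw [ov, nsq, inner_self_eq_norm_sq_to_K, ← ENNReal.ofReal_mul (by positivity)]
  simp [sq]

lemma _root_.HilbertBasis.ext_inner {ι : Type*} (b : HilbertBasis ι ℂ H) {x y : H}
    (h : ∀ i, inner ℂ (b i) x = inner ℂ (b i) y) : x = y := by
  apply b.repr.injective
  ext i
  rw [b.repr_apply_apply, b.repr_apply_apply, h]

lemma _root_.HilbertBasis.inner_ne {ι : Type*} (b : HilbertBasis ι ℂ H) {i j : ι} (h : i ≠ j) :
    inner ℂ (b i) (b j) = 0 := b.orthonormal.2 h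

lemma _root_.HilbertBasis.inner_self {ι : Type*} (b : HilbertBasis ι ℂ H) (i : ι) :
    inner ℂ (b i) (b i) = 1 := by
  rw [inner_self_eq_norm_sq_to_K, b.orthonormal.1 i]; simp

/-- A complete orthonormal family, as a Hilbert basis. -/
lemma exists_basis_of_total [CompleteSpace H] {ι : Type*} {e : ι → H} (he : Orthonormal ℂ e)
    (ht : ∀ z, (∀ i, inner ℂ (e i) z = 0) → z = 0) : ∃ b : HilbertBasis ι ℂ H, ⇑b = e := by
  refine ⟨HilbertBasis.mkOfOrthogonalEqBot he ?_, HilbertBasis.coe_mkOfOrthogonalEqBot _ _⟩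
  rw [eq_bot_iff]
  intro z hz
  rw [Submodule.mem_bot]
  exact ht z fun i => (Submodule.mem_orthogonal _ _).1 hz _ (Submodule.subset_span ⟨i, rfl⟩)

end Overlap

/-! ## Elementary tensors -/

section Tensor

variable {HA : Type u} {HB : Type v} {KA : Type w} {KB : Type w'}
  [NormedAddCommGroup HA] [InnerProductSpace ℂ HA]
  [NormedAddCommGroup HB] [InnerProductSpace ℂ HB]
  [NormedAddCommGroup KA] [InnerProductSpace ℂ KA]
  [NormedAddCommGroup KB] [InnerProductSpace ℂ KB]

/-- The elementary tensor `a ⊗ b` in the Hilbert space tensor product. -/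
def ht (a : HA) (b : HB) : HTensor HA HB := ((a ⊗ₜ[ℂ] b : HA ⊗[ℂ] HB) : HTensor HA HB)

lemma tmulRight_apply (a : HA) (b : HB) : tmulRight HA b a = ht a b := rfl

lemma tmulLeft_apply (a : HA) (b : HB) : tmulLeft HB a b = ht a b := rfl

lemma opTensor_ht (S : HA →L[ℂ] KA) (T : HB →L[ℂ] KB) (a : HA) (b : HB) :
    opTensor S T (ht a b) = ht (S a) (T b) := by
  rw [opTensor, ht, ContinuousLinearMap.completion_apply_coe]
  rfl

lemma inner_ht (a a' : HA) (b b' : HB) :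
    inner ℂ (ht a b) (ht a' b') = inner ℂ a a' * inner ℂ b b' := by
  rw [ht, ht, Completion.inner_coe, TensorProduct.inner_tmul]

lemma ht_smul_right (c : ℂ) (a : HA) (b : HB) : ht a (c • b) = c • ht a b := by
  rw [← tmulLeft_apply, map_smul, tmulLeft_apply]

lemma ht_smul_left (c : ℂ) (a : HA) (b : HB) : ht (c • a) b = c • ht a b := by
  rw [← tmulRight_apply, map_smul, tmulRight_apply]

/-- Elementary tensors span a dense subspace and the inner product is continuous. With `clm_ht_ext`
this reduces operator identities on tensor products to elementary tensors. -/
lemma ht_ext {z : HTensor HA HB} (h : ∀ a b, inner ℂ (ht a b) z = 0) : z = 0 := by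
  have h1 : ∀ t : HA ⊗[ℂ] HB, inner ℂ (t : HTensor HA HB) z = 0 := by
    intro t
    induction t using TensorProduct.induction_on with
    | zero => exact inner_zero_left _
    | tmul a b => exact h a b
    | add x y hx hy => rw [Completion.coe_add, inner_add_left, hx, hy, add_zero]
  have h2 : (fun t : HTensor HA HB => inner ℂ t z) = fun _ => (0 : ℂ) :=
    Completion.ext (by fun_prop) (by fun_prop) h1
  exact inner_self_eq_zero.1 (congrFun h2 z)

lemma clm_ht_ext {K : Type*} [NormedAddCommGroup K] [InnerProductSpace ℂ K]
    {S T : HTensor HA HB →L[ℂ] K} (h : ∀ a b, S (ht a b) = T (ht a b)) : S = T := by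
  have h1 : ∀ t : HA ⊗[ℂ] HB, S (t : HTensor HA HB) = T t := by
    intro t
    induction t using TensorProduct.induction_on with
    | zero => exact (map_zero S).trans (map_zero T).symm
    | tmul a b => exact h a b
    | add x y hx hy => rw [Completion.coe_add, map_add, map_add, hx, hy]
  ext t
  exact congrFun (Completion.ext S.continuous T.continuous h1) t

lemma nsq_ht (a : HA) (b : HB) : nsq (ht a b) = nsq a * nsq b := by
  have : ‖ht a b‖ ^ 2 = ‖a‖ ^ 2 * ‖b‖ ^ 2 := by
    rw [ht, Completion.norm_coe, TensorProduct.norm_tmul, mul_pow]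
  rw [nsq, this, ENNReal.ofReal_mul (by positivity)]
  rfl

lemma ov_ht (a a' : HA) (b b' : HB) : ov (ht a b) (ht a' b') = ov a a' * ov b b' := by
  rw [ov, inner_ht, norm_mul, mul_pow, ENNReal.ofReal_mul (by positivity)]
  rfl

lemma opTensor_comp {LA : Type*} {LB : Type*} [NormedAddCommGroup LA] [InnerProductSpace ℂ LA]
    [NormedAddCommGroup LB] [InnerProductSpace ℂ LB]
    (S : HA →L[ℂ] KA) (T : HB →L[ℂ] KB) (S' : KA →L[ℂ] LA) (T' : KB →L[ℂ] LB) :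
    opTensor S' T' ∘L opTensor S T = opTensor (S' ∘L S) (T' ∘L T) :=
  clm_ht_ext fun a b => by simp [opTensor_ht]

lemma opTensor_id : opTensor (.id ℂ HA) (.id ℂ HB) = .id ℂ (HTensor HA HB) :=
  clm_ht_ext fun a b => by simp [opTensor_ht]

lemma opTensor_zero_right (S : HA →L[ℂ] KA) : opTensor S (0 : HB →L[ℂ] KB) = 0 :=
  clm_ht_ext fun a b => by
    rw [opTensor_ht, ← tmulLeft_apply]; exact map_zero _

variable [CompleteSpace HA] [CompleteSpace HB] [CompleteSpace KA] [CompleteSpace KB]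

lemma opTensor_adjoint (S : HA →L[ℂ] KA) (T : HB →L[ℂ] KB) :
    (opTensor S T).adjoint = opTensor S.adjoint T.adjoint := by
  refine clm_ht_ext fun a b => ?_
  rw [← sub_eq_zero]
  refine ht_ext fun a' b' => ?_
  rw [inner_sub_right, ContinuousLinearMap.adjoint_inner_right, opTensor_ht, opTensor_ht,
    inner_ht, inner_ht, ContinuousLinearMap.adjoint_inner_right,
    ContinuousLinearMap.adjoint_inner_right, sub_self]

lemma tmulRight_adjoint_ht (a : HA) (b b' : HB) :
    (tmulRight HA b').adjoint (ht a b) = inner ℂ b' b • a := by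
  refine ext_inner_left ℂ fun x => ?_
  rw [ContinuousLinearMap.adjoint_inner_right, tmulRight_apply, inner_ht, inner_smul_right, mul_comm]

lemma tmulLeft_adjoint_ht (a a' : HA) (b : HB) :
    (tmulLeft HB a').adjoint (ht a b) = inner ℂ a' a • b := by
  refine ext_inner_left ℂ fun x => ?_
  rw [ContinuousLinearMap.adjoint_inner_right, tmulLeft_apply, inner_ht, inner_smul_right]

end Tensor

/-! ## Orthogonal decompositions into copies of one Hilbert space -/

section Decomp

variable {κ : Type*} {H : Type u} {K : Type v}
  [NormedAddCommGroup H] [InnerProductSpace ℂ H] [CompleteSpace H]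
  [NormedAddCommGroup K] [InnerProductSpace ℂ K] [CompleteSpace K]

/-- The maps `J k` are isometric embeddings of `H` whose ranges decompose `K` orthogonally. -/
structure IsDecomp (J : κ → H →L[ℂ] K) : Prop where
  adj_self : ∀ k, (J k).adjoint ∘L J k = .id ℂ H
  adj_ne : ∀ k l, k ≠ l → (J k).adjoint ∘L J l = 0
  total : ∀ z, (∀ k, (J k).adjoint z = 0) → z = 0

namespace IsDecomp

variable {J : κ → H →L[ℂ] K} (hJ : IsDecomp J)
include hJ

lemma adj_apply (k : κ) (x : H) : (J k).adjoint (J k x) = x :=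
  congrArg (fun T => T x) (hJ.adj_self k)

lemma adj_apply_ne {k l : κ} (h : k ≠ l) (x : H) : (J k).adjoint (J l x) = 0 :=
  congrArg (fun T => T x) (hJ.adj_ne k l h)

lemma inner_same (k : κ) (x y : H) : inner ℂ (J k x) (J k y) = inner ℂ x y := by
  rw [← ContinuousLinearMap.adjoint_inner_right, hJ.adj_apply]

lemma inner_ne {k l : κ} (h : k ≠ l) (x y : H) : inner ℂ (J k x) (J l y) = 0 := by
  rw [← ContinuousLinearMap.adjoint_inner_right, hJ.adj_apply_ne h, inner_zero_right]

lemma ov_same (k : κ) (x y : H) : ov (J k x) (J k y) = ov x y := by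
  rw [ov, ov, hJ.inner_same]

lemma ov_ne {k l : κ} (h : k ≠ l) (x y : H) : ov (J k x) (J l y) = 0 := by
  rw [ov_eq_zero, hJ.inner_ne h]

lemma nsq_map (k : κ) (x : H) : nsq (J k x) = nsq x := by
  have : ‖J k x‖ ^ 2 = ‖x‖ ^ 2 := by
    rw [← inner_self_eq_norm_sq (𝕜 := ℂ), ← inner_self_eq_norm_sq (𝕜 := ℂ), hJ.inner_same]
  rw [nsq, nsq, this]

/-- Bases of the copies of H glue to a basis of K. Eigenbases of block diagonal operators and of
tensor products are obtained this way. -/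
lemma exists_basis {ι : κ → Type*} (b : ∀ k, HilbertBasis (ι k) ℂ H) :
    ∃ c : HilbertBasis (Σ k, ι k) ℂ K, ∀ k i, c ⟨k, i⟩ = J k (b k i) := by
  classical
  obtain ⟨c, hc⟩ := exists_basis_of_total (e := fun p : Σ k, ι k => J p.1 (b p.1 p.2)) (by
      rw [orthonormal_iff_ite]
      rintro ⟨k, i⟩ ⟨l, j⟩
      by_cases hkl : k = l
      · subst hkl
        rw [hJ.inner_same, orthonormal_iff_ite.1 (b k).orthonormal]
        simp
      · rw [hJ.inner_ne hkl, if_neg (fun h => hkl (congrArg Sigma.fst h)) ])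
    (by
      intro z hz
      refine hJ.total z fun k => (b k).ext_inner fun i => ?_
      rw [ContinuousLinearMap.adjoint_inner_right, inner_zero_right]
      exact hz ⟨k, i⟩)
  exact ⟨c, fun k i => by rw [hc]⟩

lemma tsum_nsq_adjoint (z : K) : ∑' k, nsq ((J k).adjoint z) = nsq z := by
  obtain ⟨c, hc⟩ := hJ.exists_basis (fun _ => onb H)
  rw [← tsum_ov_basis c, ENNReal.tsum_sigma']
  refine tsum_congr fun k => ?_
  rw [← tsum_ov_basis (onb H)]
  refine tsum_congr fun i => ?_
  rw [hc, ov_adjoint_left]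

end IsDecomp

variable {HA : Type u} {HB : Type v} [NormedAddCommGroup HA] [InnerProductSpace ℂ HA]
  [CompleteSpace HA] [NormedAddCommGroup HB] [InnerProductSpace ℂ HB] [CompleteSpace HB]

lemma isDecomp_tmulRight {κ : Type*} (b : HilbertBasis κ ℂ HB) :
    IsDecomp (fun k => tmulRight HA (b k)) where
  adj_self k := by
    ext x
    simp [tmulRight_apply, tmulRight_adjoint_ht, b.orthonormal.1 k]
  adj_ne k l h := by
    ext x
    simp [tmulRight_apply, tmulRight_adjoint_ht, b.inner_ne h]
  total z hz := by
    refine ht_ext fun x y => ?_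
    rw [← tmulLeft_apply, ← ContinuousLinearMap.adjoint_inner_right]
    suffices (tmulLeft HB x).adjoint z = 0 by rw [this, inner_zero_right]
    refine b.ext_inner fun k => ?_
    rw [ContinuousLinearMap.adjoint_inner_right, tmulLeft_apply, ← tmulRight_apply,
      ← ContinuousLinearMap.adjoint_inner_right, hz, inner_zero_right, inner_zero_right]

lemma isDecomp_tmulLeft {κ : Type*} (b : HilbertBasis κ ℂ HA) :
    IsDecomp (fun k => tmulLeft HB (b k)) where
  adj_self k := by
    ext x
    simp [tmulLeft_apply, tmulLeft_adjoint_ht, b.orthonormal.1 k]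
  adj_ne k l h := by
    ext x
    simp [tmulLeft_apply, tmulLeft_adjoint_ht, b.inner_ne h]
  total z hz := by
    refine ht_ext fun x y => ?_
    rw [← tmulRight_apply, ← ContinuousLinearMap.adjoint_inner_right]
    suffices (tmulRight HA y).adjoint z = 0 by rw [this, inner_zero_right]
    refine b.ext_inner fun k => ?_
    rw [ContinuousLinearMap.adjoint_inner_right, tmulRight_apply, ← tmulLeft_apply,
      ← ContinuousLinearMap.adjoint_inner_right, hz, inner_zero_right, inner_zero_right]

lemma IsDecomp.opTensor_left (HA : Type*) [NormedAddCommGroup HA] [InnerProductSpace ℂ HA]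
    [CompleteSpace HA] {J : κ → H →L[ℂ] K} (hJ : IsDecomp J) :
    IsDecomp (fun k => opTensor (.id ℂ HA) (J k)) where
  adj_self k := by
    rw [opTensor_adjoint, opTensor_comp, hJ.adj_self, ContinuousLinearMap.adjoint_id,
      ContinuousLinearMap.id_comp, opTensor_id]
  adj_ne k l h := by
    rw [opTensor_adjoint, opTensor_comp, hJ.adj_ne k l h, opTensor_zero_right]
  total z hz := by
    refine ht_ext fun x y => ?_
    rw [← tmulLeft_apply, ← ContinuousLinearMap.adjoint_inner_right]
    suffices (tmulLeft K x).adjoint z = 0 by rw [this, inner_zero_right]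
    refine hJ.total _ fun k => ext_inner_left ℂ fun w => ?_
    rw [ContinuousLinearMap.adjoint_inner_right, ContinuousLinearMap.adjoint_inner_right,
      tmulLeft_apply, inner_zero_right]
    have := congrArg (inner ℂ (ht x w)) (hz k)
    rwa [ContinuousLinearMap.adjoint_inner_right, opTensor_ht, inner_zero_right] at this

end Decomp

/-! ## Sums of rank one operators -/

section KetSum

variable {ι : Type*} {κ : Type*} {H : Type u} [NormedAddCommGroup H] [InnerProductSpace ℂ H]
  [CompleteSpace H] {K : Type v} [NormedAddCommGroup K] [InnerProductSpace ℂ K] [CompleteSpace K]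

/-- A square summable family of vectors. -/
def SqSummable (ξ : ι → H) : Prop := ∑' i, nsq (ξ i) ≠ ∞

/-- The positive trace class operator `∑ |ξ i⟩⟨ξ i|`. -/
def ketSum (ξ : ι → H) : Op H := ∑' i, rankOne ℂ (ξ i) (ξ i)

lemma SqSummable.summable {ξ : ι → H} (h : SqSummable ξ) : Summable fun i => ‖ξ i‖ ^ 2 := by
  have := ENNReal.summable_toReal h
  refine this.congr fun i => ?_
  rw [nsq, ENNReal.toReal_ofReal (by positivity)]

lemma SqSummable.map {ξ : ι → H} (h : SqSummable ξ) (T : H →L[ℂ] K) :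
    SqSummable fun i => T (ξ i) := by
  refine ne_top_of_le_ne_top ?_ (ENNReal.tsum_le_tsum fun i => nsq_map_le T (ξ i))
  rw [ENNReal.tsum_mul_left]
  exact ENNReal.mul_ne_top ENNReal.ofReal_ne_top h

lemma IsDecomp.tsum_nsq_prod {J : κ → H →L[ℂ] K} (hJ : IsDecomp J) (ξ : ι → K) :
    ∑' p : κ × ι, nsq ((J p.1).adjoint (ξ p.2)) = ∑' i, nsq (ξ i) := by
  rw [ENNReal.tsum_prod (f := fun k i => nsq ((J k).adjoint (ξ i))), ENNReal.tsum_comm]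
  exact tsum_congr fun i => hJ.tsum_nsq_adjoint _

lemma SqSummable.adjoint {J : κ → H →L[ℂ] K} (hJ : IsDecomp J) {ξ : ι → K} (h : SqSummable ξ) :
    SqSummable fun p : κ × ι => (J p.1).adjoint (ξ p.2) := by
  rw [SqSummable, hJ.tsum_nsq_prod]
  exact h

lemma norm_rankOne_self (x : H) : ‖rankOne ℂ x x‖ = ‖x‖ ^ 2 := by
  rw [norm_rankOne, sq]

lemma SqSummable.summable_rankOne {ξ : ι → H} (h : SqSummable ξ) :
    Summable fun i => rankOne ℂ (ξ i) (ξ i) := by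
  refine Summable.of_norm ?_
  simpa only [norm_rankOne_self] using h.summable

lemma SqSummable.hasSum {ξ : ι → H} (h : SqSummable ξ) :
    HasSum (fun i => rankOne ℂ (ξ i) (ξ i)) (ketSum ξ) := h.summable_rankOne.hasSum

lemma SqSummable.hasSum_apply {ξ : ι → H} (h : SqSummable ξ) (x : H) :
    HasSum (fun i => inner ℂ (ξ i) x • ξ i) (ketSum ξ x) :=
  h.hasSum.mapL (ContinuousLinearMap.apply ℂ H x)

lemma SqSummable.hasSum_inner {ξ : ι → H} (h : SqSummable ξ) (x y : H) :
    HasSum (fun i => inner ℂ (ξ i) y * inner ℂ x (ξ i)) (inner ℂ x (ketSum ξ y)) := by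
  simpa [inner_smul_right] using (h.hasSum_apply y).mapL (innerSL ℂ x)

/-- No summability is needed: a divergent `tsum` is 0, which is positive as well. -/
lemma isPositive_ketSum (ξ : ι → H) : (ketSum ξ).IsPositive := by
  rw [← ContinuousLinearMap.nonneg_iff_isPositive]
  refine tsum_nonneg fun i => ?_
  rw [ContinuousLinearMap.nonneg_iff_isPositive]
  exact isPositive_rankOne_self _

lemma SqSummable.qf_ketSum {ξ : ι → H} (h : SqSummable ξ) (x : H) :
    qf (ketSum ξ) x = ∑' i, ov (ξ i) x := by
  have h1 := (h.hasSum_inner x x).mapL (RCLike.reCLM (K := ℂ))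
  have h2 : ∀ i, RCLike.reCLM (K := ℂ) (inner ℂ (ξ i) x * inner ℂ x (ξ i))
      = ‖inner ℂ (ξ i) x‖ ^ 2 := by
    intro i
    rw [← inner_conj_symm x (ξ i), RCLike.mul_conj]
    simp [← Complex.ofReal_pow]
  simp only [h2] at h1
  rw [qf, show (inner ℂ x (ketSum ξ x)).re = RCLike.reCLM (K := ℂ) (inner ℂ x (ketSum ξ x)) from rfl,
    ← h1.tsum_eq, ENNReal.ofReal_tsum_of_nonneg (fun _ => by positivity) h1.summable]
  rfl

lemma qf_rankOne (x y : H) : qf (rankOne ℂ x x) y = ov x y := by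
  rw [qf, rankOne_apply, inner_smul_right, ← inner_conj_symm y x, RCLike.mul_conj, ov]
  simp [← Complex.ofReal_pow]

/-- By complex polarisation the quadratic form determines the operator; positivity ensures that the
truncation in `ENNReal.ofReal` loses nothing. -/
lemma ext_qf {S T : Op H} (hS : S.IsPositive) (hT : T.IsPositive) (h : ∀ x, qf S x = qf T x) :
    S = T := by
  have h0 : ∀ x, inner ℂ x ((S - T) x) = 0 := by
    intro x
    have h1 := h x
    have hs := (hS.inner_nonneg_right x)
    have htt := (hT.inner_nonneg_right x)
    rw [Complex.le_def] at hs htt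
    rw [qf, qf, ENNReal.ofReal_eq_ofReal_iff (by simpa using hs.1) (by simpa using htt.1)] at h1
    rw [sub_apply, inner_sub_right, sub_eq_zero]
    exact Complex.ext h1 (hs.2.symm.trans htt.2)
  have h2 : ((S - T : Op H) : H →ₗ[ℂ] H) = 0 := by
    rw [← inner_map_self_eq_zero]
    intro x
    rw [← inner_conj_symm]
    rw [ContinuousLinearMap.coe_coe, h0 x, map_zero]
  rw [← sub_eq_zero]
  ext x
  exact congrArg (fun T => T x) h2

lemma ketSum_eq_of_qf {ξ : ι → H} {η : κ → H} (hξ : SqSummable ξ) (hη : SqSummable η)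
    (h : ∀ x, ∑' i, ov (ξ i) x = ∑' i, ov (η i) x) : ketSum ξ = ketSum η :=
  ext_qf (isPositive_ketSum ξ) (isPositive_ketSum η) fun x => by
    rw [hξ.qf_ketSum, hη.qf_ketSum, h]

lemma conj_rankOne (T : H →L[ℂ] K) (x : H) :
    T ∘L rankOne ℂ x x ∘L T.adjoint = rankOne ℂ (T x) (T x) := by
  ext y
  simp [rankOne_apply, ContinuousLinearMap.adjoint_inner_right]

lemma SqSummable.conj {ξ : ι → H} (h : SqSummable ξ) (T : H →L[ℂ] K) :
    T ∘L ketSum ξ ∘L T.adjoint = ketSum fun i => T (ξ i) := by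
  have h1 := (h.hasSum.mapL
    ((ContinuousLinearMap.compL ℂ K H K T) ∘L ((ContinuousLinearMap.compL ℂ K H H).flip T.adjoint)))
  refine h1.unique ?_
  simpa [conj_rankOne] using (h.map T).hasSum

lemma SqSummable.trace_ketSum {ξ : ι → H} (h : SqSummable ξ) :
    trace (ketSum ξ) = ∑' i, nsq (ξ i) := by
  have : trace (ketSum ξ) = ∑' i, qf (ketSum ξ) (onb H i) := rfl
  rw [this]
  simp_rw [h.qf_ketSum]
  rw [ENNReal.tsum_comm]
  exact tsum_congr fun i => tsum_ov_basis' _ _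

lemma ketSum_unique [Unique ι] (ξ : ι → H) : ketSum ξ = rankOne ℂ (ξ default) (ξ default) := by
  rw [ketSum, tsum_eq_single default (fun i hi => absurd (Subsingleton.elim i default) hi)]

lemma rankOne_eq_ketSum (x : H) : rankOne ℂ x x = ketSum fun _ : Unit => x :=
  (ketSum_unique fun _ : Unit => x).symm

lemma sqSummable_of_finite [Finite ι] (ξ : ι → H) : SqSummable ξ := by
  have := Fintype.ofFinite ι
  rw [SqSummable, tsum_fintype, ← lt_top_iff_ne_top]
  exact ENNReal.sum_lt_top.2 fun i _ => ENNReal.ofReal_lt_top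

lemma trace_rankOne (x : H) : trace (rankOne ℂ x x) = nsq x := by
  rw [rankOne_eq_ketSum, (sqSummable_of_finite _).trace_ketSum]
  simp

lemma smul_rankOne_self (c : ℝ) (hc : 0 ≤ c) (x : H) :
    c • rankOne ℂ x x = rankOne ℂ (((√c : ℝ) : ℂ) • x) (((√c : ℝ) : ℂ) • x) := by
  ext y
  simp only [smul_apply, rankOne_apply, inner_smul_left, Complex.conj_ofReal,
    smul_smul]
  rw [mul_right_comm, ← Complex.ofReal_mul, Real.mul_self_sqrt hc]
  rw [← Complex.coe_smul, smul_smul]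

lemma smul_ketSum (c : ℝ) (hc : 0 ≤ c) (ξ : ι → H) :
    c • ketSum ξ = ketSum fun i => ((√c : ℝ) : ℂ) • ξ i := by
  rw [ketSum, ketSum, ← tsum_const_smul'']
  exact tsum_congr fun i => smul_rankOne_self c hc _

lemma SqSummable.smul {ξ : ι → H} (h : SqSummable ξ) (c : ℂ) : SqSummable fun i => c • ξ i := by
  simp_rw [SqSummable, nsq_smul, ENNReal.tsum_mul_left]
  exact ENNReal.mul_ne_top ENNReal.ofReal_ne_top h

/-- Common form of all partial traces: slicing every vector along the decomposition. Pythagoras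
makes the double family square summable, so the two sums may be merged. -/
lemma IsDecomp.tsum_conj_ketSum {J : κ → H →L[ℂ] K} (hJ : IsDecomp J) {ξ : ι → K}
    (h : SqSummable ξ) :
    ∑' k, (J k).adjoint ∘L ketSum ξ ∘L J k
      = ketSum fun p : κ × ι => (J p.1).adjoint (ξ p.2) := by
  conv_rhs => rw [ketSum, (SqSummable.adjoint hJ h).summable_rankOne.tsum_prod]
  refine tsum_congr fun k => ?_
  have := h.conj (J k).adjoint
  rwa [ContinuousLinearMap.adjoint_adjoint] at this

lemma qf_conj (T : H →L[ℂ] K) (S : Op K) (x : H) : qf (T.adjoint ∘L S ∘L T) x = qf S (T x) := by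
  simp [qf, ContinuousLinearMap.adjoint_inner_right]

lemma SqSummable.isCompactOperator {ξ : ι → H} (h : SqSummable ξ) :
    IsCompactOperator (ketSum ξ) := by
  refine isCompactOperator_of_tendsto h.hasSum (Filter.Eventually.of_forall fun s => ?_)
  induction s using Finset.cons_induction with
  | empty => simpa using isCompactOperator_zero
  | cons i s hi ih =>
    rw [Finset.sum_cons]
    refine IsCompactOperator.add ?_ ih
    rw [rankOne_def']
    exact (isCompactOperator_of_locallyCompactSpace_rng
      (ContinuousLinearMap.toSpanSingleton ℂ (ξ i))).comp_clm _

end KetSum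

-- Existence of eigenbases

section EigenBasis

variable {H : Type u} [NormedAddCommGroup H] [InnerProductSpace ℂ H] [CompleteSpace H]

/-- The spectral theorem for compact symmetric operators. -/
lemma nonempty_eigenBasis {T : Op H} (hc : IsCompactOperator T)
    (hs : (T : H →ₗ[ℂ] H).IsSymmetric) : Nonempty (EigenBasis T) := by
  classical
  let E : ℂ → Submodule ℂ H := fun μ => Module.End.eigenspace (T : H →ₗ[ℂ] H) μ
  have hE : ∀ μ x, x ∈ E μ ↔ T x = μ • x := fun μ x => Module.End.mem_eigenspace_iff
  have hcl : ∀ μ, CompleteSpace (E μ) := fun μ => by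
    have : IsClosed ((E μ : Submodule ℂ H) : Set H) := by
      have : ((E μ : Submodule ℂ H) : Set H) = {x | T x = μ • x} := Set.ext fun x => hE μ x
      rw [this]
      exact isClosed_eq (by fun_prop) (by fun_prop)
    exact this.completeSpace_coe
  have horth := hs.orthogonalFamily_eigenspaces.orthonormal_sigma_orthonormal
    (v_family := fun μ => onb (E μ)) (fun μ => (onb (E μ)).orthonormal)
  obtain ⟨b, hb⟩ := exists_basis_of_total horth (by
    intro z hz
    have hz' : z ∈ (⨆ μ, E μ)ᗮ := by
      rw [← Submodule.iInf_orthogonal, Submodule.mem_iInf]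
      intro μ
      rw [Submodule.mem_orthogonal]
      intro y hy
      have h1 : (E μ).subtypeL.adjoint z = 0 := by
        refine (onb (E μ)).ext_inner fun i => ?_
        rw [ContinuousLinearMap.adjoint_inner_right, inner_zero_right]
        exact hz ⟨μ, i⟩
      have h2 := ContinuousLinearMap.adjoint_inner_right (E μ).subtypeL ⟨y, hy⟩ z
      rw [h1, inner_zero_right] at h2
      exact h2.symm
    rw [ContinuousLinearMap.orthogonalComplement_iSup_eigenspaces_eq_bot hc hs] at hz'
    exact hz')
  -- Eigenvalues of a symmetric operator are real, so taking the real part changes nothing.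
  refine ⟨⟨_, b, fun p => p.1.re, fun p => ?_⟩⟩
  have hmem : b p ∈ E p.1 := by
    rw [hb]
    exact (onb (E p.1) p.2).2
  have hval : Module.End.HasEigenvalue (T : H →ₗ[ℂ] H) p.1 :=
    Module.End.hasEigenvalue_of_hasEigenvector ⟨hmem, b.orthonormal.ne_zero p⟩
  have hre : ((p.1.re : ℝ) : ℂ) = p.1 := by
    have := hs.conj_eigenvalue_eq_self hval
    exact Complex.conj_eq_iff_re.1 this
  rw [hre]
  exact (hE _ _).1 hmem

end EigenBasis

/-! ## Operators with a basis of eigenvectors -/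

section Diagonal

variable {H : Type u} [NormedAddCommGroup H] [InnerProductSpace ℂ H] [CompleteSpace H]

namespace EigenBasis

lemma val_eq_of_inner_ne_zero {T : Op H} (hs : (T : H →ₗ[ℂ] H).IsSymmetric) {x y : H} {r s : ℝ}
    (hx : T x = (r : ℂ) • x) (hy : T y = (s : ℂ) • y) (h : inner ℂ x y ≠ 0) : r = s := by
  have h1 : inner ℂ (T x) y = inner ℂ x (T y) := hs x y
  rw [hx, hy, inner_smul_left, inner_smul_right, Complex.conj_ofReal] at h1
  exact_mod_cast mul_right_cancel₀ h h1

lemma val_nonneg {T : Op H} (hT : T.IsPositive) (e : EigenBasis T) (i : e.ι) : 0 ≤ e.val i := by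
  have h := hT.inner_nonneg_right (e.vec i)
  rw [e.apply_vec, inner_smul_right, e.vec.inner_self, mul_one] at h
  exact_mod_cast h

/-- The eigenvectors for one eigenvalue resolve the projection onto the eigenspace. -/
lemma tsum_ov_fiber {T : Op H} (hs : (T : H →ₗ[ℂ] H).IsSymmetric) (r : ℝ) (x : H) :
    ∃ c : ℝ≥0∞, ∀ e : EigenBasis T, ∑' i, (if e.val i = r then ov (e.vec i) x else 0) = c := by
  classical
  let E : Submodule ℂ H := Module.End.eigenspace (T : H →ₗ[ℂ] H) (r : ℂ)
  have hE : ∀ x, x ∈ E ↔ T x = (r : ℂ) • x := fun x => Module.End.mem_eigenspace_iff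
  have : CompleteSpace E := by
    have h1 : IsClosed ((E : Submodule ℂ H) : Set H) := by
      have : ((E : Submodule ℂ H) : Set H) = {x | T x = (r : ℂ) • x} := Set.ext fun x => hE x
      rw [this]
      exact isClosed_eq (by fun_prop) (by fun_prop)
    exact h1.completeSpace_coe
  let S : E →L[ℂ] H := E.subtypeL
  -- S S* is the orthogonal projection onto the eigenspace, which does not refer to any eigenbasis.
  refine ⟨nsq (S (S.adjoint x)), fun e => ?_⟩
  rw [← tsum_ov_basis e.vec]
  refine tsum_congr fun i => ?_
  split_ifs with h
  · have hmem : e.vec i ∈ E := by rw [hE, e.apply_vec, h]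
    have h1 : S.adjoint (e.vec i) = ⟨e.vec i, hmem⟩ := by
      refine ext_inner_left ℂ fun y => ?_
      rw [ContinuousLinearMap.adjoint_inner_right]
      rfl
    rw [← ov_adjoint_right, h1, ov_adjoint_left]
    rfl
  · have h1 : S.adjoint (e.vec i) = 0 := by
      refine ext_inner_left ℂ fun y => ?_
      rw [ContinuousLinearMap.adjoint_inner_right, inner_zero_right]
      by_contra h2
      exact h (val_eq_of_inner_ne_zero hs ((hE _).1 y.2) (e.apply_vec i) h2).symm
    rw [← ov_adjoint_right, h1, ov_zero_left]

/-- Grouping the terms by eigenvalue leaves the squared norms of the projections of x onto the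
eigenspaces, which are the same for every eigenbasis. The function g may be arbitrary. -/
lemma tsum_ov_eq {T : Op H} (hs : (T : H →ₗ[ℂ] H).IsSymmetric) (e e' : EigenBasis T)
    (g : ℝ → ℝ≥0∞) (x : H) :
    ∑' i, ov (e.vec i) x * g (e.val i) = ∑' i, ov (e'.vec i) x * g (e'.val i) := by
  classical
  have key : ∀ e : EigenBasis T, ∑' i, ov (e.vec i) x * g (e.val i)
      = ∑' r : ℝ, (∑' i, (if e.val i = r then ov (e.vec i) x else 0)) * g r := by
    intro e
    simp_rw [← ENNReal.tsum_mul_right]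
    rw [ENNReal.tsum_comm]
    refine tsum_congr fun i => ?_
    simp_rw [ite_mul, zero_mul]
    rw [tsum_eq_single (e.val i) (fun r hr => if_neg hr.symm), if_pos rfl]
  rw [key e, key e']
  refine tsum_congr fun r => ?_
  obtain ⟨c, hc⟩ := tsum_ov_fiber hs r x
  rw [hc e, hc e']

lemma qf_eq {T : Op H} (hs : (T : H →ₗ[ℂ] H).IsSymmetric) (e : EigenBasis T)
    (h0 : ∀ i, 0 ≤ e.val i) (x : H) :
    qf T x = ∑' i, ov (e.vec i) x * ENNReal.ofReal (e.val i) := by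
  have h1 := (e.vec.hasSum_inner_mul_inner x (T x)).mapL (RCLike.reCLM (K := ℂ))
  have h2 : ∀ i, RCLike.reCLM (K := ℂ) (inner ℂ x (e.vec i) * inner ℂ (e.vec i) (T x))
      = ‖inner ℂ (e.vec i) x‖ ^ 2 * e.val i := by
    intro i
    have h3 : inner ℂ (e.vec i) (T x) = inner ℂ (T (e.vec i)) x := (hs _ _).symm
    rw [h3, e.apply_vec, inner_smul_left, Complex.conj_ofReal, ← inner_conj_symm x (e.vec i),
      mul_left_comm, RCLike.conj_mul, mul_comm]
    simp [← Complex.ofReal_pow, ← Complex.ofReal_mul]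
  simp only [h2] at h1
  rw [qf, show (inner ℂ x (T x)).re = RCLike.reCLM (K := ℂ) (inner ℂ x (T x)) from rfl,
    ← h1.tsum_eq, ENNReal.ofReal_tsum_of_nonneg
      (fun i => mul_nonneg (by positivity) (h0 i)) h1.summable]
  exact tsum_congr fun i => ENNReal.ofReal_mul (by positivity)

lemma trace_eq {T : Op H} (hs : (T : H →ₗ[ℂ] H).IsSymmetric) (e : EigenBasis T)
    (h0 : ∀ i, 0 ≤ e.val i) : trace T = ∑' i, ENNReal.ofReal (e.val i) := by
  have h : trace T = ∑' i, qf T (onb H i) := rfl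
  rw [h]
  simp_rw [qf_eq hs e h0]
  rw [ENNReal.tsum_comm]
  refine tsum_congr fun i => ?_
  rw [ENNReal.tsum_mul_right, tsum_ov_basis', nsq_basis, one_mul]

/-- Rescaling an operator rescales its eigenvalues. -/
def smul {T : Op H} (e : EigenBasis T) (c : ℝ) : EigenBasis (c • T) where
  ι := e.ι
  vec := e.vec
  val i := c * e.val i
  apply_vec i := by
    rw [smul_apply, e.apply_vec, Complex.ofReal_mul, mul_smul, ← Complex.coe_smul]

end EigenBasis

/-- The defining infimum runs over equal values: `EigenBasis.tsum_ov_eq` exchanges first the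
eigenbasis of σ, then that of ρ. Afterwards each relative entropy can be computed in the most
convenient bases. -/
lemma relEntropy_eq {ρ σ : Op H} (hρ : (ρ : H →ₗ[ℂ] H).IsSymmetric)
    (hσ : (σ : H →ₗ[ℂ] H).IsSymmetric) (e : EigenBasis ρ) (f : EigenBasis σ) :
    relEntropy ρ σ = ∑' i, ∑' j, ov (e.vec i) (f.vec j) * relTerm (e.val i) (f.val j) := by
  refine le_antisymm (iInf_le_of_le e (iInf_le _ f)) (le_iInf fun e' => le_iInf fun f' =>
    le_of_eq ?_)
  change _ = ∑' i, ∑' j, ov (e'.vec i) (f'.vec j) * relTerm (e'.val i) (f'.val j)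
  have h1 : ∀ i, ∑' j, ov (e.vec i) (f.vec j) * relTerm (e.val i) (f.val j)
      = ∑' j, ov (e.vec i) (f'.vec j) * relTerm (e.val i) (f'.val j) := fun i => by
    simp_rw [ov_comm (e.vec i)]
    exact EigenBasis.tsum_ov_eq hσ f f' (relTerm (e.val i)) (e.vec i)
  simp_rw [h1]
  rw [ENNReal.tsum_comm, ENNReal.tsum_comm (f := fun i j => ov (e'.vec i) (f'.vec j) * _)]
  exact tsum_congr fun j => EigenBasis.tsum_ov_eq hρ e e' (fun x => relTerm x (f'.val j)) _

/-! ### Functional calculus and entropy -/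

lemma mem_spectrum_of_eigenvector {T : Op H} {r : ℝ} {x : H} (hx : x ≠ 0)
    (h : T x = (r : ℂ) • x) : r ∈ spectrum ℝ T := by
  rw [spectrum.mem_iff]
  intro hu
  obtain ⟨S, hS⟩ := hu.exists_left_inv
  have h1 : S ((algebraMap ℝ (Op H) r - T) x) = x := congrArg (fun A : Op H => A x) hS
  have h2 : (algebraMap ℝ (Op H) r - T) x = 0 := by
    rw [sub_apply, h, Algebra.algebraMap_eq_smul_one, smul_apply, Complex.coe_smul, sub_eq_zero]
    rfl
  rw [h2, map_zero] at h1
  exact hx h1.symm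

/-- Stone–Weierstrass: the property holds for constants and the identity, and passes to sums,
products and uniform limits. -/
lemma cfc_apply_eigenvector {T : Op H} (hT : IsSelfAdjoint T) {g : ℝ → ℝ}
    (hg : ContinuousOn g (spectrum ℝ T)) {r : ℝ} {x : H} (hx : x ≠ 0)
    (h : T x = (r : ℂ) • x) : cfc g T x = (g r : ℂ) • x := by
  have hr := mem_spectrum_of_eigenvector hx h
  rw [cfc_apply g T hT hg]
  suffices H : ∀ f : C(spectrum ℝ T, ℝ), cfcHom hT f x = (f ⟨r, hr⟩ : ℂ) • x from H _
  intro f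
  induction f using ContinuousMap.induction_on_of_compact with
  | const c =>
    have : (ContinuousMap.const (spectrum ℝ T) c) = algebraMap ℝ C(spectrum ℝ T, ℝ) c := rfl
    rw [this, AlgHomClass.commutes, Algebra.algebraMap_eq_smul_one, smul_apply]
    simp
  | id =>
    rw [cfcHom_id]
    simpa using h
  | star_id =>
    rw [map_star, cfcHom_id, hT.star_eq]
    simpa using h
  | add f g hf hg =>
    rw [map_add, add_apply, hf, hg, ContinuousMap.add_apply, Complex.ofReal_add, add_smul]
  | mul f g hf hg =>
    rw [map_mul]
    change cfcHom hT f (cfcHom hT g x) = _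
    rw [hg, map_smul, hf, smul_smul, mul_comm]
    simp
  | frequently f hf =>
    have hc : IsClosed {f : C(spectrum ℝ T, ℝ) | cfcHom hT f x = (f ⟨r, hr⟩ : ℂ) • x} := by
      refine isClosed_eq ?_ ?_
      · exact (ContinuousLinearMap.apply ℂ H x).continuous.comp (cfcHom_continuous hT)
      · exact (Complex.continuous_ofReal.comp (continuous_eval_const _)).smul
          continuous_const
    exact hc.closure_subset (mem_closure_iff_frequently.2 hf)

/-- An eigenbasis of ρ is one of η(ρ). The trace bound puts the eigenvalues in [0, 1], where η is
nonnegative, so nothing is truncated. -/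
lemma entropy_eq {ρ : Op H} (hρ : ρ.IsPositive) (htr : trace ρ ≤ 1) (e : EigenBasis ρ) :
    entropy ρ = ∑' i, ENNReal.ofReal (Real.negMulLog (e.val i)) := by
  have hsa : IsSelfAdjoint ρ := hρ.isSelfAdjoint
  let f : EigenBasis (cfc Real.negMulLog ρ) :=
    { ι := e.ι
      vec := e.vec
      val := fun i => Real.negMulLog (e.val i)
      apply_vec := fun i => cfc_apply_eigenvector hsa
        Real.continuous_negMulLog.continuousOn (e.vec.orthonormal.ne_zero i) (e.apply_vec i) }
  refine EigenBasis.trace_eq (cfc_predicate Real.negMulLog ρ).isSymmetric f fun i => ?_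
  refine Real.negMulLog_nonneg (e.val_nonneg hρ i) ?_
  rw [e.trace_eq hρ.isSymmetric (e.val_nonneg hρ)] at htr
  have := (ENNReal.le_tsum i).trans htr
  rwa [ENNReal.ofReal_le_one] at this

lemma trace_smul {T : Op H} {c : ℝ} (hc : 0 ≤ c) : trace (c • T) = ENNReal.ofReal c * trace T := by
  rw [trace, trace, ← ENNReal.tsum_mul_left]
  refine tsum_congr fun i => ?_
  rw [← ENNReal.ofReal_mul hc, smul_apply, inner_smul_right_eq_smul]
  simp

lemma trace_smul_inv_self {T : Op H} (h0 : trace T ≠ 0) (ht : trace T ≠ ∞) :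
    trace ((trace T).toReal⁻¹ • T) = 1 := by
  rw [trace_smul (by positivity), ENNReal.ofReal_inv_of_pos (ENNReal.toReal_pos h0 ht),
    ENNReal.ofReal_toReal ht, ENNReal.inv_mul_cancel h0 ht]

lemma isPositive_smul {T : Op H} (hT : T.IsPositive) {c : ℝ} (hc : 0 ≤ c) :
    (c • T).IsPositive := by
  rw [← ContinuousLinearMap.nonneg_iff_isPositive] at hT ⊢
  exact smul_nonneg hc hT

/-- The homogeneous extension of the entropy in terms of eigenvalues. -/
lemma homExt_entropy_eq {R : Op H} (hR : R.IsPositive) (ht : trace R ≠ ∞) (e : EigenBasis R) :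
    homExt entropy R = ∑' i, ENNReal.ofReal (e.val i)
      * ENNReal.ofReal (Real.log (trace R).toReal - Real.log (e.val i)) := by
  have hsum := e.trace_eq hR.isSymmetric (e.val_nonneg hR)
  rw [homExt]
  by_cases h0 : trace R = 0
  · rw [h0, zero_mul]
    symm
    rw [ENNReal.tsum_eq_zero]
    intro i
    rw [h0] at hsum
    rw [ENNReal.tsum_eq_zero.1 hsum.symm i, zero_mul]
  · set p := (trace R).toReal with hp
    have hp0 : 0 < p := ENNReal.toReal_pos h0 ht
    have hpR : trace R = ENNReal.ofReal p := (ENNReal.ofReal_toReal ht).symm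
    rw [entropy_eq (isPositive_smul hR (by positivity)) (trace_smul_inv_self h0 ht).le
      (e.smul p⁻¹), ← ENNReal.tsum_mul_left]
    refine tsum_congr fun i => ?_
    have hv := e.val_nonneg hR i
    change trace R * ENNReal.ofReal (Real.negMulLog (p⁻¹ * e.val i)) = _
    rw [hpR, ← ENNReal.ofReal_mul hp0.le, ← ENNReal.ofReal_mul hv]
    congr 1
    rcases hv.eq_or_lt with h | h
    · rw [← h]; simp
    · rw [Real.negMulLog, Real.log_mul (by positivity) h.ne', Real.log_inv]
      field_simp
      ring

end Diagonal

/-! ## Positive trace class operators -/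

section TraceClass

variable {H : Type u} [NormedAddCommGroup H] [InnerProductSpace ℂ H] [CompleteSpace H]
  {ι : Type*}

/-- Positive trace class operators. -/
structure IsPosTraceClass (T : Op H) : Prop where
  pos : T.IsPositive
  compact : IsCompactOperator T
  trace_ne_top : trace T ≠ ∞

lemma SqSummable.isPosTraceClass {ξ : ι → H} (h : SqSummable ξ) : IsPosTraceClass (ketSum ξ) :=
  ⟨isPositive_ketSum ξ, h.isCompactOperator, by rw [h.trace_ketSum]; exact h⟩

lemma isPosTraceClass_rankOne (x : H) : IsPosTraceClass (rankOne ℂ x x) := by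
  rw [rankOne_eq_ketSum]
  exact (sqSummable_of_finite _).isPosTraceClass

namespace IsPosTraceClass

variable {T : Op H} (hT : IsPosTraceClass T)
include hT

lemma sym : (T : H →ₗ[ℂ] H).IsSymmetric := hT.pos.isSymmetric

/-- A basis of eigenvectors. -/
def eig : EigenBasis T := (nonempty_eigenBasis hT.compact hT.sym).some

lemma qf_eq (e : EigenBasis T) (x : H) :
    qf T x = ∑' i, ov (e.vec i) x * ENNReal.ofReal (e.val i) :=
  e.qf_eq hT.sym (e.val_nonneg hT.pos) x

lemma trace_eq (e : EigenBasis T) : trace T = ∑' i, ENNReal.ofReal (e.val i) :=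
  e.trace_eq hT.sym (e.val_nonneg hT.pos)

lemma val_le (e : EigenBasis T) (i : e.ι) : e.val i ≤ (trace T).toReal := by
  rw [← ENNReal.ofReal_le_iff_le_toReal hT.trace_ne_top, hT.trace_eq e]
  exact ENNReal.le_tsum i

lemma qf_vec (e : EigenBasis T) (i : e.ι) : qf T (e.vec i) = ENNReal.ofReal (e.val i) := by
  rw [qf, e.apply_vec, inner_smul_right, e.vec.inner_self, mul_one, Complex.ofReal_re]

lemma homExt_entropy (e : EigenBasis T) :
    homExt entropy T = ∑' i, ENNReal.ofReal (e.val i)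
      * ENNReal.ofReal (Real.log (trace T).toReal - Real.log (e.val i)) :=
  homExt_entropy_eq hT.pos hT.trace_ne_top e

lemma homExt_smul (F : Op H → ℝ≥0∞) {c : ℝ} (hc : 0 < c) :
    homExt F (c • T) = ENNReal.ofReal c * homExt F T := by
  rw [homExt, homExt, trace_smul hc.le, mul_assoc, smul_smul]
  congr 4
  rw [ENNReal.toReal_mul, ENNReal.toReal_ofReal hc.le, mul_inv, mul_comm c⁻¹, mul_assoc,
    inv_mul_cancel₀ hc.ne', mul_one]

end IsPosTraceClass

/-- This is log x ≤ x − 1 at x = (t/T)(r/l), multiplied by l: Klein's inequality for the normalised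
values l/t and r/T. Terms are placed so that every summand is nonnegative. -/
lemma klein_scaled {l r t T : ℝ} (hl : 0 < l) (hr : 0 < r) (ht : l ≤ t) (hT : r ≤ T) :
    ENNReal.ofReal l * ENNReal.ofReal (Real.log t - Real.log l) + ENNReal.ofReal l
      ≤ ENNReal.ofReal l * ENNReal.ofReal (Real.log T - Real.log r)
        + ENNReal.ofReal (t / T) * ENNReal.ofReal r := by
  have ht0 : 0 < t := hl.trans_le ht
  have hT0 : 0 < T := hr.trans_le hT
  have h1 : 0 ≤ Real.log t - Real.log l := sub_nonneg.2 (Real.log_le_log hl ht)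
  have h2 : 0 ≤ Real.log T - Real.log r := sub_nonneg.2 (Real.log_le_log hr hT)
  rw [← ENNReal.ofReal_mul hl.le, ← ENNReal.ofReal_mul hl.le,
    ← ENNReal.ofReal_mul (by positivity), ← ENNReal.ofReal_add (by positivity) hl.le,
    ← ENNReal.ofReal_add (by positivity) (by positivity)]
  refine ENNReal.ofReal_le_ofReal ?_
  have h3 := Real.log_le_sub_one_of_pos (x := t / T * r / l) (by positivity)
  rw [Real.log_div (by positivity) hl.ne', Real.log_mul (by positivity) hr.ne',
    Real.log_div ht0.ne' hT0.ne'] at h3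
  have h4 : l * (t / T * r / l) = t / T * r := by field_simp
  nlinarith [mul_le_mul_of_nonneg_left h3 hl.le]

/-- The homogeneous extension of the entropy is monotone. -/
lemma homExt_entropy_mono {σ ρ : Op H} (hσ : IsPosTraceClass σ) (hρ : IsPosTraceClass ρ)
    (h : ∀ x, qf σ x ≤ qf ρ x) : homExt entropy σ ≤ homExt entropy ρ := by
  by_cases h0 : trace σ = 0
  · rw [homExt, h0, zero_mul]; exact zero_le
  have hle : trace σ ≤ trace ρ := ENNReal.tsum_le_tsum fun i => h _
  have h0' : trace ρ ≠ 0 := fun h1 => h0 (le_antisymm (h1 ▸ hle) zero_le)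
  set e := hσ.eig
  set f := hρ.eig
  rw [hσ.homExt_entropy e, hρ.homExt_entropy f]
  set t := (trace σ).toReal
  set T := (trace ρ).toReal
  have hT0 : 0 < T := ENNReal.toReal_pos h0' hρ.trace_ne_top
  have ht0 : 0 < t := ENNReal.toReal_pos h0 hσ.trace_ne_top
  -- Adding the finite trace of σ to both sides lets the scaled Klein inequality be applied to each
  -- pair of eigenvalues without subtraction.
  rw [← ENNReal.add_le_add_iff_right hσ.trace_ne_top]
  have hpt : ∀ i j, ov (e.vec i) (f.vec j) * (ENNReal.ofReal (e.val i) *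
        ENNReal.ofReal (Real.log t - Real.log (e.val i)) + ENNReal.ofReal (e.val i))
      ≤ ov (e.vec i) (f.vec j) * (ENNReal.ofReal (e.val i) *
        ENNReal.ofReal (Real.log T - Real.log (f.val j))
        + ENNReal.ofReal (t / T) * ENNReal.ofReal (f.val j)) := by
    intro i j
    by_cases hD : ov (e.vec i) (f.vec j) = 0
    · rw [hD, zero_mul, zero_mul]
    rcases (e.val_nonneg hσ.pos i).eq_or_lt with hl | hl
    · rw [← hl]; simp
    rcases (f.val_nonneg hρ.pos j).eq_or_lt with hr | hr
    -- If the j-th eigenvalue of ρ vanishes, the form of σ vanishes on that eigenvector too, which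
    -- contradicts a nonzero overlap with a positive eigenvalue of σ.
    · exfalso
      have h1 := h (f.vec j)
      rw [hρ.qf_vec, ← hr, ENNReal.ofReal_zero, nonpos_iff_eq_zero, hσ.qf_eq e,
        ENNReal.tsum_eq_zero] at h1
      rcases mul_eq_zero.1 (h1 i) with h2 | h2
      · exact hD h2
      · exact hl.not_ge (ENNReal.ofReal_eq_zero.1 h2)
    · exact mul_le_mul' le_rfl <| klein_scaled hl hr (hσ.val_le e i) (hρ.val_le f j)
  calc _ = ∑' i, ∑' j, ov (e.vec i) (f.vec j) * (ENNReal.ofReal (e.val i) *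
        ENNReal.ofReal (Real.log t - Real.log (e.val i)) + ENNReal.ofReal (e.val i)) := by
        simp_rw [ENNReal.tsum_mul_right, tsum_ov_basis', nsq_basis, one_mul]
        rw [ENNReal.tsum_add, ← hσ.trace_eq e]
    _ ≤ _ := ENNReal.tsum_le_tsum fun i => ENNReal.tsum_le_tsum fun j => hpt i j
    _ = ∑' j, (qf σ (f.vec j) * ENNReal.ofReal (Real.log T - Real.log (f.val j))
        + ENNReal.ofReal (t / T) * ENNReal.ofReal (f.val j)) := by
        rw [ENNReal.tsum_comm]
        refine tsum_congr fun j => ?_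
        simp_rw [mul_add, ← mul_assoc]
        rw [ENNReal.tsum_add, ENNReal.tsum_mul_right, ← hσ.qf_eq e]
        simp_rw [mul_assoc]
        rw [ENNReal.tsum_mul_right, tsum_ov_basis, nsq_basis, one_mul]
    -- The weights log T − log r are nonnegative, so σ may be replaced by ρ. The correction terms
    -- sum to (t/T)·T = t, the trace added at the start.
    _ ≤ _ := by
        rw [ENNReal.tsum_add, ENNReal.tsum_mul_left, ← hρ.trace_eq f]
        gcongr with j
        · rw [← hρ.qf_vec f]
          exact h _
        · rw [← ENNReal.ofReal_toReal hρ.trace_ne_top, ← ENNReal.ofReal_mul (by positivity),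
            div_mul_cancel₀ _ hT0.ne', ENNReal.ofReal_toReal hσ.trace_ne_top]

end TraceClass

/-! ## Marginals of sums of rank one operators -/

section Marginals

variable {HA : Type u} {HB : Type v} {HE : Type w} {ι : Type*}
  [NormedAddCommGroup HA] [InnerProductSpace ℂ HA] [CompleteSpace HA]
  [NormedAddCommGroup HB] [InnerProductSpace ℂ HB] [CompleteSpace HB]
  [NormedAddCommGroup HE] [InnerProductSpace ℂ HE] [CompleteSpace HE]

section AB

variable {ξ : ι → HTensor HA HB} (h : SqSummable ξ)
include h

lemma margFst_ketSum : margFst (ketSum ξ)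
    = ketSum fun p : onbIndex HB × ι => (tmulRight HA (onb HB p.1)).adjoint (ξ p.2) :=
  (isDecomp_tmulRight (onb HB)).tsum_conj_ketSum h

lemma margSnd_ketSum : margSnd (ketSum ξ)
    = ketSum fun p : onbIndex HA × ι => (tmulLeft HB (onb HA p.1)).adjoint (ξ p.2) :=
  (isDecomp_tmulLeft (onb HA)).tsum_conj_ketSum h

lemma isPosTraceClass_margFst : IsPosTraceClass (margFst (ketSum ξ)) := by
  rw [margFst_ketSum h]
  exact (h.adjoint (isDecomp_tmulRight (onb HB))).isPosTraceClass

lemma isPosTraceClass_margSnd : IsPosTraceClass (margSnd (ketSum ξ)) := by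
  rw [margSnd_ketSum h]
  exact (h.adjoint (isDecomp_tmulLeft (onb HA))).isPosTraceClass

lemma trace_margFst : trace (margFst (ketSum ξ)) = ∑' i, nsq (ξ i) := by
  rw [margFst_ketSum h, (h.adjoint (isDecomp_tmulRight (onb HB))).trace_ketSum,
    (isDecomp_tmulRight (onb HB)).tsum_nsq_prod]

lemma trace_margSnd : trace (margSnd (ketSum ξ)) = ∑' i, nsq (ξ i) := by
  rw [margSnd_ketSum h, (h.adjoint (isDecomp_tmulLeft (onb HA))).trace_ketSum,
    (isDecomp_tmulLeft (onb HA)).tsum_nsq_prod]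

/-- Parseval in the traced factor removes the fixed basis from the partial trace; this basis-free
form is the one used to compare marginals. -/
lemma qf_margFst (x : HA) :
    qf (margFst (ketSum ξ)) x = ∑' i, nsq ((tmulLeft HB x).adjoint (ξ i)) := by
  rw [margFst_ketSum h, (h.adjoint (isDecomp_tmulRight (onb HB))).qf_ketSum,
    ENNReal.tsum_prod (f := fun j i => ov ((tmulRight HA (onb HB j)).adjoint (ξ i)) x),
    ENNReal.tsum_comm]
  refine tsum_congr fun i => ?_
  rw [← tsum_ov_basis' (onb HB)]
  refine tsum_congr fun j => ?_
  rw [ov_adjoint_right, ov_adjoint_right]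
  rfl

lemma qf_margSnd (y : HB) :
    qf (margSnd (ketSum ξ)) y = ∑' i, nsq ((tmulRight HA y).adjoint (ξ i)) := by
  rw [margSnd_ketSum h, (h.adjoint (isDecomp_tmulLeft (onb HA))).qf_ketSum,
    ENNReal.tsum_prod (f := fun j i => ov ((tmulLeft HB (onb HA j)).adjoint (ξ i)) y),
    ENNReal.tsum_comm]
  refine tsum_congr fun i => ?_
  rw [← tsum_ov_basis' (onb HA)]
  refine tsum_congr fun j => ?_
  rw [ov_adjoint_right, ov_adjoint_right]
  rfl

end AB

-- Marginals of a pure state: common spectrum and local contractions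

section Pure

variable (v : HTensor HA HB)

lemma isPosTraceClass_margFst_rankOne : IsPosTraceClass (margFst (rankOne ℂ v v)) := by
  rw [rankOne_eq_ketSum]
  exact isPosTraceClass_margFst (sqSummable_of_finite _)

lemma isPosTraceClass_margSnd_rankOne : IsPosTraceClass (margSnd (rankOne ℂ v v)) := by
  rw [rankOne_eq_ketSum]
  exact isPosTraceClass_margSnd (sqSummable_of_finite _)

lemma trace_margFst_rankOne : trace (margFst (rankOne ℂ v v)) = nsq v := by
  rw [rankOne_eq_ketSum, trace_margFst (sqSummable_of_finite _)]
  simp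

lemma trace_margSnd_rankOne : trace (margSnd (rankOne ℂ v v)) = nsq v := by
  rw [rankOne_eq_ketSum, trace_margSnd (sqSummable_of_finite _)]
  simp

lemma qf_margFst_rankOne (x : HA) :
    qf (margFst (rankOne ℂ v v)) x = nsq ((tmulLeft HB x).adjoint v) := by
  rw [rankOne_eq_ketSum, qf_margFst (sqSummable_of_finite _)]
  simp

lemma qf_margSnd_rankOne (y : HB) :
    qf (margSnd (rankOne ℂ v v)) y = nsq ((tmulRight HA y).adjoint v) := by
  rw [rankOne_eq_ketSum, qf_margSnd (sqSummable_of_finite _)]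
  simp

/-- The A marginal is the Gram matrix of the slices of v. Along an eigenbasis of the marginal the
slices are therefore orthogonal, as in a Schmidt decomposition. -/
lemma inner_margFst_rankOne (x y : HA) : inner ℂ x (margFst (rankOne ℂ v v) y)
    = inner ℂ ((tmulLeft HB y).adjoint v) ((tmulLeft HB x).adjoint v) := by
  rw [rankOne_eq_ketSum, margFst_ketSum (sqSummable_of_finite _)]
  have h := ((sqSummable_of_finite fun _ : Unit => v).adjoint
    (isDecomp_tmulRight (HA := HA) (onb HB))).hasSum_inner x y
  have h2 := (onb HB).hasSum_inner_mul_inner ((tmulLeft HB y).adjoint v) ((tmulLeft HB x).adjoint v)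
  rw [← h.tsum_eq, ← h2.tsum_eq, ← (Equiv.prodPUnit (onbIndex HB)).symm.tsum_eq]
  refine tsum_congr fun k => ?_
  rw [ContinuousLinearMap.adjoint_inner_left, ContinuousLinearMap.adjoint_inner_left,
    ContinuousLinearMap.adjoint_inner_right, ContinuousLinearMap.adjoint_inner_right]
  rfl

/-- The vectors `⟨eᵢ| v` are eigenvectors of the second marginal. -/
lemma margSnd_rankOne_apply (e : EigenBasis (margFst (rankOne ℂ v v))) (i : e.ι) :
    margSnd (rankOne ℂ v v) ((tmulLeft HB (e.vec i)).adjoint v)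
      = (e.val i : ℂ) • (tmulLeft HB (e.vec i)).adjoint v := by
  have hss : SqSummable fun i => (tmulLeft HB (e.vec i)).adjoint v := by
    rw [SqSummable, (isDecomp_tmulLeft e.vec).tsum_nsq_adjoint]
    exact nsq_ne_top v
  -- The partial trace over A may be taken in the eigenbasis e instead of the fixed basis.
  have h1 : margSnd (rankOne ℂ v v) = ketSum fun i => (tmulLeft HB (e.vec i)).adjoint v := by
    refine ext_qf (isPosTraceClass_margSnd_rankOne v).pos (isPositive_ketSum _) fun y => ?_
    rw [qf_margSnd_rankOne, hss.qf_ketSum, ← tsum_ov_basis' e.vec]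
    refine tsum_congr fun j => ?_
    rw [ov_adjoint_right, ov_adjoint_right]
    rfl
  rw [h1]
  refine (hss.hasSum_apply _).unique ?_
  -- The Gram matrix of the slices is diagonal, so only the term j = i survives in the series.
  have h2 : ∀ j, inner ℂ ((tmulLeft HB (e.vec j)).adjoint v) ((tmulLeft HB (e.vec i)).adjoint v)
      = (e.val j : ℂ) * inner ℂ (e.vec i) (e.vec j) := fun j => by
    rw [← inner_margFst_rankOne, e.apply_vec, inner_smul_right]
  simp_rw [h2]
  have h3 : HasSum (fun j => ((e.val j : ℂ) * inner ℂ (e.vec i) (e.vec j)) •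
      (tmulLeft HB (e.vec j)).adjoint v) (((e.val i : ℂ) * inner ℂ (e.vec i) (e.vec i)) •
      (tmulLeft HB (e.vec i)).adjoint v) := by
    refine hasSum_single i fun j hj => ?_
    rw [e.vec.inner_ne hj.symm, mul_zero, zero_smul]
  rwa [e.vec.inner_self, mul_one] at h3

/-- The marginals of a pure state have the same nonzero spectrum. -/
lemma tsum_val_margFst_eq_margSnd (e : EigenBasis (margFst (rankOne ℂ v v)))
    (f : EigenBasis (margSnd (rankOne ℂ v v))) (G : ℝ → ℝ≥0∞) :
    ∑' i, ENNReal.ofReal (e.val i) * G (e.val i)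
      = ∑' j, ENNReal.ofReal (f.val j) * G (f.val j) := by
  have hA := isPosTraceClass_margFst_rankOne v
  have hB := isPosTraceClass_margSnd_rankOne v
  -- Both sums become double sums over the squared overlaps of v with products of eigenvectors.
  have h1 : ∀ i, ENNReal.ofReal (e.val i) * G (e.val i)
      = ∑' j, ov v (ht (e.vec i) (f.vec j)) * G (e.val i) := fun i => by
    rw [ENNReal.tsum_mul_right, ← hA.qf_vec e, qf_margFst_rankOne, ← tsum_ov_basis' f.vec]
    simp_rw [ov_adjoint_right]
    rfl
  have h2 : ∀ j, ENNReal.ofReal (f.val j) * G (f.val j)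
      = ∑' i, ov v (ht (e.vec i) (f.vec j)) * G (f.val j) := fun j => by
    rw [ENNReal.tsum_mul_right, ← hB.qf_vec f, qf_margSnd_rankOne, ← tsum_ov_basis' e.vec]
    simp_rw [ov_adjoint_right]
    rfl
  rw [tsum_congr h1, tsum_congr h2, ENNReal.tsum_comm]
  refine tsum_congr fun j => tsum_congr fun i => ?_
  -- A nonzero overlap means that the i-th slice, an eigenvector of the B marginal, is not
  -- orthogonal to the j-th one, so the two eigenvalues agree.
  by_cases h : inner ℂ v (ht (e.vec i) (f.vec j)) = 0
  · rw [ov_eq_zero.2 h, zero_mul, zero_mul]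
  · have h3 : inner ℂ ((tmulLeft HB (e.vec i)).adjoint v) (f.vec j) ≠ 0 := by
      rwa [ContinuousLinearMap.adjoint_inner_left]
    rw [EigenBasis.val_eq_of_inner_ne_zero hB.sym (margSnd_rankOne_apply v e i)
      (f.apply_vec j) h3]

lemma homExt_entropy_margFst_eq_margSnd :
    homExt entropy (margFst (rankOne ℂ v v)) = homExt entropy (margSnd (rankOne ℂ v v)) := by
  have hA := isPosTraceClass_margFst_rankOne v
  have hB := isPosTraceClass_margSnd_rankOne v
  rw [hA.homExt_entropy hA.eig, hB.homExt_entropy hB.eig, trace_margFst_rankOne,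
    trace_margSnd_rankOne]
  exact tsum_val_margFst_eq_margSnd v hA.eig hB.eig
    fun s => ENNReal.ofReal (Real.log (nsq v).toReal - Real.log s)

lemma nsq_map_le_of_contraction {H : Type*} [NormedAddCommGroup H] [InnerProductSpace ℂ H]
    {T : Op H} (hT : ‖T‖ ≤ 1) (x : H) : nsq (T x) ≤ nsq x := by
  refine (nsq_map_le T x).trans ?_
  calc _ ≤ ENNReal.ofReal (1 ^ 2) * nsq x := by gcongr
    _ = nsq x := by simp

/-- Local contractions do not increase the homogeneous entropy of the marginal of a pure state. -/
lemma homExt_entropy_opTensor_le {S : Op HA} {T : Op HB} (hS : ‖S‖ ≤ 1) (hT : ‖T‖ ≤ 1) :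
    homExt entropy (margFst (rankOne ℂ (opTensor S T v) (opTensor S T v)))
      ≤ homExt entropy (margFst (rankOne ℂ v v)) := by
  -- A contraction on B acts on the slices ⟨x|w, so it lowers the A marginal in the operator order.
  have key1 : ∀ w : HTensor HA HB,
      homExt entropy (margFst (rankOne ℂ (opTensor (.id ℂ HA) T w) (opTensor (.id ℂ HA) T w)))
        ≤ homExt entropy (margFst (rankOne ℂ w w)) := fun w => by
    refine homExt_entropy_mono (isPosTraceClass_margFst_rankOne _)
      (isPosTraceClass_margFst_rankOne _) fun x => ?_
    rw [qf_margFst_rankOne, qf_margFst_rankOne]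
    have : (tmulLeft HB x).adjoint (opTensor (.id ℂ HA) T w) = T ((tmulLeft HB x).adjoint w) := by
      have h1 : (tmulLeft HB x).adjoint ∘L opTensor (.id ℂ HA) T = T ∘L (tmulLeft HB x).adjoint :=
        clm_ht_ext fun a b => by simp [opTensor_ht, tmulLeft_adjoint_ht]
      exact congrArg (fun A => A w) h1
    rw [this]
    exact nsq_map_le_of_contraction hT _
  -- A contraction on A does not lower the A marginal in general, but it lowers the B marginal,
  -- which has the same entropy.
  have key2 : ∀ w : HTensor HA HB,
      homExt entropy (margFst (rankOne ℂ (opTensor S (.id ℂ HB) w) (opTensor S (.id ℂ HB) w)))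
        ≤ homExt entropy (margFst (rankOne ℂ w w)) := fun w => by
    rw [homExt_entropy_margFst_eq_margSnd, homExt_entropy_margFst_eq_margSnd]
    refine homExt_entropy_mono (isPosTraceClass_margSnd_rankOne _)
      (isPosTraceClass_margSnd_rankOne _) fun x => ?_
    rw [qf_margSnd_rankOne, qf_margSnd_rankOne]
    have : (tmulRight HA x).adjoint (opTensor S (.id ℂ HB) w) = S ((tmulRight HA x).adjoint w) := by
      have h1 : (tmulRight HA x).adjoint ∘L opTensor S (.id ℂ HB) = S ∘L (tmulRight HA x).adjoint :=
        clm_ht_ext fun a b => by simp [opTensor_ht, tmulRight_adjoint_ht]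
      exact congrArg (fun A => A w) h1
    rw [this]
    exact nsq_map_le_of_contraction hS _
  have h : opTensor S T v = opTensor (.id ℂ HA) T (opTensor S (.id ℂ HB) v) := by
    have := opTensor_comp S (.id ℂ HB) (.id ℂ HA) T
    rw [ContinuousLinearMap.id_comp, ContinuousLinearMap.comp_id] at this
    exact congrArg (fun A => A v) this.symm
  rw [h]
  exact (key1 _).trans (key2 v)

end Pure

end Marginals

/-! ## Eigenbases of block operators and tensor products -/

section Blocks

variable {H : Type u} [NormedAddCommGroup H] [InnerProductSpace ℂ H] [CompleteSpace H]
  {κ : Type w} {K : Type (max u w)} [NormedAddCommGroup K] [InnerProductSpace ℂ K] [CompleteSpace K]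

/-- An eigenbasis of an operator which is block diagonal for an orthogonal decomposition. -/
def EigenBasis.ofDecomp {J : κ → H →L[ℂ] K} (hJ : IsDecomp J) {ω : Op K} {ρ : κ → Op H}
    (h : ∀ k x, ω (J k x) = J k (ρ k x)) (e : ∀ k, EigenBasis (ρ k)) : EigenBasis ω where
  ι := Σ k, (e k).ι
  vec := (hJ.exists_basis fun k => (e k).vec).choose
  val p := (e p.1).val p.2
  apply_vec p := by
    rw [(hJ.exists_basis fun k => (e k).vec).choose_spec p.1 p.2, h, (e p.1).apply_vec, map_smul]

lemma EigenBasis.ofDecomp_vec {J : κ → H →L[ℂ] K} (hJ : IsDecomp J) {ω : Op K} {ρ : κ → Op H}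
    (h : ∀ k x, ω (J k x) = J k (ρ k x)) (e : ∀ k, EigenBasis (ρ k)) (k : κ) (i : (e k).ι) :
    (EigenBasis.ofDecomp hJ h e).vec ⟨k, i⟩ = J k ((e k).vec i) :=
  (hJ.exists_basis fun k => (e k).vec).choose_spec k i

/-- The eigenbasis of `S ⊗ T` formed by products of eigenvectors. -/
def EigenBasis.tensor {HA : Type u} {HB : Type v} [NormedAddCommGroup HA] [InnerProductSpace ℂ HA]
    [CompleteSpace HA] [NormedAddCommGroup HB] [InnerProductSpace ℂ HB] [CompleteSpace HB]
    {S : Op HA} {T : Op HB} (e : EigenBasis S) (f : EigenBasis T) :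
    EigenBasis (opTensor S T) where
  ι := Σ _ : e.ι, f.ι
  vec := ((isDecomp_tmulLeft e.vec).exists_basis fun _ => f.vec).choose
  val p := e.val p.1 * f.val p.2
  apply_vec p := by
    rw [((isDecomp_tmulLeft e.vec).exists_basis fun _ => f.vec).choose_spec p.1 p.2,
      tmulLeft_apply, opTensor_ht, e.apply_vec, f.apply_vec, ht_smul_left, ht_smul_right, smul_smul,
      Complex.ofReal_mul]

lemma EigenBasis.tensor_vec {HA : Type u} {HB : Type v} [NormedAddCommGroup HA]
    [InnerProductSpace ℂ HA]
    [CompleteSpace HA] [NormedAddCommGroup HB] [InnerProductSpace ℂ HB] [CompleteSpace HB]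
    {S : Op HA} {T : Op HB} (e : EigenBasis S) (f : EigenBasis T) (i : e.ι) (j : f.ι) :
    (e.tensor f).vec ⟨i, j⟩ = ht (e.vec i) (f.vec j) :=
  ((isDecomp_tmulLeft e.vec).exists_basis fun _ => f.vec).choose_spec i j

lemma EigenBasis.tsum_ofDecomp {J : κ → H →L[ℂ] K} (hJ : IsDecomp J) {ω : Op K} {ρ : κ → Op H}
    (h : ∀ k x, ω (J k x) = J k (ρ k x)) (e : ∀ k, EigenBasis (ρ k)) (F : K → ℝ → ℝ≥0∞) :
    ∑' p, F ((EigenBasis.ofDecomp hJ h e).vec p) ((EigenBasis.ofDecomp hJ h e).val p)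
      = ∑' k, ∑' i, F (J k ((e k).vec i)) ((e k).val i) := by
  refine (ENNReal.tsum_sigma' _).trans (tsum_congr fun k => tsum_congr fun i => ?_)
  rw [EigenBasis.ofDecomp_vec]
  rfl

lemma EigenBasis.tsum_tensor {HA : Type u} {HB : Type v} [NormedAddCommGroup HA]
    [InnerProductSpace ℂ HA]
    [CompleteSpace HA] [NormedAddCommGroup HB] [InnerProductSpace ℂ HB] [CompleteSpace HB]
    {S : Op HA} {T : Op HB} (e : EigenBasis S) (f : EigenBasis T)
    (F : HTensor HA HB → ℝ → ℝ≥0∞) :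
    ∑' p, F ((e.tensor f).vec p) ((e.tensor f).val p)
      = ∑' i, ∑' j, F (ht (e.vec i) (f.vec j)) (e.val i * f.val j) := by
  refine (ENNReal.tsum_sigma' _).trans (tsum_congr fun i => tsum_congr fun j => ?_)
  rw [EigenBasis.tensor_vec]
  rfl

lemma isSymmetric_opTensor {HA : Type*} {HB : Type*} [NormedAddCommGroup HA]
    [InnerProductSpace ℂ HA]
    [CompleteSpace HA] [NormedAddCommGroup HB] [InnerProductSpace ℂ HB] [CompleteSpace HB]
    {S : Op HA} {T : Op HB} (hS : S.IsPositive) (hT : T.IsPositive) :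
    (opTensor S T : HTensor HA HB →ₗ[ℂ] HTensor HA HB).IsSymmetric := by
  rw [← ContinuousLinearMap.isSelfAdjoint_iff_isSymmetric,
    ContinuousLinearMap.isSelfAdjoint_iff', opTensor_adjoint,
    ContinuousLinearMap.isSelfAdjoint_iff'.1 hS.isSelfAdjoint,
    ContinuousLinearMap.isSelfAdjoint_iff'.1 hT.isSelfAdjoint]

/-- Terms carried by a copy l ≠ k annihilate the range of J k, so the sum is block diagonal. -/
lemma IsDecomp.ketSum_apply {K : Type*} [NormedAddCommGroup K] [InnerProductSpace ℂ K]
    [CompleteSpace K] {κ ι : Type*} {J : κ → H →L[ℂ] K} (hJ : IsDecomp J) {η : ι × κ → H}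
    (hη : SqSummable η) (k : κ) (x : H) :
    ketSum (fun p => J p.2 (η p)) (J k x) = J k (ketSum (fun j => η (j, k)) x) := by
  have h1 : SqSummable fun p : ι × κ => J p.2 (η p) := by
    simpa only [SqSummable, hJ.nsq_map] using hη
  have h2 : SqSummable fun j => η (j, k) :=
    ne_top_of_le_ne_top hη (ENNReal.tsum_comp_le_tsum_of_injective
      (f := fun j : ι => (j, k)) (fun a b h => congrArg Prod.fst h) fun p => nsq (η p))
  have h3 := (h2.hasSum_apply x).mapL (J k)
  have hinj : Function.Injective fun j : ι => (j, k) := fun a b h => congrArg Prod.fst h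
  refine (h1.hasSum_apply (J k x)).unique ?_
  rw [← hinj.hasSum_iff]
  · simpa only [Function.comp_def, hJ.inner_same, map_smul] using h3
  · rintro ⟨j, l⟩ hjl
    have : l ≠ k := fun h => hjl ⟨j, by rw [h]⟩
    rw [hJ.inner_ne this, zero_smul]

lemma IsDecomp.ketSum_apply_single {K : Type*} [NormedAddCommGroup K] [InnerProductSpace ℂ K]
    [CompleteSpace K] {κ : Type*} {J : κ → H →L[ℂ] K} (hJ : IsDecomp J) {η : κ → H}
    (hη : SqSummable η) (k : κ) (x : H) :
    ketSum (fun k => J k (η k)) (J k x) = J k (rankOne ℂ (η k) (η k) x) := by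
  have h1 : SqSummable fun k => J k (η k) := by
    simpa only [SqSummable, hJ.nsq_map] using hη
  refine (h1.hasSum_apply (J k x)).unique ?_
  rw [rankOne_apply, map_smul, ← hJ.inner_same k]
  refine hasSum_single k fun l hl => ?_
  rw [hJ.inner_ne hl, zero_smul]

/-- An eigenvector with nonzero eigenvalue lies in the range, so it is not orthogonal to v, itself
an eigenvector with eigenvalue ‖v‖². -/
lemma eigenBasis_rankOne_val (v : H) (c : EigenBasis (rankOne ℂ v v)) (i : c.ι)
    (h : c.val i ≠ 0) : c.val i = (nsq v).toReal := by
  have hv : rankOne ℂ v v v = (((nsq v).toReal : ℝ) : ℂ) • v := by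
    rw [rankOne_apply, inner_self_eq_norm_sq_to_K, nsq, ENNReal.toReal_ofReal (by positivity)]
    simp
  refine EigenBasis.val_eq_of_inner_ne_zero (isPositive_rankOne_self v).isSymmetric
    (c.apply_vec i) hv fun h0 => ?_
  have h1 := c.apply_vec i
  rw [rankOne_apply, ← inner_conj_symm, h0, map_zero, zero_smul] at h1
  exact (smul_ne_zero (Complex.ofReal_ne_zero.2 h) (c.vec.orthonormal.ne_zero i)) h1.symm

end Blocks

-- Scalar identities for the summands of the relative entropy

section Scalars

lemma relTerm_zero (y : ℝ) : relTerm 0 y = ENNReal.ofReal y := by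
  simp [relTerm]

lemma relTerm_pos {x y : ℝ} (hy : y ≠ 0) :
    relTerm x y = ENNReal.ofReal (x * Real.log x - x * Real.log y + y - x) := by
  rw [relTerm, if_neg (fun h => hy h.1)]

lemma klein_nonneg {x y : ℝ} (hx : 0 < x) (hy : 0 < y) :
    0 ≤ x * Real.log x - x * Real.log y + y - x := by
  have h := Real.log_le_sub_one_of_pos (x := y / x) (by positivity)
  rw [Real.log_div hy.ne' hx.ne'] at h
  have h2 : x * (y / x - 1) = y - x := by field_simp
  nlinarith [mul_le_mul_of_nonneg_left h hx.le]

/-- Expanding log(rp) cancels every log s. Here s is an eigenvalue of the A marginal of a block of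
weight p, and r one of the total A marginal; the last hypothesis rules out the infinite branch. -/
lemma relTerm_classical {s r p : ℝ} (hs : 0 ≤ s) (hsp : s ≤ p) (hr : 0 ≤ r) (hr1 : r ≤ 1)
    (h : s ≠ 0 → r ≠ 0) :
    relTerm s (r * p) + ENNReal.ofReal s * ENNReal.ofReal (Real.log p - Real.log s)
        + ENNReal.ofReal s
      = ENNReal.ofReal s * ENNReal.ofReal (-Real.log r)
        + ENNReal.ofReal r * ENNReal.ofReal p := by
  rcases hs.eq_or_lt with h0 | h0
  · rw [← h0, relTerm_zero, ENNReal.ofReal_mul hr]; simp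
  · have hr0 : 0 < r := lt_of_le_of_ne hr (h h0.ne').symm
    have hp : 0 < p := h0.trans_le hsp
    have h1 : 0 ≤ Real.log p - Real.log s := sub_nonneg.2 (Real.log_le_log h0 hsp)
    have h2 : 0 ≤ -Real.log r := neg_nonneg.2 (Real.log_nonpos hr hr1)
    have h3 := klein_nonneg h0 (mul_pos hr0 hp)
    rw [relTerm_pos (by positivity), ← ENNReal.ofReal_mul hs, ← ENNReal.ofReal_mul hs,
      ← ENNReal.ofReal_mul hr, ← ENNReal.ofReal_add h3 (by positivity),
      ← ENNReal.ofReal_add (by positivity) hs, ← ENNReal.ofReal_add (by positivity) (by positivity)]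
    congr 1
    rw [Real.log_mul hr0.ne' hp.ne']
    ring

/-- The same expansion for log(rs), with x an eigenvalue of a pure block, s one of its B marginal
and r one of the total A marginal. -/
lemma relTerm_pure {x r s : ℝ} (hx : 0 ≤ x) (hs : 0 ≤ s) (hsx : x ≠ 0 → s ≤ x) (hr : 0 ≤ r)
    (hr1 : r ≤ 1) (h : x ≠ 0 → r ≠ 0) (h' : x ≠ 0 → s ≠ 0) :
    relTerm x (r * s) + ENNReal.ofReal x
      = ENNReal.ofReal x * (ENNReal.ofReal (Real.log x - Real.log s)
        + ENNReal.ofReal (-Real.log r)) + ENNReal.ofReal r * ENNReal.ofReal s := by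
  rcases hx.eq_or_lt with h0 | h0
  · rw [← h0, relTerm_zero, ENNReal.ofReal_mul hr]; simp
  · have hr0 : 0 < r := lt_of_le_of_ne hr (h h0.ne').symm
    have hs0 : 0 < s := lt_of_le_of_ne hs (h' h0.ne').symm
    have h1 : 0 ≤ Real.log x - Real.log s := sub_nonneg.2 (Real.log_le_log hs0 (hsx h0.ne'))
    have h2 : 0 ≤ -Real.log r := neg_nonneg.2 (Real.log_nonpos hr hr1)
    have h3 := klein_nonneg h0 (mul_pos hr0 hs0)
    rw [relTerm_pos (by positivity), ← ENNReal.ofReal_add h1 h2, ← ENNReal.ofReal_mul hx,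
      ← ENNReal.ofReal_mul hr, ← ENNReal.ofReal_add h3 hx,
      ← ENNReal.ofReal_add (by positivity) (by positivity)]
    congr 1
    rw [Real.log_mul hr0.ne' hs0.ne']
    ring

end Scalars

/-! ## Flagged states -/

section Flag

variable {HA : Type u} {HB : Type v} {HE : Type w}
  [NormedAddCommGroup HA] [InnerProductSpace ℂ HA] [CompleteSpace HA]
  [NormedAddCommGroup HB] [InnerProductSpace ℂ HB] [CompleteSpace HB]
  [NormedAddCommGroup HE] [InnerProductSpace ℂ HE] [CompleteSpace HE]

/-- The map `v ↦ v ⊗ |k⟩`. -/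
def flagMap (HA : Type u) (HB : Type v) {HE : Type w}
    [NormedAddCommGroup HA] [InnerProductSpace ℂ HA]
    [NormedAddCommGroup HB] [InnerProductSpace ℂ HB]
    [NormedAddCommGroup HE] [InnerProductSpace ℂ HE] [CompleteSpace HE] (k : onbIndex HE) :
    HTensor HA HB →L[ℂ] HTensor HA (HTensor HB HE) :=
  opTensor (.id ℂ HA) (tmulRight HB (onb HE k))

/-- The flagged operator `∑ₖ |ψ k⟩⟨ψ k| ⊗ |k⟩⟨k|`. -/
def flag (ψ : onbIndex HE → HTensor HA HB) : Op (HTensor HA (HTensor HB HE)) :=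
  ketSum fun k => flagMap HA HB k (ψ k)

lemma isDecomp_flagMap : IsDecomp (flagMap HA HB (HE := HE)) :=
  (isDecomp_tmulRight (onb HE)).opTensor_left HA

lemma flagMap_ht (k : onbIndex HE) (a : HA) (b : HB) :
    flagMap HA HB k (ht a b) = ht a (tmulRight HB (onb HE k) b) := by
  rw [flagMap, opTensor_ht]; rfl

variable {ψ : onbIndex HE → HTensor HA HB} (hψ : SqSummable ψ)
include hψ

lemma sqSummable_flag : SqSummable fun k => flagMap HA HB k (ψ k) := by
  simpa only [SqSummable, isDecomp_flagMap.nsq_map] using hψ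

lemma isPosTraceClass_flag : IsPosTraceClass (flag ψ) := (sqSummable_flag hψ).isPosTraceClass

lemma trace_flag : trace (flag ψ) = ∑' k, nsq (ψ k) := by
  rw [flag, (sqSummable_flag hψ).trace_ketSum]
  exact tsum_congr fun k => isDecomp_flagMap.nsq_map k _

lemma flag_apply (k : onbIndex HE) (x : HTensor HA HB) :
    flag ψ (flagMap HA HB k x) = flagMap HA HB k (rankOne ℂ (ψ k) (ψ k) x) :=
  isDecomp_flagMap.ketSum_apply_single hψ k x

/-- The partial trace over E uses the very basis that carries the flags, so slice k sees only `ψ k`.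
-/
lemma margAB_flag : margAB (flag ψ) = ketSum ψ := by
  have hJ := isDecomp_flagMap (HA := HA) (HB := HB) (HE := HE)
  have h1 : margAB (flag ψ) = _ := hJ.tsum_conj_ketSum (sqSummable_flag hψ)
  rw [h1]
  refine ketSum_eq_of_qf ((sqSummable_flag hψ).adjoint hJ) hψ fun x => ?_
  rw [ENNReal.tsum_prod (f := fun k l => ov ((flagMap HA HB k).adjoint (flagMap HA HB l (ψ l))) x)]
  refine tsum_congr fun k => ?_
  rw [tsum_eq_single k fun l hl => by rw [hJ.adj_apply_ne hl.symm, ov_zero_left], hJ.adj_apply]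

/-- The `AE` marginal of a flagged operator, as a sum of rank one operators. -/
lemma margAE_flag : margAE (flag ψ) = ketSum fun p : onbIndex HB × onbIndex HE =>
    tmulRight HA (onb HE p.2) ((tmulRight HA (onb HB p.1)).adjoint (ψ p.2)) := by
  have h1 : margAE (flag ψ) = _ :=
    ((isDecomp_tmulLeft (onb HB)).opTensor_left HA).tsum_conj_ketSum (sqSummable_flag hψ)
  rw [h1]
  congr 1
  ext1 p
  have : (opTensor (.id ℂ HA) (tmulLeft HE (onb HB p.1))).adjoint ∘L flagMap HA HB p.2
      = tmulRight HA (onb HE p.2) ∘L (tmulRight HA (onb HB p.1)).adjoint := by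
    refine clm_ht_ext fun a b => ?_
    simp only [ContinuousLinearMap.comp_apply, flagMap_ht, opTensor_adjoint, opTensor_ht,
      tmulRight_apply, tmulLeft_adjoint_ht, tmulRight_adjoint_ht, ht_smul_right, ht_smul_left,
      ContinuousLinearMap.adjoint_id, ContinuousLinearMap.id_apply]
  exact congrArg (fun A => A (ψ p.2)) this

/-- The `BE` marginal of a flagged operator, as a sum of rank one operators. -/
lemma margSnd_flag : margSnd (flag ψ) = ketSum fun p : onbIndex HA × onbIndex HE =>
    tmulRight HB (onb HE p.2) ((tmulLeft HB (onb HA p.1)).adjoint (ψ p.2)) := by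
  rw [flag, margSnd_ketSum (sqSummable_flag hψ)]
  congr 1
  ext1 p
  have : (tmulLeft (HTensor HB HE) (onb HA p.1)).adjoint ∘L flagMap HA HB p.2
      = tmulRight HB (onb HE p.2) ∘L (tmulLeft HB (onb HA p.1)).adjoint := by
    refine clm_ht_ext fun a b => ?_
    simp only [ContinuousLinearMap.comp_apply, flagMap_ht, tmulRight_apply, tmulLeft_adjoint_ht,
      ht_smul_left]
  exact congrArg (fun A => A (ψ p.2)) this

lemma sqSummable_slicesFst : SqSummable fun p : onbIndex HB × onbIndex HE =>
    (tmulRight HA (onb HB p.1)).adjoint (ψ p.2) := hψ.adjoint (isDecomp_tmulRight (onb HB))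

lemma sqSummable_slicesSnd : SqSummable fun p : onbIndex HA × onbIndex HE =>
    (tmulLeft HB (onb HA p.1)).adjoint (ψ p.2) := hψ.adjoint (isDecomp_tmulLeft (onb HA))

lemma sqSummable_margAE : SqSummable fun p : onbIndex HB × onbIndex HE =>
    tmulRight HA (onb HE p.2) ((tmulRight HA (onb HB p.1)).adjoint (ψ p.2)) := by
  simpa only [SqSummable, (isDecomp_tmulRight (onb HE)).nsq_map] using sqSummable_slicesFst hψ

lemma sqSummable_margBE : SqSummable fun p : onbIndex HA × onbIndex HE =>
    tmulRight HB (onb HE p.2) ((tmulLeft HB (onb HA p.1)).adjoint (ψ p.2)) := by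
  simpa only [SqSummable, (isDecomp_tmulRight (onb HE)).nsq_map] using sqSummable_slicesSnd hψ

omit hψ in
lemma margFst_rankOne_eq (v : HTensor HA HB) :
    margFst (rankOne ℂ v v) = ketSum fun j => (tmulRight HA (onb HB j)).adjoint v := by
  have h : SqSummable fun j => (tmulRight HA (onb HB j)).adjoint v := by
    rw [SqSummable, (isDecomp_tmulRight (onb HB)).tsum_nsq_adjoint]; exact nsq_ne_top v
  refine ext_qf (isPosTraceClass_margFst_rankOne v).pos (isPositive_ketSum _) fun x => ?_
  rw [qf_margFst_rankOne, h.qf_ketSum, ← tsum_ov_basis' (onb HB)]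
  refine tsum_congr fun j => ?_
  rw [ov_adjoint_right, ov_adjoint_right]
  rfl

omit hψ in
lemma margSnd_rankOne_eq (v : HTensor HA HB) :
    margSnd (rankOne ℂ v v) = ketSum fun j => (tmulLeft HB (onb HA j)).adjoint v := by
  have h : SqSummable fun j => (tmulLeft HB (onb HA j)).adjoint v := by
    rw [SqSummable, (isDecomp_tmulLeft (onb HA)).tsum_nsq_adjoint]; exact nsq_ne_top v
  refine ext_qf (isPosTraceClass_margSnd_rankOne v).pos (isPositive_ketSum _) fun x => ?_
  rw [qf_margSnd_rankOne, h.qf_ketSum, ← tsum_ov_basis' (onb HA)]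
  refine tsum_congr fun j => ?_
  rw [ov_adjoint_right, ov_adjoint_right]
  rfl

lemma margAE_flag_apply (k : onbIndex HE) (x : HA) :
    margAE (flag ψ) (tmulRight HA (onb HE k) x)
      = tmulRight HA (onb HE k) (margFst (rankOne ℂ (ψ k) (ψ k)) x) := by
  rw [margAE_flag hψ, margFst_rankOne_eq]
  exact (isDecomp_tmulRight (onb HE)).ketSum_apply (sqSummable_slicesFst hψ) k x

lemma margSnd_flag_apply (k : onbIndex HE) (x : HB) :
    margSnd (flag ψ) (tmulRight HB (onb HE k) x)
      = tmulRight HB (onb HE k) (margSnd (rankOne ℂ (ψ k) (ψ k)) x) := by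
  rw [margSnd_flag hψ, margSnd_rankOne_eq]
  exact (isDecomp_tmulRight (onb HE)).ketSum_apply (sqSummable_slicesSnd hψ) k x

lemma isPosTraceClass_margAE : IsPosTraceClass (margAE (flag ψ)) := by
  rw [margAE_flag hψ]; exact (sqSummable_margAE hψ).isPosTraceClass

lemma isPosTraceClass_margBE : IsPosTraceClass (margSnd (flag ψ)) :=
  isPosTraceClass_margSnd (sqSummable_flag hψ)

lemma trace_margAE : trace (margAE (flag ψ)) = ∑' k, nsq (ψ k) := by
  rw [margAE_flag hψ, (sqSummable_margAE hψ).trace_ketSum]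
  simp_rw [(isDecomp_tmulRight (onb HE)).nsq_map]
  exact (isDecomp_tmulRight (onb HB)).tsum_nsq_prod ψ

lemma trace_margBE : trace (margSnd (flag ψ)) = ∑' k, nsq (ψ k) := by
  rw [flag, trace_margSnd (sqSummable_flag hψ)]
  exact tsum_congr fun k => isDecomp_flagMap.nsq_map k _

lemma qf_margFst_flag (x : HA) :
    qf (margFst (flag ψ)) x = ∑' k, nsq ((tmulLeft HB x).adjoint (ψ k)) := by
  rw [flag, qf_margFst (sqSummable_flag hψ)]
  refine tsum_congr fun k => ?_
  have : (tmulLeft (HTensor HB HE) x).adjoint ∘L flagMap HA HB k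
      = tmulRight HB (onb HE k) ∘L (tmulLeft HB x).adjoint := by
    refine clm_ht_ext fun a b => ?_
    simp only [ContinuousLinearMap.comp_apply, flagMap_ht, tmulRight_apply, tmulLeft_adjoint_ht,
      ht_smul_left]
  have h2 := congrArg (fun A => A (ψ k)) this
  simp only [ContinuousLinearMap.comp_apply] at h2
  rw [h2, (isDecomp_tmulRight (onb HE)).nsq_map]

omit hψ in
lemma nsq_tmulLeft_adjoint_ht (x a : HA) (k : onbIndex HE) :
    nsq ((tmulLeft HE x).adjoint (tmulRight HA (onb HE k) a)) = ov x a := by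
  rw [tmulRight_apply, tmulLeft_adjoint_ht, nsq_smul, nsq_basis, mul_one, ov]

omit hψ in
lemma nsq_tmulRight_adjoint_ht (y : HE) (a : HA) (k : onbIndex HE) :
    nsq ((tmulRight HA y).adjoint (tmulRight HA (onb HE k) a)) = ov y (onb HE k) * nsq a := by
  rw [tmulRight_apply, tmulRight_adjoint_ht, nsq_smul, ov]

lemma margFst_margAE : margFst (margAE (flag ψ)) = margFst (flag ψ) := by
  refine ext_qf ?_ (isPosTraceClass_margFst (sqSummable_flag hψ)).pos fun x => ?_
  · rw [margAE_flag hψ]; exact (isPosTraceClass_margFst (sqSummable_margAE hψ)).pos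
  rw [qf_margFst_flag hψ, margAE_flag hψ, qf_margFst (sqSummable_margAE hψ)]
  simp_rw [nsq_tmulLeft_adjoint_ht]
  rw [ENNReal.tsum_prod (f := fun j k => ov x ((tmulRight HA (onb HB j)).adjoint (ψ k))),
    ENNReal.tsum_comm]
  refine tsum_congr fun k => ?_
  rw [← tsum_ov_basis (onb HB)]
  refine tsum_congr fun j => ?_
  rw [ov_adjoint_left, ov_adjoint_left]
  rfl

/-- The `E` marginal of a flagged operator is diagonal. -/
def flagDiag (ψ : onbIndex HE → HTensor HA HB) : Op HE :=
  ketSum fun k => ((√(nsq (ψ k)).toReal : ℝ) : ℂ) • onb HE k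

omit hψ in
lemma ofReal_norm_sqrt (p : ℝ≥0∞) (hp : p ≠ ∞) :
    ENNReal.ofReal (‖((√p.toReal : ℝ) : ℂ)‖ ^ 2) = p := by
  rw [Complex.norm_real, Real.norm_eq_abs, sq_abs, Real.sq_sqrt ENNReal.toReal_nonneg,
    ENNReal.ofReal_toReal hp]

lemma sqSummable_flagDiag :
    SqSummable fun k => ((√(nsq (ψ k)).toReal : ℝ) : ℂ) • onb HE k := by
  rw [SqSummable]
  simp_rw [nsq_smul, nsq_basis, ofReal_norm_sqrt _ (nsq_ne_top _), mul_one]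
  exact hψ

lemma qf_flagDiag (y : HE) : qf (flagDiag ψ) y = ∑' k, ov y (onb HE k) * nsq (ψ k) := by
  rw [flagDiag, (sqSummable_flagDiag hψ).qf_ketSum]
  refine tsum_congr fun k => ?_
  rw [ov_smul_left, ofReal_norm_sqrt _ (nsq_ne_top _), mul_comm, ov_comm]

lemma flagDiag_apply (k : onbIndex HE) :
    flagDiag ψ (onb HE k) = ((nsq (ψ k)).toReal : ℂ) • onb HE k := by
  refine ((sqSummable_flagDiag hψ).hasSum_apply (onb HE k)).unique ?_
  have h := hasSum_single (f := fun l => inner ℂ (((√(nsq (ψ l)).toReal : ℝ) : ℂ) • onb HE l)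
    (onb HE k) • (((√(nsq (ψ l)).toReal : ℝ) : ℂ) • onb HE l)) k fun l hl => by
      rw [inner_smul_left, (onb HE).inner_ne hl, mul_zero, zero_smul]
  rwa [inner_smul_left, (onb HE).inner_self, mul_one, Complex.conj_ofReal, smul_smul,
    ← Complex.ofReal_mul, Real.mul_self_sqrt ENNReal.toReal_nonneg] at h

/-- The eigenbasis of the `E` marginal. -/
def flagDiagEig : EigenBasis (flagDiag ψ) where
  ι := onbIndex HE
  vec := onb HE
  val k := (nsq (ψ k)).toReal
  apply_vec := flagDiag_apply hψ

lemma tsum_flagDiagEig (F : HE → ℝ → ℝ≥0∞) :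
    ∑' p, F ((flagDiagEig hψ).vec p) ((flagDiagEig hψ).val p)
      = ∑' k, F (onb HE k) (nsq (ψ k)).toReal := rfl

lemma margSnd_margAE : margSnd (margAE (flag ψ)) = flagDiag ψ := by
  refine ext_qf ?_ (isPositive_ketSum _) fun y => ?_
  · rw [margAE_flag hψ]; exact (isPosTraceClass_margSnd (sqSummable_margAE hψ)).pos
  rw [qf_flagDiag hψ, margAE_flag hψ, qf_margSnd (sqSummable_margAE hψ)]
  simp_rw [nsq_tmulRight_adjoint_ht]
  rw [ENNReal.tsum_prod
    (f := fun j k => ov y (onb HE k) * nsq ((tmulRight HA (onb HB j)).adjoint (ψ k))),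
    ENNReal.tsum_comm]
  refine tsum_congr fun k => ?_
  rw [ENNReal.tsum_mul_left, (isDecomp_tmulRight (onb HB)).tsum_nsq_adjoint]

lemma margSnd_margSnd : margSnd (margSnd (flag ψ)) = flagDiag ψ := by
  refine ext_qf ?_ (isPositive_ketSum _) fun y => ?_
  · rw [margSnd_flag hψ]; exact (isPosTraceClass_margSnd (sqSummable_margBE hψ)).pos
  rw [qf_flagDiag hψ, margSnd_flag hψ, qf_margSnd (sqSummable_margBE hψ)]
  simp_rw [nsq_tmulRight_adjoint_ht]
  rw [ENNReal.tsum_prod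
    (f := fun j k => ov y (onb HE k) * nsq ((tmulLeft HB (onb HA j)).adjoint (ψ k))),
    ENNReal.tsum_comm]
  refine tsum_congr fun k => ?_
  rw [ENNReal.tsum_mul_left, (isDecomp_tmulLeft (onb HA)).tsum_nsq_adjoint]

end Flag

-- Mutual information of flagged states

section FlagEntropy

variable {HA : Type u} {HB : Type v} {HE : Type w}
  [NormedAddCommGroup HA] [InnerProductSpace ℂ HA] [CompleteSpace HA]
  [NormedAddCommGroup HB] [InnerProductSpace ℂ HB] [CompleteSpace HB]
  [NormedAddCommGroup HE] [InnerProductSpace ℂ HE] [CompleteSpace HE]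
  {ψ : onbIndex HE → HTensor HA HB}

/-- The `A` marginal of a flagged operator is the sum of the marginals of its blocks. -/
lemma qf_margFst_flag' (hψ : SqSummable ψ) (x : HA) :
    qf (margFst (flag ψ)) x = ∑' k, qf (margFst (rankOne ℂ (ψ k) (ψ k))) x := by
  simp_rw [qf_margFst_flag hψ, qf_margFst_rankOne]

lemma trace_margFst_flag (hψ : SqSummable ψ) : trace (margFst (flag ψ)) = ∑' k, nsq (ψ k) := by
  rw [flag, trace_margFst (sqSummable_flag hψ)]
  exact tsum_congr fun k => isDecomp_flagMap.nsq_map k _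

lemma isPosTraceClass_margFst_flag (hψ : SqSummable ψ) :
    IsPosTraceClass (margFst (flag ψ)) := isPosTraceClass_margFst (sqSummable_flag hψ)

lemma val_margFst_flag_le_one (h1 : ∑' k, nsq (ψ k) = 1) (hψ : SqSummable ψ)
    (α : EigenBasis (margFst (flag ψ))) (l : α.ι) : α.val l ≤ 1 := by
  have := (isPosTraceClass_margFst_flag hψ).val_le α l
  rwa [trace_margFst_flag hψ, h1, ENNReal.toReal_one] at this

lemma isPositive_flagDiag (ψ : onbIndex HE → HTensor HA HB) : (flagDiag ψ).IsPositive :=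
  isPositive_ketSum _

lemma ENNReal_tsum_rotate {κ ι : Type*} {β : κ → Type*} (f : ∀ k, β k → ι → ℝ≥0∞) :
    ∑' k, ∑' j, ∑' l, f k j l = ∑' l, ∑' k, ∑' j, f k j l := by
  rw [ENNReal.tsum_comm]
  exact tsum_congr fun k => ENNReal.tsum_comm

lemma relEntropy_margAE_expand (hψ : SqSummable ψ) (α : EigenBasis (margFst (flag ψ)))
    (a : ∀ k, EigenBasis (margFst (rankOne ℂ (ψ k) (ψ k)))) :
    relEntropy (margAE (flag ψ)) (opTensor (margFst (flag ψ)) (flagDiag ψ))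
      = ∑' k, ∑' j, ∑' l, ov ((a k).vec j) (α.vec l)
        * relTerm ((a k).val j) (α.val l * (nsq (ψ k)).toReal) := by
  have hR := isDecomp_tmulRight (HA := HA) (onb HE)
  rw [relEntropy_eq (isPosTraceClass_margAE hψ).sym
    (isSymmetric_opTensor (isPosTraceClass_margFst_flag hψ).pos (isPositive_flagDiag ψ))
    (EigenBasis.ofDecomp hR (margAE_flag_apply hψ) a) (α.tensor (flagDiagEig hψ))]
  refine (EigenBasis.tsum_ofDecomp hR (margAE_flag_apply hψ) a (fun x r => ∑' q,
    ov x ((α.tensor (flagDiagEig hψ)).vec q) * relTerm r ((α.tensor (flagDiagEig hψ)).val q))).trans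
    (tsum_congr fun k => tsum_congr fun j => ?_)
  refine (EigenBasis.tsum_tensor α (flagDiagEig hψ) (fun y s => ov _ y * relTerm _ s)).trans
    (tsum_congr fun l => ?_)
  refine (tsum_flagDiagEig hψ (fun z p => ov _ (ht (α.vec l) z)
    * relTerm ((a k).val j) (α.val l * p))).trans ?_
  -- Distinct flags are orthogonal, so only the E eigenvector equal to the flag of the block
  -- contributes.
  rw [tsum_eq_single k]
  · rw [tmulRight_apply, ov_ht, ov_self, nsq_basis, mul_one, mul_one]
  · intro m hm
    rw [tmulRight_apply, ov_ht, ov_eq_zero.2 ((onb HE).inner_ne (Ne.symm hm)), mul_zero, zero_mul]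

/-- The scalar content of I(A:E) + ∑ H_k = H(A). Here w is the matrix of squared overlaps between
eigenvectors of block k and of the A marginal, s and r are their eigenvalues, and p the block
weights. The 1 on each side is the total mass of the linear terms in `relTerm`, kept to avoid
subtraction. -/
lemma tsum_relTerm_classical {κ ι : Type*} {β : κ → Type*} {w : ∀ k, β k → ι → ℝ≥0∞}
    {s : ∀ k, β k → ℝ} {r : ι → ℝ} {p : κ → ℝ≥0∞} (hw : ∀ k j, ∑' l, w k j l = 1)
    (hw' : ∀ k l, ∑' j, w k j l = 1) (hs : ∀ k, ∑' j, ENNReal.ofReal (s k j) = p k)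
    (hp : ∀ k, p k ≠ ∞) (hp1 : ∑' k, p k = 1) (hr1 : ∑' l, ENNReal.ofReal (r l) = 1)
    (hqf : ∀ l, ∑' k, ∑' j, w k j l * ENNReal.ofReal (s k j) = ENNReal.ofReal (r l))
    (hs0 : ∀ k j, 0 ≤ s k j) (hsp : ∀ k j, s k j ≤ (p k).toReal) (hr0 : ∀ l, 0 ≤ r l)
    (hrle : ∀ l, r l ≤ 1) :
    ∑' k, ∑' j, ∑' l, w k j l * relTerm (s k j) (r l * (p k).toReal)
        + ∑' k, ∑' j, ENNReal.ofReal (s k j)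
          * ENNReal.ofReal (Real.log (p k).toReal - Real.log (s k j)) + 1
      = ∑' l, ENNReal.ofReal (r l) * ENNReal.ofReal (-Real.log (r l)) + 1 := by
  have hent : ∑' k, ∑' j, ENNReal.ofReal (s k j)
          * ENNReal.ofReal (Real.log (p k).toReal - Real.log (s k j))
      = ∑' k, ∑' j, ∑' l, w k j l * (ENNReal.ofReal (s k j)
        * ENNReal.ofReal (Real.log (p k).toReal - Real.log (s k j))) := by
    simp_rw [ENNReal.tsum_mul_right, hw, one_mul]
  have hunit : (1 : ℝ≥0∞) = ∑' k, ∑' j, ∑' l, w k j l * ENNReal.ofReal (s k j) := by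
    simp_rw [ENNReal.tsum_mul_right, hw, one_mul, hs, hp1]
  have hpt : ∀ k j l, w k j l * relTerm (s k j) (r l * (p k).toReal)
        + w k j l * (ENNReal.ofReal (s k j)
        * ENNReal.ofReal (Real.log (p k).toReal - Real.log (s k j)))
        + w k j l * ENNReal.ofReal (s k j)
      = w k j l * ENNReal.ofReal (s k j) * ENNReal.ofReal (-Real.log (r l))
        + w k j l * (ENNReal.ofReal (r l) * p k) := by
    intro k j l
    by_cases hD : w k j l = 0
    · simp [hD]
    -- If r l = 0, then the sum giving r l forces each w·s to vanish, so a nonzero weight forces s =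
    -- 0.
    have h4 := relTerm_classical (hs0 k j) (hsp k j) (hr0 l) (hrle l) fun hne hz => by
      have h2 := hqf l
      rw [hz, ENNReal.ofReal_zero, ENNReal.tsum_eq_zero] at h2
      rcases mul_eq_zero.1 (ENNReal.tsum_eq_zero.1 (h2 k) j) with h3 | h3
      · exact hD h3
      · exact hne (le_antisymm (ENNReal.ofReal_eq_zero.1 h3) (hs0 k j))
    rw [mul_assoc, ← mul_add, ← mul_add, ← mul_add, h4, ENNReal.ofReal_toReal (hp k)]
  rw [hent]
  -- Only the 1 on the left is expanded, as the mass of the s; the 1 on the right is later recovered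
  -- as the mass of r·p.
  nth_rewrite 1 [hunit]
  simp_rw [← ENNReal.tsum_add, hpt, ENNReal.tsum_add]
  congr 1
  · rw [ENNReal_tsum_rotate]
    simp_rw [ENNReal.tsum_mul_right, hqf]
  · have h3 : ∀ k, ∑' j, ∑' l, w k j l * (ENNReal.ofReal (r l) * p k) = p k := fun k => by
      rw [ENNReal.tsum_comm]
      simp_rw [ENNReal.tsum_mul_right, hw', one_mul, ENNReal.tsum_mul_right, hr1, one_mul]
    simp_rw [h3, hp1]

/-- The scalar content of I(A:BE) = ∑ H_k + H(A). Here w are squared overlaps of eigenvectors of the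
pure block k with products of marginal eigenvectors, and o those of the block vector itself; the
sums of o over one index give back the marginal eigenvalues s and r. A pure block has only the
eigenvalues 0 and p. -/
lemma tsum_relTerm_pure {κ ι : Type*} {β γ : κ → Type*} {w : ∀ k, γ k → ι → β k → ℝ≥0∞}
    {o : ∀ k, ι → β k → ℝ≥0∞} {x : ∀ k, γ k → ℝ}
    {s : ∀ k, β k → ℝ} {r : ι → ℝ} {p : κ → ℝ≥0∞} (hw : ∀ k i, ∑' l, ∑' j, w k i l j = 1)
    (hw' : ∀ k l j, ∑' i, w k i l j = 1)
    (hwx : ∀ k l j, ∑' i, w k i l j * ENNReal.ofReal (x k i) = o k l j)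
    (hos : ∀ k j, ∑' l, o k l j = ENNReal.ofReal (s k j))
    (hor : ∀ l, ∑' k, ∑' j, o k l j = ENNReal.ofReal (r l))
    (hs : ∀ k, ∑' j, ENNReal.ofReal (s k j) = p k)
    (hx : ∀ k, ∑' i, ENNReal.ofReal (x k i) = p k)
    (hp1 : ∑' k, p k = 1) (hr1 : ∑' l, ENNReal.ofReal (r l) = 1)
    (hs0 : ∀ k j, 0 ≤ s k j) (hsp : ∀ k j, s k j ≤ (p k).toReal)
    (hx0 : ∀ k i, 0 ≤ x k i) (hxp : ∀ k i, x k i ≠ 0 → x k i = (p k).toReal)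
    (hr0 : ∀ l, 0 ≤ r l) (hrle : ∀ l, r l ≤ 1) :
    ∑' k, ∑' i, ∑' l, ∑' j, w k i l j * relTerm (x k i) (r l * s k j) + 1
      = ∑' k, ∑' j, ENNReal.ofReal (s k j)
          * ENNReal.ofReal (Real.log (p k).toReal - Real.log (s k j))
        + ∑' l, ENNReal.ofReal (r l) * ENNReal.ofReal (-Real.log (r l)) + 1 := by
  have hunit : (1 : ℝ≥0∞) = ∑' k, ∑' i, ∑' l, ∑' j, w k i l j * ENNReal.ofReal (x k i) := by
    simp_rw [ENNReal.tsum_mul_right, hw, one_mul, hx, hp1]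
  have hpt : ∀ k i l j, w k i l j * relTerm (x k i) (r l * s k j)
        + w k i l j * ENNReal.ofReal (x k i)
      = w k i l j * ENNReal.ofReal (x k i)
          * (ENNReal.ofReal (Real.log (p k).toReal - Real.log (s k j))
            + ENNReal.ofReal (-Real.log (r l)))
        + w k i l j * (ENNReal.ofReal (r l) * ENNReal.ofReal (s k j)) := by
    intro k i l j
    by_cases hD : w k i l j = 0
    · simp [hD]
    have hov : x k i ≠ 0 → o k l j ≠ 0 := fun h0 h2 => by
      rw [← hwx, ENNReal.tsum_eq_zero] at h2
      rcases mul_eq_zero.1 (h2 i) with h3 | h3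
      · exact hD h3
      · exact h0 (le_antisymm (ENNReal.ofReal_eq_zero.1 h3) (hx0 k i))
    have h4 := relTerm_pure (hx0 k i) (hs0 k j) (fun h0 => by rw [hxp k i h0]; exact hsp k j)
      (hr0 l) (hrle l)
      (fun h0 h5 => hov h0 (ENNReal.tsum_eq_zero.1 (ENNReal.tsum_eq_zero.1
        ((hor l).trans (by rw [h5, ENNReal.ofReal_zero])) k) j))
      (fun h0 h5 => hov h0 (ENNReal.tsum_eq_zero.1
        ((hos k j).trans (by rw [h5, ENNReal.ofReal_zero])) l))
    rw [mul_assoc, ← mul_add, ← mul_add, h4]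
    by_cases h0 : x k i = 0
    · rw [h0]; simp
    · rw [hxp k i h0]
  nth_rewrite 1 [hunit]
  simp_rw [← ENNReal.tsum_add, hpt, ENNReal.tsum_add]
  congr 1
  · have h5 : ∀ k, ∑' i, ∑' l, ∑' j, w k i l j * ENNReal.ofReal (x k i)
          * (ENNReal.ofReal (Real.log (p k).toReal - Real.log (s k j))
            + ENNReal.ofReal (-Real.log (r l)))
        = ∑' j, ENNReal.ofReal (s k j)
          * ENNReal.ofReal (Real.log (p k).toReal - Real.log (s k j))
          + ∑' l, (∑' j, o k l j) * ENNReal.ofReal (-Real.log (r l)) := fun k => by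
      rw [ENNReal.tsum_comm]
      have h6 : ∀ l, ∑' i, ∑' j, w k i l j * ENNReal.ofReal (x k i)
          * (ENNReal.ofReal (Real.log (p k).toReal - Real.log (s k j))
            + ENNReal.ofReal (-Real.log (r l)))
          = ∑' j, o k l j * ENNReal.ofReal (Real.log (p k).toReal - Real.log (s k j))
          + (∑' j, o k l j) * ENNReal.ofReal (-Real.log (r l)) := fun l => by
        rw [ENNReal.tsum_comm]
        simp_rw [ENNReal.tsum_mul_right, hwx, mul_add]
        rw [ENNReal.tsum_add, ENNReal.tsum_mul_right]
      simp_rw [h6]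
      rw [ENNReal.tsum_add, ENNReal.tsum_comm]
      simp_rw [ENNReal.tsum_mul_right, hos]
    simp_rw [h5]
    rw [ENNReal.tsum_add, ENNReal.tsum_comm (f := fun k l => (∑' j, o k l j) * _)]
    simp_rw [ENNReal.tsum_mul_right, hor]
  · have h3 : ∀ k, ∑' i, ∑' l, ∑' j, w k i l j
        * (ENNReal.ofReal (r l) * ENNReal.ofReal (s k j)) = p k := fun k => by
      rw [ENNReal.tsum_comm]
      have h4 : ∀ l, ∑' i, ∑' j, w k i l j * (ENNReal.ofReal (r l) * ENNReal.ofReal (s k j))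
          = ENNReal.ofReal (r l) * p k := fun l => by
        rw [ENNReal.tsum_comm]
        simp_rw [ENNReal.tsum_mul_right, hw', one_mul, ENNReal.tsum_mul_left, hs]
      simp_rw [h4, ENNReal.tsum_mul_right, hr1, one_mul]
    simp_rw [h3, hp1]

lemma tsum_val_margFst_flag (hψ : SqSummable ψ) (h1 : ∑' k, nsq (ψ k) = 1)
    (α : EigenBasis (margFst (flag ψ))) : ∑' l, ENNReal.ofReal (α.val l) = 1 := by
  rw [← (isPosTraceClass_margFst_flag hψ).trace_eq α, trace_margFst_flag hψ, h1]

/-- The flag makes E classical, and this is Holevo's formula I(A:E) = H(A) − ∑ H_k, stated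
additively because H(A) may be infinite. -/
lemma relEntropy_margAE (hψ : SqSummable ψ) (h1 : ∑' k, nsq (ψ k) = 1)
    (α : EigenBasis (margFst (flag ψ))) :
    relEntropy (margAE (flag ψ)) (opTensor (margFst (flag ψ)) (flagDiag ψ))
        + ∑' k, homExt entropy (margFst (rankOne ℂ (ψ k) (ψ k))) + 1
      = ∑' l, ENNReal.ofReal (α.val l) * ENNReal.ofReal (-Real.log (α.val l)) + 1 := by
  have hA := isPosTraceClass_margFst_flag hψ
  have hk := fun k => isPosTraceClass_margFst_rankOne (ψ k)
  obtain ⟨a⟩ : Nonempty (∀ k, EigenBasis (margFst (rankOne ℂ (ψ k) (ψ k)))) :=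
    ⟨fun k => (hk k).eig⟩
  have hent : ∀ k, homExt entropy (margFst (rankOne ℂ (ψ k) (ψ k)))
      = ∑' j, ENNReal.ofReal ((a k).val j)
        * ENNReal.ofReal (Real.log (nsq (ψ k)).toReal - Real.log ((a k).val j)) := fun k => by
    rw [(hk k).homExt_entropy (a k), trace_margFst_rankOne]
  rw [relEntropy_margAE_expand hψ α a, tsum_congr hent]
  refine tsum_relTerm_classical (fun k j => by rw [tsum_ov_basis', nsq_basis])
    (fun k l => by rw [tsum_ov_basis, nsq_basis])
    (fun k => by rw [← (hk k).trace_eq, trace_margFst_rankOne])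
    (fun k => nsq_ne_top _) h1 (tsum_val_margFst_flag hψ h1 α) (fun l => ?_)
    (fun k => (a k).val_nonneg (hk k).pos) (fun k j => ?_) (α.val_nonneg hA.pos)
    (val_margFst_flag_le_one h1 hψ α)
  · rw [← hA.qf_vec α, qf_margFst_flag' hψ]
    exact tsum_congr fun k => ((hk k).qf_eq (a k) _).symm
  · rw [← trace_margFst_rankOne]
    exact (hk k).val_le (a k) j

lemma relEntropy_flag_expand (hψ : SqSummable ψ) (α : EigenBasis (margFst (flag ψ)))
    (b : ∀ k, EigenBasis (margSnd (rankOne ℂ (ψ k) (ψ k))))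
    (c : ∀ k, EigenBasis (rankOne ℂ (ψ k) (ψ k))) :
    relEntropy (flag ψ) (opTensor (margFst (flag ψ)) (margSnd (flag ψ)))
      = ∑' k, ∑' i, ∑' l, ∑' j, ov ((c k).vec i) (ht (α.vec l) ((b k).vec j))
        * relTerm ((c k).val i) (α.val l * (b k).val j) := by
  have hR := isDecomp_tmulRight (HA := HB) (onb HE)
  have hJ := isDecomp_flagMap (HA := HA) (HB := HB) (HE := HE)
  rw [relEntropy_eq (isPosTraceClass_flag hψ).sym
    (isSymmetric_opTensor (isPosTraceClass_margFst_flag hψ).pos (isPosTraceClass_margBE hψ).pos)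
    (EigenBasis.ofDecomp hJ (flag_apply hψ) c)
    (α.tensor (EigenBasis.ofDecomp hR (margSnd_flag_apply hψ) b))]
  refine (EigenBasis.tsum_ofDecomp hJ (flag_apply hψ) c (fun x r => ∑' q,
    ov x ((α.tensor (EigenBasis.ofDecomp hR (margSnd_flag_apply hψ) b)).vec q)
    * relTerm r ((α.tensor (EigenBasis.ofDecomp hR (margSnd_flag_apply hψ) b)).val q))).trans
    (tsum_congr fun k => tsum_congr fun i => ?_)
  refine (EigenBasis.tsum_tensor α _ (fun y s => ov _ y * relTerm _ s)).trans
    (tsum_congr fun l => ?_)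
  refine (EigenBasis.tsum_ofDecomp hR (margSnd_flag_apply hψ) b (fun z s => ov _ (ht (α.vec l) z)
    * relTerm ((c k).val i) (α.val l * s))).trans ?_
  rw [tsum_eq_single k]
  · refine tsum_congr fun j => ?_
    rw [← flagMap_ht, hJ.ov_same]
  · intro m hm
    rw [ENNReal.tsum_eq_zero]
    intro j
    rw [← flagMap_ht, hJ.ov_ne (Ne.symm hm), zero_mul]

lemma nsq_tmulLeft_adjoint {ι : Type*} (v : HTensor HA HB) (x : HA) (b : HilbertBasis ι ℂ HB) :
    nsq ((tmulLeft HB x).adjoint v) = ∑' j, ov v (ht x (b j)) := by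
  rw [← tsum_ov_basis' b]
  refine tsum_congr fun j => ?_
  rw [ov_adjoint_right]
  rfl

lemma nsq_tmulRight_adjoint {ι : Type*} (v : HTensor HA HB) (y : HB) (b : HilbertBasis ι ℂ HA) :
    nsq ((tmulRight HA y).adjoint v) = ∑' j, ov v (ht (b j) y) := by
  rw [← tsum_ov_basis' b]
  refine tsum_congr fun j => ?_
  rw [ov_adjoint_right]
  rfl

lemma relEntropy_flag (hψ : SqSummable ψ) (h1 : ∑' k, nsq (ψ k) = 1)
    (α : EigenBasis (margFst (flag ψ))) :
    relEntropy (flag ψ) (opTensor (margFst (flag ψ)) (margSnd (flag ψ))) + 1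
      = ∑' k, homExt entropy (margFst (rankOne ℂ (ψ k) (ψ k)))
        + ∑' l, ENNReal.ofReal (α.val l) * ENNReal.ofReal (-Real.log (α.val l)) + 1 := by
  have hA := isPosTraceClass_margFst_flag hψ
  have hk := fun k => isPosTraceClass_margSnd_rankOne (ψ k)
  have hr := fun k => isPosTraceClass_rankOne (ψ k)
  obtain ⟨b⟩ : Nonempty (∀ k, EigenBasis (margSnd (rankOne ℂ (ψ k) (ψ k)))) :=
    ⟨fun k => (hk k).eig⟩
  obtain ⟨c⟩ : Nonempty (∀ k, EigenBasis (rankOne ℂ (ψ k) (ψ k))) := ⟨fun k => (hr k).eig⟩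
  have hent : ∀ k, homExt entropy (margFst (rankOne ℂ (ψ k) (ψ k)))
      = ∑' j, ENNReal.ofReal ((b k).val j)
        * ENNReal.ofReal (Real.log (nsq (ψ k)).toReal - Real.log ((b k).val j)) := fun k => by
    -- The BE marginal brings in the B marginals of the blocks; purity turns their entropies into
    -- those of the A marginals.
    rw [homExt_entropy_margFst_eq_margSnd, (hk k).homExt_entropy (b k), trace_margSnd_rankOne]
  rw [relEntropy_flag_expand hψ α b c, tsum_congr hent]
  refine tsum_relTerm_pure (o := fun k l j => ov (ψ k) (ht (α.vec l) ((b k).vec j)))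
    (fun k i => ?_) (fun k l j => ?_) (fun k l j => ?_) (fun k j => ?_) (fun l => ?_)
    (fun k => by rw [← (hk k).trace_eq, trace_margSnd_rankOne])
    (fun k => by rw [← (hr k).trace_eq, trace_rankOne]) h1 (tsum_val_margFst_flag hψ h1 α)
    (fun k => (b k).val_nonneg (hk k).pos) (fun k j => ?_) (fun k => (c k).val_nonneg (hr k).pos)
    (fun k => eigenBasis_rankOne_val (ψ k) (c k)) (α.val_nonneg hA.pos)
    (val_margFst_flag_le_one h1 hψ α)
  · rw [← nsq_basis (c k).vec i, ← (isDecomp_tmulLeft α.vec).tsum_nsq_adjoint ((c k).vec i)]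
    exact tsum_congr fun l => (nsq_tmulLeft_adjoint _ _ (b k).vec).symm
  · rw [tsum_ov_basis, nsq_ht, nsq_basis, nsq_basis, one_mul]
  · rw [← (hr k).qf_eq (c k), qf_rankOne]
  · rw [← (hk k).qf_vec (b k), qf_margSnd_rankOne, nsq_tmulRight_adjoint _ _ α.vec]
  · rw [← hA.qf_vec α, qf_margFst_flag hψ]
    exact tsum_congr fun k => (nsq_tmulLeft_adjoint _ _ (b k).vec).symm
  · rw [← trace_margSnd_rankOne]
    exact (hk k).val_le (b k) j

/-- For a flagged state the flag turns the mutual information with `A` into a classical part and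
twice the mean entropy of the `A` marginals. -/
lemma relEntropy_flag_eq (hψ : SqSummable ψ) (h1 : ∑' k, nsq (ψ k) = 1) :
    relEntropy (flag ψ) (opTensor (margFst (flag ψ)) (margSnd (flag ψ)))
      = relEntropy (margAE (flag ψ))
          (opTensor (margFst (margAE (flag ψ))) (margSnd (margAE (flag ψ))))
        + 2 * ∑' k, homExt entropy (margFst (rankOne ℂ (ψ k) (ψ k))) := by
  rw [margFst_margAE hψ, margSnd_margAE hψ]
  have hA := isPosTraceClass_margFst_flag hψ
  have e1 := relEntropy_flag hψ h1 hA.eig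
  -- H(A) + 1 is replaced as a whole by I(A:E) + ∑ H_k + 1, so H(A) disappears without being
  -- cancelled, even if it is infinite.
  rw [add_assoc, ← relEntropy_margAE hψ h1 hA.eig] at e1
  rw [← (ENNReal.add_left_inj ENNReal.one_ne_top), e1]
  ring

lemma margAE_smul (c : ℝ) (ω : Op (HTensor HA (HTensor HB HE))) :
    margAE (c • ω) = c • margAE ω := by
  rw [margAE, margAE, ← tsum_const_smul'']
  refine tsum_congr fun j => ?_
  rw [ContinuousLinearMap.smul_comp, ContinuousLinearMap.comp_smul]

lemma smul_flag {c : ℝ} (hc : 0 ≤ c) (ψ : onbIndex HE → HTensor HA HB) :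
    c • flag ψ = flag fun k => ((√c : ℝ) : ℂ) • ψ k := by
  rw [flag, smul_ketSum c hc, flag]
  simp_rw [map_smul]

lemma homExt_entropy_sqrt_smul {c : ℝ} (hc : 0 < c) (v : HTensor HA HB) :
    homExt entropy (margFst (rankOne ℂ (((√c : ℝ) : ℂ) • v) (((√c : ℝ) : ℂ) • v)))
      = ENNReal.ofReal c * homExt entropy (margFst (rankOne ℂ v v)) := by
  have h3 : margFst (rankOne ℂ (((√c : ℝ) : ℂ) • v) (((√c : ℝ) : ℂ) • v))
      = c • margFst (rankOne ℂ v v) := by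
    rw [← smul_rankOne_self _ hc.le, margFst, margFst, ← tsum_const_smul'']
    refine tsum_congr fun j => ?_
    rw [ContinuousLinearMap.smul_comp, ContinuousLinearMap.comp_smul]
  rw [h3, (isPosTraceClass_margFst_rankOne v).homExt_smul _ hc]

/-- Both sides are homogeneous of degree one, so the normalised case suffices. Compressions by
projectors make the unnormalised form necessary. -/
lemma mutualInfo_flag (hψ : SqSummable ψ) :
    mutualInfo (flag ψ) = mutualInfo (margAE (flag ψ))
      + 2 * ∑' k, homExt entropy (margFst (rankOne ℂ (ψ k) (ψ k))) := by
  rw [mutualInfo, mutualInfo, homExt, homExt, trace_flag hψ, trace_margAE hψ]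
  set t := ∑' k, nsq (ψ k) with ht
  by_cases h0 : t = 0
  · have h2 : ∀ k, homExt entropy (margFst (rankOne ℂ (ψ k) (ψ k))) = 0 := fun k => by
      rw [homExt, trace_margFst_rankOne, ENNReal.tsum_eq_zero.1 h0 k, zero_mul]
    simp [h0, h2]
  have hr : 0 < t.toReal := ENNReal.toReal_pos h0 hψ
  have hr' : 0 < t.toReal⁻¹ := inv_pos.2 hr
  rw [← margAE_smul, smul_flag hr'.le]
  have hφ := hψ.smul ((√(t.toReal⁻¹) : ℝ) : ℂ)
  have hn : ∑' k, nsq (((√(t.toReal⁻¹) : ℝ) : ℂ) • ψ k) = 1 := by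
    rw [← trace_flag hφ, ← smul_flag hr'.le, trace_smul hr'.le, trace_flag hψ, ← ht,
      ENNReal.ofReal_inv_of_pos hr, ENNReal.ofReal_toReal hψ, ENNReal.inv_mul_cancel h0 hψ]
  have hh : ∀ k, homExt entropy (margFst (rankOne ℂ (((√(t.toReal⁻¹) : ℝ) : ℂ) • ψ k)
      (((√(t.toReal⁻¹) : ℝ) : ℂ) • ψ k)))
      = t⁻¹ * homExt entropy (margFst (rankOne ℂ (ψ k) (ψ k))) := fun k => by
    rw [homExt_entropy_sqrt_smul hr', ENNReal.ofReal_inv_of_pos hr, ENNReal.ofReal_toReal hψ]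
  rw [relEntropy_flag_eq hφ hn, mul_add]
  simp_rw [hh]
  rw [ENNReal.tsum_mul_left, mul_left_comm 2, ← mul_assoc t t⁻¹, ENNReal.mul_inv_cancel h0 hψ,
    one_mul]

/-! ### The entropies of a flagged state -/

/-- The grouping rule of entropy for one eigenvalue s in a block of weight p. -/
lemma negMulLog_split {s p : ℝ} (hs : 0 ≤ s) (hsp : s ≤ p) (hp : p ≤ 1) :
    ENNReal.ofReal (Real.negMulLog s)
      = ENNReal.ofReal s * ENNReal.ofReal (-Real.log p)
        + ENNReal.ofReal s * ENNReal.ofReal (Real.log p - Real.log s) := by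
  rcases hs.eq_or_lt with h0 | h0
  · rw [← h0]; simp
  · have h1 : 0 ≤ Real.log p - Real.log s := sub_nonneg.2 (Real.log_le_log h0 hsp)
    have h2 : 0 ≤ -Real.log p := neg_nonneg.2 (Real.log_nonpos (hs.trans hsp) hp)
    rw [← ENNReal.ofReal_mul hs, ← ENNReal.ofReal_mul hs,
      ← ENNReal.ofReal_add (by positivity) (by positivity), Real.negMulLog]
    congr 1
    ring

/-- The entropy of a subnormalised operator and its homogeneous extension. -/
lemma IsPosTraceClass.tsum_negMulLog {H : Type*} [NormedAddCommGroup H] [InnerProductSpace ℂ H]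
    [CompleteSpace H] {T : Op H} (hT : IsPosTraceClass T) (h1 : trace T ≤ 1) (e : EigenBasis T) :
    ∑' i, ENNReal.ofReal (Real.negMulLog (e.val i))
      = ENNReal.ofReal (Real.negMulLog (trace T).toReal) + homExt entropy T := by
  have hp : (trace T).toReal ≤ 1 := by
    rw [← ENNReal.toReal_one]; exact ENNReal.toReal_mono ENNReal.one_ne_top h1
  rw [hT.homExt_entropy e]
  simp_rw [negMulLog_split (e.val_nonneg hT.pos _) (hT.val_le e _) hp]
  rw [ENNReal.tsum_add, ENNReal.tsum_mul_right, ← hT.trace_eq e, Real.negMulLog, neg_mul_comm,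
    ENNReal.ofReal_mul ENNReal.toReal_nonneg, ENNReal.ofReal_toReal hT.trace_ne_top]

lemma IsPosTraceClass.entropy_eq_add {H : Type*} [NormedAddCommGroup H] [InnerProductSpace ℂ H]
    [CompleteSpace H] {T : Op H} (hT : IsPosTraceClass T) (h1 : trace T ≤ 1) :
    entropy T = ENNReal.ofReal (Real.negMulLog (trace T).toReal) + homExt entropy T := by
  rw [entropy_eq hT.pos h1 hT.eig, hT.tsum_negMulLog h1]

lemma nsq_le_one (h1 : ∑' k, nsq (ψ k) = 1) (k : onbIndex HE) : nsq (ψ k) ≤ 1 :=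
  h1 ▸ ENNReal.le_tsum k

lemma entropy_flagDiag (hψ : SqSummable ψ) (h1 : ∑' k, nsq (ψ k) = 1) :
    entropy (flagDiag ψ) = ∑' k, ENNReal.ofReal (Real.negMulLog (nsq (ψ k)).toReal) := by
  refine entropy_eq (isPositive_flagDiag ψ) ?_ (flagDiagEig hψ)
  rw [← margSnd_margAE hψ, margAE_flag hψ, trace_margSnd (sqSummable_margAE hψ),
    ← (sqSummable_margAE hψ).trace_ketSum, ← margAE_flag hψ, trace_margAE hψ, h1]

lemma entropy_flag (hψ : SqSummable ψ) (h1 : ∑' k, nsq (ψ k) = 1) :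
    entropy (flag ψ) = ∑' k, ENNReal.ofReal (Real.negMulLog (nsq (ψ k)).toReal) := by
  have hr := fun k => isPosTraceClass_rankOne (ψ k)
  rw [entropy_eq (isPosTraceClass_flag hψ).pos (by rw [trace_flag hψ, h1])
    (EigenBasis.ofDecomp isDecomp_flagMap (flag_apply hψ) fun k => (hr k).eig)]
  refine (EigenBasis.tsum_ofDecomp _ _ _ (fun _ s => ENNReal.ofReal (Real.negMulLog s))).trans
    (tsum_congr fun k => ?_)
  have h2 := (hr k).tsum_negMulLog (by rw [trace_rankOne]; exact nsq_le_one h1 k) (hr k).eig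
  -- A pure block contributes no entropy beyond that of its weight.
  have h3 : homExt entropy (rankOne ℂ (ψ k) (ψ k)) = 0 := by
    rw [(hr k).homExt_entropy (hr k).eig, ENNReal.tsum_eq_zero]
    intro i
    by_cases h0 : (hr k).eig.val i = 0
    · rw [h0]; simp
    · rw [eigenBasis_rankOne_val _ _ _ h0, trace_rankOne]; simp
  rw [trace_rankOne, h3, add_zero] at h2
  exact h2

lemma entropy_margAE_flag (hψ : SqSummable ψ) (h1 : ∑' k, nsq (ψ k) = 1) :
    entropy (margAE (flag ψ)) = ∑' k, ENNReal.ofReal (Real.negMulLog (nsq (ψ k)).toReal)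
      + ∑' k, homExt entropy (margFst (rankOne ℂ (ψ k) (ψ k))) := by
  have hr := fun k => isPosTraceClass_margFst_rankOne (ψ k)
  rw [entropy_eq (isPosTraceClass_margAE hψ).pos (by rw [trace_margAE hψ, h1])
    (EigenBasis.ofDecomp (isDecomp_tmulRight (onb HE)) (margAE_flag_apply hψ) fun k => (hr k).eig),
    ← ENNReal.tsum_add]
  refine (EigenBasis.tsum_ofDecomp _ _ _ (fun _ s => ENNReal.ofReal (Real.negMulLog s))).trans
    (tsum_congr fun k => ?_)
  have h2 := (hr k).tsum_negMulLog (by rw [trace_margFst_rankOne]; exact nsq_le_one h1 k)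
    (hr k).eig
  rw [trace_margFst_rankOne] at h2
  exact h2

lemma entropy_margBE_flag (hψ : SqSummable ψ) (h1 : ∑' k, nsq (ψ k) = 1) :
    entropy (margSnd (flag ψ)) = ∑' k, ENNReal.ofReal (Real.negMulLog (nsq (ψ k)).toReal)
      + ∑' k, homExt entropy (margFst (rankOne ℂ (ψ k) (ψ k))) := by
  have hr := fun k => isPosTraceClass_margSnd_rankOne (ψ k)
  rw [entropy_eq (isPosTraceClass_margBE hψ).pos (by rw [trace_margBE hψ, h1])
    (EigenBasis.ofDecomp (isDecomp_tmulRight (onb HE)) (margSnd_flag_apply hψ) fun k => (hr k).eig),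
    ← ENNReal.tsum_add]
  refine (EigenBasis.tsum_ofDecomp _ _ _ (fun _ s => ENNReal.ofReal (Real.negMulLog s))).trans
    (tsum_congr fun k => ?_)
  have h2 := (hr k).tsum_negMulLog (by rw [trace_margSnd_rankOne]; exact nsq_le_one h1 k)
    (hr k).eig
  rw [trace_margSnd_rankOne, ← homExt_entropy_margFst_eq_margSnd] at h2
  exact h2

/-- With S the entropy of the flag weights, the expression is (S + h) + (S + h) − (S + S) where h =
∑ H_k. As an inequality it also survives S = ∞ under truncated subtraction. -/
lemma condMutualInfoFin_flag_le (hψ : SqSummable ψ) (h1 : ∑' k, nsq (ψ k) = 1) :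
    condMutualInfoFin (flag ψ) ≤ 2 * ∑' k, homExt entropy (margFst (rankOne ℂ (ψ k) (ψ k))) := by
  rw [condMutualInfoFin, margSnd_margSnd hψ, entropy_margAE_flag hψ h1, entropy_margBE_flag hψ h1,
    entropy_flagDiag hψ h1, entropy_flag hψ h1, tsub_le_iff_right]
  apply le_of_eq
  ring

end FlagEntropy

/-! ## Pure states -/

section PureStates

variable {H : Type u} [NormedAddCommGroup H] [InnerProductSpace ℂ H] [CompleteSpace H]

lemma exists_sqrt {T : Op H} (hT : T.IsPositive) :
    ∃ R : Op H, (∀ x y, inner ℂ (R x) y = inner ℂ x (R y)) ∧ ∀ x, T x = R (R x) := by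
  have h0 : (0 : Op H) ≤ T := (ContinuousLinearMap.nonneg_iff_isPositive T).2 hT
  refine ⟨CFC.sqrt T, fun x y => ?_, fun x => ?_⟩
  · have h1 : (CFC.sqrt T).IsPositive :=
      (ContinuousLinearMap.nonneg_iff_isPositive _).1 (CFC.sqrt_nonneg T)
    exact h1.isSymmetric x y
  · exact congrArg (fun A : Op H => A x) (CFC.sqrt_mul_sqrt_self T h0).symm

lemma qf_eq_nsq {T R : Op H} (hR : ∀ x y, inner ℂ (R x) y = inner ℂ x (R y))
    (h : ∀ x, T x = R (R x)) (x : H) : qf T x = nsq (R x) := by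
  rw [qf, h, ← hR, nsq, ← inner_self_eq_norm_sq (𝕜 := ℂ)]
  rfl

lemma eq_zero_of_trace_eq_zero {T : Op H} (hT : T.IsPositive) (h : trace T = 0) : T = 0 := by
  obtain ⟨R, hR, hTR⟩ := exists_sqrt hT
  have h1 : ∀ i, R (onb H i) = 0 := fun i => by
    rw [← nsq_eq_zero, ← qf_eq_nsq hR hTR]
    exact ENNReal.tsum_eq_zero.1 h i
  ext x
  rw [hTR]
  have h2 : R x = 0 := (onb H).ext_inner fun i => by
    rw [← hR, h1, inner_zero_left, inner_zero_right]
  rw [h2, map_zero]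
  rfl

lemma trace_add {S T : Op H} (hS : S.IsPositive) (hT : T.IsPositive) :
    trace (S + T) = trace S + trace T := by
  rw [trace, trace, trace, ← ENNReal.tsum_add]
  refine tsum_congr fun i => ?_
  have h1 := (Complex.le_def.1 (hS.inner_nonneg_right (onb H i))).1
  have h2 := (Complex.le_def.1 (hT.inner_nonneg_right (onb H i))).1
  rw [add_apply, inner_add_right, Complex.add_re, ENNReal.ofReal_add h1 h2]

/-- Pure states are the rank one projections. -/
lemma exists_eq_rankOne {φ : Op H} (hφ : φ ∈ pureStates H) :
    ∃ v : H, nsq v = 1 ∧ φ = rankOne ℂ v v := by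
  obtain ⟨⟨hpos, htr⟩, hext⟩ := mem_extremePoints.1 hφ
  obtain ⟨R, hR, hTR⟩ := exists_sqrt hpos
  -- With R the square root of φ and w = R e ≠ 0, Cauchy–Schwarz for ⟨w, x⟩ = ⟨e, R x⟩ gives |w⟩⟨w|
  -- ≤ φ.
  obtain ⟨i, hi⟩ : ∃ i, R (onb H i) ≠ 0 := by
    by_contra! h
    have h0 : trace φ = 0 := ENNReal.tsum_eq_zero.2 fun i => by
      have : qf φ (onb H i) = 0 := by rw [qf_eq_nsq hR hTR, h, nsq_zero]
      exact this
    rw [h0] at htr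
    exact zero_ne_one htr
  set e := onb H i
  set w := R e
  have he : ‖e‖ = 1 := (onb H).orthonormal.1 i
  have hσ : (φ - rankOne ℂ w w).IsPositive := by
    rw [ContinuousLinearMap.isPositive_def]
    refine ⟨hpos.isSymmetric.sub (isPositive_rankOne_self w).isSymmetric, fun x => ?_⟩
    have h1 : inner ℂ (φ x) x = ((‖R x‖ ^ 2 : ℝ) : ℂ) := by
      rw [hTR, hR, inner_self_eq_norm_sq_to_K]; simp
    have h2 : inner ℂ (rankOne ℂ w w x) x = ((‖inner ℂ w x‖ ^ 2 : ℝ) : ℂ) := by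
      rw [rankOne_apply, inner_smul_left, RCLike.conj_mul]; simp
    rw [ContinuousLinearMap.reApplyInnerSelf, sub_apply, inner_sub_left, h1, h2,
      ← Complex.ofReal_sub]
    have h3 : ‖inner ℂ w x‖ ≤ ‖R x‖ := by
      rw [show inner ℂ w x = inner ℂ e (R x) from hR e x]
      simpa [he] using norm_inner_le_norm (𝕜 := ℂ) e (R x)
    exact sub_nonneg.2 (by gcongr)
  have hsum : φ = rankOne ℂ w w + (φ - rankOne ℂ w w) := by abel
  have hts : nsq w + trace (φ - rankOne ℂ w w) = 1 := by
    rw [← trace_rankOne, ← trace_add (isPositive_rankOne_self w) hσ, ← hsum, htr]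
  have hs0 : nsq w ≠ 0 := fun h => hi (nsq_eq_zero.1 h)
  by_cases hd : trace (φ - rankOne ℂ w w) = 0
  · refine ⟨w, by rwa [hd, add_zero] at hts, ?_⟩
    have := eq_zero_of_trace_eq_zero hσ hd
    exact sub_eq_zero.1 this
  · have htd : trace (φ - rankOne ℂ w w) ≠ ∞ := fun h => by simp [h] at hts
    have hs : 0 < (nsq w).toReal := ENNReal.toReal_pos hs0 (nsq_ne_top w)
    have hd' : 0 < (trace (φ - rankOne ℂ w w)).toReal := ENNReal.toReal_pos hd htd
    have h1 : (nsq w).toReal⁻¹ • rankOne ℂ w w ∈ states H := by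
      refine ⟨isPositive_smul (isPositive_rankOne_self w) (by positivity), ?_⟩
      rw [← trace_rankOne w]
      exact trace_smul_inv_self (by rwa [trace_rankOne]) (by rw [trace_rankOne]; exact nsq_ne_top w)
    have h2 : (trace (φ - rankOne ℂ w w)).toReal⁻¹ • (φ - rankOne ℂ w w) ∈ states H :=
      ⟨isPositive_smul hσ (by positivity), trace_smul_inv_self hd htd⟩
    -- φ is a proper mixture of the normalised rank one part and the normalised remainder;
    -- extremality identifies it with the former.
    have h3 := (hext _ h1 _ h2 ⟨(nsq w).toReal, (trace (φ - rankOne ℂ w w)).toReal, hs, hd', by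
      rw [← ENNReal.toReal_add (nsq_ne_top w) htd, hts, ENNReal.toReal_one], by
      rw [smul_smul, smul_smul, mul_inv_cancel₀ hs.ne', mul_inv_cancel₀ hd'.ne', one_smul, one_smul,
        ← hsum]⟩)
    have h4 : (nsq w).toReal⁻¹ • rankOne ℂ w w = φ := by
      exact h3.1
    rw [smul_rankOne_self _ (by positivity)] at h4
    refine ⟨_, ?_, h4.symm⟩
    rw [← trace_rankOne, h4, htr]

/-- A unit vector representing a pure state. -/
def stateVec (φ : pureStates H) : H := (exists_eq_rankOne φ.2).choose

lemma nsq_stateVec (φ : pureStates H) : nsq (stateVec φ) = 1 :=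
  (exists_eq_rankOne φ.2).choose_spec.1

lemma eq_rankOne_stateVec (φ : pureStates H) :
    (φ : Op H) = rankOne ℂ (stateVec φ) (stateVec φ) :=
  (exists_eq_rankOne φ.2).choose_spec.2

end PureStates

-- The discrete inequality

section Discrete

variable {HA : Type u} {HB : Type v} {HE : Type w}
  [NormedAddCommGroup HA] [InnerProductSpace ℂ HA] [CompleteSpace HA]
  [NormedAddCommGroup HB] [InnerProductSpace ℂ HB] [CompleteSpace HB]
  [NormedAddCommGroup HE] [InnerProductSpace ℂ HE] [CompleteSpace HE]

lemma homExt_entropy_of_trace_eq_one {H : Type*} [NormedAddCommGroup H] [InnerProductSpace ℂ H]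
    [CompleteSpace H] {T : Op H} (h : trace T = 1) : homExt entropy T = entropy T := by
  rw [homExt, h]; simp

lemma homExt_entropy_stateVec (φ : pureStates (HTensor HA HB)) :
    homExt entropy (margFst (rankOne ℂ (stateVec φ) (stateVec φ)))
      = entropy (margFst (φ : Op (HTensor HA HB))) := by
  rw [homExt_entropy_of_trace_eq_one (by rw [trace_margFst_rankOne, nsq_stateVec]),
    ← eq_rankOne_stateVec]

lemma homExt_entropy_sqrt_smul' {c : ℝ} (hc : 0 ≤ c) (v : HTensor HA HB) :
    homExt entropy (margFst (rankOne ℂ (((√c : ℝ) : ℂ) • v) (((√c : ℝ) : ℂ) • v)))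
      = ENNReal.ofReal c * homExt entropy (margFst (rankOne ℂ v v)) := by
  rcases hc.eq_or_lt with h | h
  · rw [← h, homExt, trace_margFst_rankOne]; simp
  · exact homExt_entropy_sqrt_smul h v

lemma norm_le_one_of_proj {H : Type*} [NormedAddCommGroup H] [InnerProductSpace ℂ H]
    [CompleteSpace H] {P : Op H} (hP : P ∈ finiteRankProj H) : ‖P‖ ≤ 1 :=
  hP.1.norm_le

lemma flagMap_opTensor (P : Op HA) (k : onbIndex HE) (x : HTensor HA HB) :
    opTensor P (.id ℂ (HTensor HB HE)) (flagMap HA HB k x)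
      = flagMap HA HB k (opTensor P (.id ℂ HB) x) := by
  have : opTensor P (.id ℂ (HTensor HB HE)) ∘L flagMap HA HB k
      = flagMap HA HB k ∘L opTensor P (.id ℂ HB) :=
    clm_ht_ext fun a b => by simp [flagMap_ht, opTensor_ht]
  exact congrArg (fun A => A x) this

lemma conj_flag {P : Op HA} (hP : IsSelfAdjoint P) {ψ : onbIndex HE → HTensor HA HB}
    (hψ : SqSummable ψ) :
    opTensor P (.id ℂ (HTensor HB HE)) ∘L flag ψ ∘L opTensor P (.id ℂ (HTensor HB HE))
      = flag fun k => opTensor P (.id ℂ HB) (ψ k) := by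
  have h := (sqSummable_flag hψ).conj (opTensor P (.id ℂ (HTensor HB HE)))
  rw [opTensor_adjoint, ContinuousLinearMap.adjoint_id,
    ContinuousLinearMap.isSelfAdjoint_iff'.1 hP] at h
  rw [flag, h, flag]
  simp_rw [flagMap_opTensor]

/-- Compression on A commutes with flagging, so each term of the supremum is again a flagged
difference, for vectors shrunk by a local contraction. -/
lemma condMutualInfo_flag_le {ψ : onbIndex HE → HTensor HA HB} (hψ : SqSummable ψ) :
    condMutualInfo (flag ψ) ≤ 2 * ∑' k, homExt entropy (margFst (rankOne ℂ (ψ k) (ψ k))) := by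
  refine iSup₂_le fun P hP => ?_
  change mutualInfo _ - mutualInfo (margAE _) ≤ _
  rw [conj_flag hP.1.isSelfAdjoint hψ, mutualInfo_flag (hψ.map _), tsub_le_iff_left]
  gcongr with k
  exact homExt_entropy_opTensor_le (ψ k) (norm_le_one_of_proj hP) ContinuousLinearMap.norm_id_le

lemma tsum_extend {κ ι V M : Type*} [Zero V] [AddCommMonoid M] [TopologicalSpace M] {s : ι → κ}
    (hs : Function.Injective s) (f : ι → V) (F : V → M) (hF : F 0 = 0) :
    ∑' k, F (Function.extend s f 0 k) = ∑' i, F (f i) := by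
  rw [← hs.tsum_eq]
  · exact tsum_congr fun i => by rw [hs.extend_apply]
  · intro k hk
    by_contra h
    refine hk ?_
    change F _ = 0
    rw [Function.extend_apply' _ _ _ (fun ⟨i, hi⟩ => h ⟨i, hi⟩)]
    exact hF

/-- Extending a countable decomposition into vectors by a flag. -/
lemma isExtension_flag_extend {ι : Type*} {s : ι → onbIndex HE} (hs : Function.Injective s)
    {f : ι → HTensor HA HB} (h1 : ∑' i, nsq (f i) = 1) :
    SqSummable (Function.extend s f 0) ∧ ∑' k, nsq (Function.extend s f 0 k) = 1 ∧
      IsExtension (ketSum f) (flag (Function.extend s f 0)) := by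
  have h2 : ∑' k, nsq (Function.extend s f 0 k) = 1 := by
    rw [tsum_extend hs f nsq nsq_zero, h1]
  have h3 : SqSummable (Function.extend s f 0) := by
    rw [SqSummable, h2]; exact ENNReal.one_ne_top
  refine ⟨h3, h2, ⟨(isPosTraceClass_flag h3).pos, by rw [trace_flag h3, h2]⟩, ?_⟩
  rw [margAB_flag h3]
  exact tsum_extend hs f (fun v => rankOne ℂ v v) (by simp)

/-- Ensures that ℓ² has enough flags for a countable ensemble, whichever basis was fixed there. -/
lemma infinite_onbIndex_l2 : Infinite (onbIndex (lp (fun _ : ℕ => ℂ) 2)) := by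
  by_contra h
  rw [not_infinite_iff_finite] at h
  have := Fintype.ofFinite (onbIndex (lp (fun _ : ℕ => ℂ) 2))
  have hfin : FiniteDimensional ℂ (lp (fun _ : ℕ => ℂ) 2) :=
    (onb (lp (fun _ : ℕ => ℂ) 2)).toOrthonormalBasis.toBasis.finiteDimensional_of_finite
  let b : HilbertBasis ℕ ℂ (lp (fun _ : ℕ => ℂ) 2) := ⟨LinearIsometryEquiv.refl ℂ _⟩
  exact not_finite_iff_infinite.2 (inferInstance : Infinite ℕ) b.orthonormal.linearIndependent.finite

theorem squashed_le_formationDiscrete (ω : Op (HTensor HA HB)) :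
    squashed ω ≤ formationDiscrete ω := by
  refine le_iInf fun π => le_iInf fun φ => le_iInf fun hπ => le_iInf fun hω => ?_
  -- The weights are absorbed into the vectors, so that the decomposition becomes a sum of rank one
  -- operators.
  let f : ℕ → HTensor HA HB := fun i => ((√(π i : ℝ) : ℝ) : ℂ) • stateVec (φ i)
  have hnf : ∀ i, nsq (f i) = π i := fun i => by
    rw [nsq_smul, nsq_stateVec, mul_one, Complex.norm_real, Real.norm_eq_abs, sq_abs,
      Real.sq_sqrt (NNReal.coe_nonneg (π i)), ENNReal.ofReal_coe_nnreal]
  have h1 : ∑' i, nsq (f i) = 1 := by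
    simp_rw [hnf]
    rw [← ENNReal.coe_tsum hπ.summable, hπ.tsum_eq, ENNReal.coe_one]
  have hωf : ω = ketSum f := by
    have h2 : SqSummable f := by rw [SqSummable, h1]; exact ENNReal.one_ne_top
    have h3 : (fun i => (π i : ℝ) • (φ i : Op (HTensor HA HB))) = fun i => rankOne ℂ (f i) (f i) :=
      funext fun i => by
        rw [← smul_rankOne_self _ (NNReal.coe_nonneg (π i)), ← eq_rankOne_stateVec]
    exact hω.unique (h3 ▸ h2.hasSum)
  have := infinite_onbIndex_l2
  obtain ⟨hss, -, hext⟩ := isExtension_flag_extend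
    (Infinite.natEmbedding (onbIndex (lp (fun _ : ℕ => ℂ) 2))).injective h1
  rw [← hωf] at hext
  calc squashed ω ≤ 2⁻¹ * condMutualInfo _ := by
        rw [squashed]
        gcongr
        exact iInf₂_le _ hext
    _ ≤ 2⁻¹ * (2 * ∑' k, _) := by
        gcongr
        exact condMutualInfo_flag_le hss
    _ = ∑' i, homExt entropy (margFst (rankOne ℂ (f i) (f i))) := by
        rw [← mul_assoc, ENNReal.inv_mul_cancel (by simp) (by simp), one_mul]
        exact tsum_extend (Infinite.natEmbedding _).injective f
          (fun v => homExt entropy (margFst (rankOne ℂ v v)))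
          (by rw [homExt, trace_margFst_rankOne, nsq_zero, zero_mul])
    _ = _ := by
        refine tsum_congr fun i => ?_
        change homExt entropy (margFst (rankOne ℂ (((√(π i : ℝ) : ℝ) : ℂ) • stateVec (φ i))
          (((√(π i : ℝ) : ℝ) : ℂ) • stateVec (φ i)))) = _
        rw [homExt_entropy_sqrt_smul' (NNReal.coe_nonneg (π i)), homExt_entropy_stateVec,
          ENNReal.ofReal_coe_nnreal]

end Discrete

/-! ## Barycenters in finite dimension -/

section Hull

variable {Ω : Type*} [MeasurableSpace Ω] {μ : Measure Ω} [IsProbabilityMeasure μ]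

/-- A point outside a nonempty convex set of a finite-dimensional space is weakly separated from it
by a nonzero functional. -/
lemma exists_weak_separation {V : Type*} [NormedAddCommGroup V] [NormedSpace ℝ V]
    [FiniteDimensional ℝ V] {C : Set V} (hC : Convex ℝ C) (hne : C.Nonempty) {m : V} (hm : m ∉ C) :
    ∃ l : V →L[ℝ] ℝ, l ≠ 0 ∧ ((∀ c ∈ C, l c ≤ l m) ∨ ∃ r, ∀ c ∈ C, l c = r) := by
  by_cases hi : (interior C).Nonempty
  · obtain ⟨l, hl⟩ := geometric_hahn_banach_open_point hC.interior isOpen_interior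
      (fun h => hm (interior_subset h))
    refine ⟨l, ?_, Or.inl fun c hc => ?_⟩
    · rintro rfl
      obtain ⟨a, ha⟩ := hi
      exact lt_irrefl _ (hl a ha)
    · have h1 : c ∈ closure (interior C) := by
        rw [hC.closure_interior_eq_closure_of_nonempty_interior hi]
        exact subset_closure hc
      have h2 : closure (interior C) ⊆ {x | l x ≤ l m} :=
        closure_minimal (fun a ha => (hl a ha).le) (isClosed_le l.continuous continuous_const)
      exact h2 h1
  -- Without interior points C spans a proper affine subspace, on which some nonzero functional is
  -- constant.
  · rw [hC.interior_nonempty_iff_affineSpan_eq_top] at hi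
    obtain ⟨c₀, hc₀⟩ := hne
    have hd : (affineSpan ℝ C).direction < ⊤ := by
      refine lt_top_iff_ne_top.2 fun h => hi ?_
      exact (AffineSubspace.direction_eq_top_iff_of_nonempty
        ⟨c₀, subset_affineSpan ℝ C hc₀⟩).1 h
    obtain ⟨l, hl0, hl⟩ := Submodule.exists_le_ker_of_lt_top _ hd
    refine ⟨LinearMap.toContinuousLinearMap l, fun h => hl0 ?_, Or.inr ⟨l c₀, fun c hc => ?_⟩⟩
    · ext x
      exact congrArg (fun f : V →L[ℝ] ℝ => f x) h
    · have h1 : c - c₀ ∈ (affineSpan ℝ C).direction :=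
        AffineSubspace.vsub_mem_direction (subset_affineSpan ℝ C hc) (subset_affineSpan ℝ C hc₀)
      have h2 : l (c - c₀) = 0 := hl h1
      rw [map_sub, sub_eq_zero] at h2
      exact h2

/-- Induction on the dimension. If the mean m were outside C, a weakly separating functional would
be almost surely equal to its value at m. So f stays almost surely in a hyperplane through m, where
the smaller dimension applies. This is why C need not be closed. -/
lemma integral_mem_of_convex (n : ℕ) :
    ∀ {V : Type u} [NormedAddCommGroup V] [NormedSpace ℝ V] [FiniteDimensional ℝ V],
      Module.finrank ℝ V = n → ∀ {C : Set V}, Convex ℝ C → ∀ {f : Ω → V}, Integrable f μ →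
      (∀ᵐ x ∂μ, f x ∈ C) → ∫ x, f x ∂μ ∈ C := by
  induction n using Nat.strong_induction_on with
  | _ n ih =>
    intro V _ _ _ hn C hC f hf hfC
    by_contra hm
    obtain ⟨x₀, hx₀⟩ := hfC.exists
    obtain ⟨l, hl0, hl⟩ := exists_weak_separation hC ⟨_, hx₀⟩ hm
    set m := ∫ x, f x ∂μ
    have hint : Integrable (fun x => l (f x)) μ := l.integrable_comp hf
    have hlm : ∫ x, l (f x) ∂μ = l m := l.integral_comp_comm hf
    have hae : ∀ᵐ x ∂μ, l (f x) = l m := by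
      rcases hl with hl | ⟨r, hr⟩
      · have h0 : ∫ x, (l m - l (f x)) ∂μ = 0 := by
          rw [integral_sub (integrable_const _) hint, hlm]; simp
        have h1 := (integral_eq_zero_iff_of_nonneg_ae
          (hfC.mono fun x hx => sub_nonneg.2 (hl _ hx)) ((integrable_const _).sub hint)).1 h0
        exact h1.mono fun x hx => (sub_eq_zero.1 hx).symm
      · have h1 : ∀ᵐ x ∂μ, l (f x) = r := hfC.mono fun x hx => hr _ hx
        have h2 : l m = r := by
          rw [← hlm, integral_congr_ae h1]; simp
        rwa [h2]
    set W := LinearMap.ker (l : V →ₗ[ℝ] ℝ)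
    have hW : W < ⊤ := lt_top_iff_ne_top.2 fun h => hl0 (by
      ext x
      have : x ∈ W := h ▸ Submodule.mem_top
      exact this)
    -- The projection p makes f − m take values in the kernel everywhere, while changing it only on
    -- a null set.
    obtain ⟨p, hp⟩ := Submodule.ClosedComplemented.of_finiteDimensional W
    have hpf : ∀ᵐ x ∂μ, ((p (f x - m) : W) : V) = f x - m := hae.mono fun x hx => by
      have : f x - m ∈ W := by
        change l (f x - m) = 0
        rw [map_sub, hx, sub_self]
      exact congrArg Subtype.val (hp ⟨_, this⟩)
    have hI : Integrable (fun x => f x - m) μ := hf.sub (integrable_const _)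
    have h0 : ∫ x, p (f x - m) ∂μ = 0 := by
      rw [p.integral_comp_comm hI, integral_sub hf (integrable_const _)]
      simp [m]
    have key := ih (Module.finrank ℝ W) (hn ▸ Submodule.finrank_lt hW.ne) rfl
      (C := {w : W | (w : V) + m ∈ C})
      (fun a ha b hb s t hs ht hst => by
        have := hC ha hb hs ht hst
        have h : s • ((a : V) + m) + t • ((b : V) + m) = ((s • a + t • b : W) : V) + m := by
          rw [smul_add, smul_add, add_add_add_comm, ← add_smul, hst, one_smul]; rfl
        rw [h] at this
        exact this)
      (p.integrable_comp hI)
      (by filter_upwards [hpf, hfC] with x hx hx'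
          change ((p (f x - m) : W) : V) + m ∈ C
          rwa [hx, sub_add_cancel])
    rw [h0] at key
    refine hm ?_
    have h1 : ((0 : W) : V) + m ∈ C := key
    rwa [Submodule.coe_zero, zero_add] at h1

/-- The barycenter of a probability measure on a subset of a finite-dimensional space lies in the
(not necessarily closed) convex hull of the subset. -/
lemma integral_mem_convexHull {V : Type*} [NormedAddCommGroup V] [NormedSpace ℝ V]
    [FiniteDimensional ℝ V] {s : Set V} {f : Ω → V} (hf : Integrable f μ)
    (hs : ∀ᵐ x ∂μ, f x ∈ s) : ∫ x, f x ∂μ ∈ convexHull ℝ s :=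
  integral_mem_of_convex _ rfl (convex_convexHull ℝ s) hf
    (hs.mono fun _ hx => subset_convexHull ℝ s hx)

end Hull

-- Measurability of the entropy and finite dimension

section Measurability

variable {H : Type u} [NormedAddCommGroup H] [InnerProductSpace ℂ H] [CompleteSpace H]

/-- Distinct basis vectors are at distance at least 1, so the balls of radius 1/2 around them are
disjoint open sets. -/
lemma countable_onbIndex [TopologicalSpace.SeparableSpace H] : Countable (onbIndex H) := by
  refine Set.countable_univ_iff.1 (Set.PairwiseDisjoint.countable_of_isOpen
    (s := fun i => Metric.ball (onb H i) (1 / 2)) ?_ (fun i _ => Metric.isOpen_ball)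
    fun i _ => ⟨_, Metric.mem_ball_self (by norm_num)⟩)
  intro i _ j _ hij
  refine Metric.ball_disjoint_ball ?_
  have h1 : inner ℂ (onb H i) (onb H i - onb H j) = 1 := by
    rw [inner_sub_right, (onb H).inner_self, (onb H).inner_ne hij, sub_zero]
  have h2 := norm_inner_le_norm (𝕜 := ℂ) (onb H i) (onb H i - onb H j)
  rw [h1, (onb H).orthonormal.1 i, one_mul, norm_one] at h2
  rw [dist_eq_norm]
  linarith

lemma measurable_trace [TopologicalSpace.SeparableSpace H] : Measurable (trace : Op H → ℝ≥0∞) := by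
  have := countable_onbIndex (H := H)
  refine Measurable.tsum fun i => Continuous.measurable ?_
  refine ENNReal.continuous_ofReal.comp (Complex.continuous_re.comp ?_)
  exact (continuous_const.inner (continuous_id.clm_apply continuous_const))

/-- The functional calculus is norm continuous in the operator, and the trace is a countable sum of
continuous functions. -/
lemma measurable_entropy_comp [TopologicalSpace.SeparableSpace H] {X : Type*} [TopologicalSpace X]
    [MeasurableSpace X] [OpensMeasurableSpace X] {G : X → Op H} (hG : Continuous G)
    (hpos : ∀ x, IsSelfAdjoint (G x)) : Measurable fun x => entropy (G x) := by
  have h : Continuous fun x => cfc Real.negMulLog (G x) :=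
    Continuous.cfc_of_mem_nhdsSet (s := Set.univ) _ Filter.univ_mem hG hpos
      Real.continuous_negMulLog.continuousOn
  exact measurable_trace.comp h.measurable

lemma finiteDimensional_hTensor {KA KB : Type*} [NormedAddCommGroup KA] [InnerProductSpace ℂ KA]
    [NormedAddCommGroup KB] [InnerProductSpace ℂ KB] [FiniteDimensional ℂ KA]
    [FiniteDimensional ℂ KB] : FiniteDimensional ℂ (HTensor KA KB) := by
  let j : KA ⊗[ℂ] KB →L[ℂ] HTensor KA KB := Completion.toComplL
  have h1 : IsClosed ((LinearMap.range (j : KA ⊗[ℂ] KB →ₗ[ℂ] HTensor KA KB) : Submodule ℂ (HTensor KA KB)) :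
      Set (HTensor KA KB)) := Submodule.closed_of_finiteDimensional _
  have h2 : Function.Surjective j := by
    intro z
    have hz : z ∈ closure (Set.range j) := Completion.denseRange_coe z
    exact h1.closure_subset hz
  exact Module.Finite.of_surjective (j : KA ⊗[ℂ] KB →ₗ[ℂ] HTensor KA KB) h2

lemma finite_onbIndex [FiniteDimensional ℂ H] : Finite (onbIndex H) :=
  (onb H).orthonormal.linearIndependent.finite

end Measurability

/-! ## Finite ensembles -/

section Ensemble

variable {HA : Type u} {HB : Type v}
  [NormedAddCommGroup HA] [InnerProductSpace ℂ HA] [CompleteSpace HA]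
  [NormedAddCommGroup HB] [InnerProductSpace ℂ HB] [CompleteSpace HB]

lemma card_onbIndex_euclidean (n : ℕ) : Nat.card (onbIndex (EuclideanSpace ℂ (Fin n))) = n := by
  have := finite_onbIndex (H := EuclideanSpace ℂ (Fin n))
  have := Fintype.ofFinite (onbIndex (EuclideanSpace ℂ (Fin n)))
  rw [← Module.finrank_eq_nat_card_basis
    (onb (EuclideanSpace ℂ (Fin n))).toOrthonormalBasis.toBasis, finrank_euclideanSpace_fin]

/-- An E of dimension equal to the number of vectors has exactly one flag for each of them. -/
lemma squashedFin_ketSum_le {ι : Type*} [Finite ι] {f : ι → HTensor HA HB}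
    (h1 : ∑' i, nsq (f i) = 1) :
    squashedFin (ketSum f) ≤ ∑' i, homExt entropy (margFst (rankOne ℂ (f i) (f i))) := by
  have := finite_onbIndex (H := EuclideanSpace ℂ (Fin (Nat.card ι)))
  let s : ι ≃ onbIndex (EuclideanSpace ℂ (Fin (Nat.card ι))) :=
    (Finite.card_eq.1 (card_onbIndex_euclidean _).symm).some
  obtain ⟨hss, hs1, hext⟩ := isExtension_flag_extend s.injective h1
  calc squashedFin (ketSum f) ≤ 2⁻¹ * condMutualInfoFin _ := by
        rw [squashedFin]
        gcongr
        exact iInf_le_of_le _ (iInf₂_le _ hext)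
    _ ≤ 2⁻¹ * (2 * ∑' k, _) := by
        gcongr
        exact condMutualInfoFin_flag_le hss hs1
    _ = _ := by
        rw [← mul_assoc, ENNReal.inv_mul_cancel (by simp) (by simp), one_mul]
        exact tsum_extend s.injective f
          (fun v => homExt entropy (margFst (rankOne ℂ v v)))
          (by rw [homExt, trace_margFst_rankOne, nsq_zero, zero_mul])

lemma homExt_squashedFin_ketSum_le {ι : Type*} [Finite ι] (f : ι → HTensor HA HB) :
    homExt squashedFin (ketSum f) ≤ ∑' i, homExt entropy (margFst (rankOne ℂ (f i) (f i))) := by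
  have hf := sqSummable_of_finite f
  by_cases h0 : trace (ketSum f) = 0
  · rw [homExt, h0, zero_mul]; exact zero_le
  have ht : trace (ketSum f) ≠ ∞ := by rw [hf.trace_ketSum]; exact hf
  have hr : 0 ≤ (trace (ketSum f)).toReal⁻¹ := inv_nonneg.2 ENNReal.toReal_nonneg
  have h1 : ∑' i, nsq (((√(trace (ketSum f)).toReal⁻¹ : ℝ) : ℂ) • f i) = 1 := by
    rw [← (hf.smul _).trace_ketSum, ← smul_ketSum _ hr]
    exact trace_smul_inv_self h0 ht
  rw [homExt, smul_ketSum _ hr]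
  refine (mul_le_mul_right (squashedFin_ketSum_le h1) _).trans ?_
  simp_rw [homExt_entropy_sqrt_smul' hr]
  rw [ENNReal.tsum_mul_left, ← mul_assoc,
    ENNReal.ofReal_inv_of_pos (ENNReal.toReal_pos h0 ht), ENNReal.ofReal_toReal ht,
    ENNReal.mul_inv_cancel h0 ht, one_mul]

lemma homExt_squashedFin_sum_le {ι : Type*} [Fintype ι] {c : ι → ℝ} (hc : ∀ i, 0 ≤ c i)
    (z : ι → HTensor HA HB) :
    homExt squashedFin (∑ i, c i • rankOne ℂ (z i) (z i))
      ≤ ∑ i, ENNReal.ofReal (c i) * homExt entropy (margFst (rankOne ℂ (z i) (z i))) := by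
  have h : ∑ i, c i • rankOne ℂ (z i) (z i) = ketSum fun i => ((√(c i) : ℝ) : ℂ) • z i := by
    rw [ketSum, tsum_fintype]
    exact Finset.sum_congr rfl fun i _ => smul_rankOne_self _ (hc i) _
  rw [h]
  refine (homExt_squashedFin_ketSum_le _).trans_eq ?_
  rw [tsum_fintype]
  exact Finset.sum_congr rfl fun i _ => homExt_entropy_sqrt_smul' (hc i) _

end Ensemble

/-! ## Compression by finite rank projectors -/

section Compression

variable {HA : Type u} {HB : Type v} {KA : Type w} {KB : Type w'}
  [NormedAddCommGroup HA] [InnerProductSpace ℂ HA] [CompleteSpace HA]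
  [NormedAddCommGroup HB] [InnerProductSpace ℂ HB] [CompleteSpace HB]
  [NormedAddCommGroup KA] [InnerProductSpace ℂ KA] [CompleteSpace KA]
  [NormedAddCommGroup KB] [InnerProductSpace ℂ KB] [CompleteSpace KB]

lemma isStarProjection_opTensor {P : Op HA} {Q : Op HB} (hP : IsStarProjection P)
    (hQ : IsStarProjection Q) : IsStarProjection (opTensor P Q) where
  isIdempotentElem := by
    change opTensor P Q ∘L opTensor P Q = _
    rw [opTensor_comp]
    exact congrArg₂ opTensor hP.isIdempotentElem hQ.isIdempotentElem
  isSelfAdjoint := by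
    rw [ContinuousLinearMap.isSelfAdjoint_iff', opTensor_adjoint,
      ContinuousLinearMap.isSelfAdjoint_iff'.1 hP.isSelfAdjoint,
      ContinuousLinearMap.isSelfAdjoint_iff'.1 hQ.isSelfAdjoint]

/-- A finite rank projector factors through an isometry from a finite-dimensional space. -/
lemma exists_isometry_of_proj {H : Type u} [NormedAddCommGroup H] [InnerProductSpace ℂ H]
    [CompleteSpace H] {P : Op H} (hP : P ∈ finiteRankProj H) :
    ∃ (K : Submodule ℂ H) (_ : FiniteDimensional ℂ K),
      P = K.subtypeL ∘L K.subtypeL.adjoint := by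
  obtain ⟨hs, hf⟩ := hP
  obtain ⟨_, h⟩ := isStarProjection_iff_eq_starProjection_range.1 hs
  refine ⟨LinearMap.range (P : H →ₗ[ℂ] H), hf, ?_⟩
  have : FiniteDimensional ℂ P.range := hf
  rw [Submodule.adjoint_subtypeL]
  exact h

/-- An isometry on the traced factor preserves the norms of slices and drops out of the marginal. -/
lemma margFst_opTensor (S : KA →L[ℂ] HA) {T : KB →L[ℂ] HB} (hT : ∀ y, ‖T y‖ = ‖y‖)
    (z : HTensor KA KB) :
    margFst (rankOne ℂ (opTensor S T z) (opTensor S T z))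
      = S ∘L margFst (rankOne ℂ z z) ∘L S.adjoint := by
  refine ext_qf (isPosTraceClass_margFst_rankOne _).pos
    ((isPosTraceClass_margFst_rankOne z).pos.conj_adjoint S) fun x => ?_
  have h1 := qf_conj S.adjoint (margFst (rankOne ℂ z z)) x
  rw [ContinuousLinearMap.adjoint_adjoint] at h1
  rw [h1, qf_margFst_rankOne, qf_margFst_rankOne]
  have h2 : (tmulLeft HB x).adjoint (opTensor S T z)
      = T ((tmulLeft KB (S.adjoint x)).adjoint z) := by
    have h3 : (tmulLeft HB x).adjoint ∘L opTensor S T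
        = T ∘L (tmulLeft KB (S.adjoint x)).adjoint :=
      clm_ht_ext fun a b => by
        simp [opTensor_ht, tmulLeft_adjoint_ht, ContinuousLinearMap.adjoint_inner_left]
    exact congrArg (fun A => A z) h3
  rw [h2, nsq, nsq, hT]

lemma continuous_margFst [FiniteDimensional ℂ KB] :
    Continuous (margFst : Op (HTensor KA KB) → Op KA) := by
  have := finite_onbIndex (H := KB)
  have := Fintype.ofFinite (onbIndex KB)
  have h : (margFst : Op (HTensor KA KB) → Op KA) = fun ω =>
      ∑ j, (tmulRight KA (onb KB j)).adjoint ∘L ω ∘L tmulRight KA (onb KB j) :=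
    funext fun ω => tsum_fintype _
  rw [h]
  exact continuous_finsetSum _ fun j _ =>
    continuous_const.clm_comp (continuous_id.clm_comp continuous_const)

/-- Only the rank one operators need depend continuously on the parameter, since unit vectors
representing pure states come from arbitrary choices. For trace at most 1 the homogeneous entropy is
the entropy minus a finite term depending on the trace, and both are measurable. -/
lemma measurable_homExt_entropy_conj [TopologicalSpace.SeparableSpace HA]
    [FiniteDimensional ℂ KB] (S : KA →L[ℂ] HA) {T : KB →L[ℂ] HB} (hT : ∀ y, ‖T y‖ = ‖y‖)
    {X : Type*} [TopologicalSpace X] [MeasurableSpace X] [OpensMeasurableSpace X]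
    {z : X → HTensor KA KB} (hz : Continuous fun x => rankOne ℂ (z x) (z x))
    (h1 : ∀ x, nsq (opTensor S T (z x)) ≤ 1) :
    Measurable fun x =>
      homExt entropy (margFst (rankOne ℂ (opTensor S T (z x)) (opTensor S T (z x)))) := by
  set G : X → Op HA := fun x => margFst (rankOne ℂ (opTensor S T (z x)) (opTensor S T (z x)))
  have hG : Continuous G := by
    have : G = fun x => S ∘L margFst (rankOne ℂ (z x) (z x)) ∘L S.adjoint :=
      funext fun x => margFst_opTensor S hT (z x)
    rw [this]
    exact continuous_const.clm_comp ((continuous_margFst.comp hz).clm_comp continuous_const)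
  have hp : ∀ x, IsPosTraceClass (G x) := fun x => isPosTraceClass_margFst_rankOne _
  have h2 : ∀ x, homExt entropy (G x)
      = entropy (G x) - ENNReal.ofReal (Real.negMulLog (trace (G x)).toReal) := fun x => by
    have h3 : trace (G x) ≤ 1 := by rw [trace_margFst_rankOne]; exact h1 x
    rw [(hp x).entropy_eq_add h3, ENNReal.add_sub_cancel_left ENNReal.ofReal_ne_top]
  change Measurable fun x => homExt entropy (G x)
  rw [funext h2]
  refine (measurable_entropy_comp hG fun x => (hp x).pos.isSelfAdjoint).sub ?_
  exact (Real.continuous_negMulLog.measurable.comp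
    (measurable_trace.comp hG.measurable).ennreal_toReal).ennreal_ofReal

end Compression

-- The continuous inequality

section Continuous

variable {HA : Type u} {HB : Type v}
  [NormedAddCommGroup HA] [InnerProductSpace ℂ HA] [CompleteSpace HA]
  [NormedAddCommGroup HB] [InnerProductSpace ℂ HB] [CompleteSpace HB]

lemma finiteDimensional_real_op {K : Type*} [NormedAddCommGroup K] [InnerProductSpace ℂ K]
    [FiniteDimensional ℂ K] : FiniteDimensional ℝ (Op K) :=
  Module.Finite.trans ℂ (Op K)

/-- The compression of a barycenter of pure states to a finite-dimensional space is a finite convex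
combination of compressed pure states with the same average of a given cost function. -/
lemma exists_finite_ensemble {H : Type*} {K : Type*} [NormedAddCommGroup H] [InnerProductSpace ℂ H]
    [CompleteSpace H] [NormedAddCommGroup K] [InnerProductSpace ℂ K] [CompleteSpace K]
    [FiniteDimensional ℂ K] (J : K →L[ℂ] H) {μ : Measure (pureStates H)} [IsProbabilityMeasure μ]
    (hint : Integrable (fun φ : pureStates H => (φ : Op H)) μ) {g : pureStates H → ℝ≥0∞}
    (hg : Measurable g) (hgtop : ∫⁻ φ, g φ ∂μ ≠ ∞) :
    ∃ (ι : Type) (_ : Fintype ι) (c : ι → ℝ) (φ : ι → pureStates H), (∀ i, 0 ≤ c i) ∧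
      (J ∘L J.adjoint) ∘L (∫ φ, (φ : Op H) ∂μ) ∘L (J ∘L J.adjoint)
        = ∑ i, c i • ((J ∘L J.adjoint) ∘L (φ i : Op H) ∘L (J ∘L J.adjoint)) ∧
      ∑ i, ENNReal.ofReal (c i) * g (φ i) = ∫⁻ φ, g φ ∂μ := by
  have hfin : FiniteDimensional ℝ (Op K) := finiteDimensional_real_op
  let L : Op H →L[ℝ] Op K :=
    ((ContinuousLinearMap.compL ℂ K H K J.adjoint) ∘L
      ((ContinuousLinearMap.compL ℂ K H H).flip J)).restrictScalars ℝ
  have hgae : ∀ᵐ φ ∂μ, g φ < ∞ := ae_lt_top hg hgtop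
  have hgint := integrable_toReal_of_lintegral_ne_top hg.aemeasurable hgtop
  have hLint : Integrable (fun φ : pureStates H => L φ) μ := L.integrable_comp hint
  -- State and cost are averaged as one vector in a finite-dimensional space, so a single finite
  -- ensemble matches both. Restricting to finite cost keeps `toReal` faithful.
  have hmem := integral_mem_convexHull (μ := μ)
    (s := (fun φ : pureStates H => (L φ, (g φ).toReal)) '' {φ | g φ < ∞}) (hLint.prodMk hgint)
    (hgae.mono fun φ hφ => ⟨φ, hφ, rfl⟩)
  rw [integral_pair hLint hgint, L.integral_comp_comm hint,
    integral_toReal hg.aemeasurable hgae, mem_convexHull_iff_exists_fintype] at hmem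
  obtain ⟨ι, _, c, y, hc, -, hy, hsum⟩ := hmem
  choose φ hφ hφy using hy
  obtain rfl : y = fun i => (L (φ i), (g (φ i)).toReal) := funext fun i => (hφy i).symm
  obtain ⟨hs1, hs2⟩ := Prod.ext_iff.1 hsum
  simp only [Prod.fst_sum, Prod.snd_sum, Prod.smul_fst, Prod.smul_snd, smul_eq_mul] at hs1 hs2
  refine ⟨ι, inferInstance, c, φ, hc, ?_, ?_⟩
  · have h : (J ∘L J.adjoint) ∘L (∫ φ, (φ : Op H) ∂μ) ∘L (J ∘L J.adjoint)
        = J ∘L L (∫ φ, (φ : Op H) ∂μ) ∘L J.adjoint := rfl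
    rw [h, ← hs1]
    ext x
    simp only [ContinuousLinearMap.comp_apply, sum_apply, map_sum]
    exact Finset.sum_congr rfl fun i _ => by
      rw [smul_apply, smul_apply, J.map_smul_of_tower]
      rfl
  calc _ = ENNReal.ofReal (∑ i, c i * (g (φ i)).toReal) := by
        rw [ENNReal.ofReal_sum_of_nonneg fun i _ => mul_nonneg (hc i) ENNReal.toReal_nonneg]
        refine Finset.sum_congr rfl fun i _ => ?_
        have hi : g (φ i) < ∞ := hφ i
        rw [ENNReal.ofReal_mul (hc i), ENNReal.ofReal_toReal hi.ne]
    _ = ∫⁻ φ, g φ ∂μ := by rw [hs2, ENNReal.ofReal_toReal hgtop]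

lemma measurable_homExt_entropy_compression [TopologicalSpace.SeparableSpace HA] {KA : Type w}
    {KB : Type w'} [NormedAddCommGroup KA] [InnerProductSpace ℂ KA] [CompleteSpace KA]
    [NormedAddCommGroup KB] [InnerProductSpace ℂ KB] [CompleteSpace KB] [FiniteDimensional ℂ KB]
    (S : KA →L[ℂ] HA) {T : KB →L[ℂ] HB} (hT : ∀ y, ‖T y‖ = ‖y‖) {Q : Op (HTensor HA HB)}
    (hQ : IsStarProjection Q) (hQJ : Q = opTensor S T ∘L (opTensor S T).adjoint) :
    Measurable fun φ : pureStates (HTensor HA HB) =>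
      homExt entropy (margFst (rankOne ℂ (Q (stateVec φ)) (Q (stateVec φ)))) := by
  have h1 : ∀ v, Q v = opTensor S T ((opTensor S T).adjoint v) := fun v => by
    conv_lhs => rw [hQJ]
    rfl
  simp only [h1]
  refine measurable_homExt_entropy_conj S hT ?_ fun φ => ?_
  · have h2 : ∀ φ : pureStates (HTensor HA HB),
        rankOne ℂ ((opTensor S T).adjoint (stateVec φ)) ((opTensor S T).adjoint (stateVec φ))
          = (opTensor S T).adjoint ∘L (φ : Op (HTensor HA HB)) ∘L opTensor S T := fun φ => by
      have := conj_rankOne (opTensor S T).adjoint (stateVec φ)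
      rw [ContinuousLinearMap.adjoint_adjoint, ← eq_rankOne_stateVec] at this
      exact this.symm
    simp_rw [h2]
    exact continuous_const.clm_comp (continuous_subtype_val.clm_comp continuous_const)
  · rw [← h1, ← nsq_stateVec φ]
    exact nsq_map_le_of_contraction hQ.norm_le _

theorem squashedHat_le_formationContinuous [TopologicalSpace.SeparableSpace HA]
    {ω : Op (HTensor HA HB)} (hω : ω ≠ 0) : squashedHat ω ≤ formationContinuous ω := by
  refine le_iInf fun μ => le_iInf fun hμ => le_iInf fun hbar => iSup₂_le fun PA hPA =>
    iSup₂_le fun PB hPB => ?_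
  by_cases htop : ∫⁻ φ, entropy (margFst (φ : Op (HTensor HA HB))) ∂μ = ∞
  · rw [htop]; exact le_top
  -- The Bochner integral of a nonintegrable function is 0, so a nonzero barycenter forces
  -- integrability.
  have hint : Integrable (fun φ : pureStates (HTensor HA HB) => (φ : Op (HTensor HA HB))) μ := by
    by_contra h
    exact hω (by rw [← hbar, integral_undef h])
  obtain ⟨KA, hKA, hA⟩ := exists_isometry_of_proj hPA
  obtain ⟨KB, hKB, hB⟩ := exists_isometry_of_proj hPB
  have hfin : FiniteDimensional ℂ (HTensor KA KB) := finiteDimensional_hTensor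
  have hQ := isStarProjection_opTensor hPA.1 hPB.1
  have hQJ : opTensor PA PB = opTensor KA.subtypeL KB.subtypeL ∘L
      (opTensor KA.subtypeL KB.subtypeL).adjoint := by
    rw [opTensor_adjoint, opTensor_comp, ← hA, ← hB]
  have hg := measurable_homExt_entropy_compression KA.subtypeL (T := KB.subtypeL) (fun _ => rfl)
    hQ hQJ
  -- The ensemble is built for the cost after compression, which the local projectors can only have
  -- lowered.
  have hgle : ∫⁻ φ : pureStates (HTensor HA HB), homExt entropy (margFst (rankOne ℂ
      (opTensor PA PB (stateVec φ)) (opTensor PA PB (stateVec φ)))) ∂μ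
      ≤ ∫⁻ φ, entropy (margFst (φ : Op (HTensor HA HB))) ∂μ :=
    lintegral_mono fun φ => by
      rw [← homExt_entropy_stateVec]
      exact homExt_entropy_opTensor_le _ (norm_le_one_of_proj hPA) (norm_le_one_of_proj hPB)
  generalize opTensor PA PB = Q at *
  generalize opTensor KA.subtypeL KB.subtypeL = J at *
  obtain ⟨ι, _, c, φ, hc, h1, h2⟩ := exists_finite_ensemble J hint hg (ne_top_of_le_ne_top htop hgle)
  refine le_trans (le_of_eq_of_le ?_ (homExt_squashedFin_sum_le hc fun i => Q (stateVec (φ i))))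
    (h2.trans_le hgle)
  have h3 : ∀ i, rankOne ℂ (Q (stateVec (φ i))) (Q (stateVec (φ i)))
      = Q ∘L (φ i : Op (HTensor HA HB)) ∘L Q := fun i => by
    have := conj_rankOne Q (stateVec (φ i))
    rw [ContinuousLinearMap.isSelfAdjoint_iff'.1 hQ.isSelfAdjoint, ← eq_rankOne_stateVec] at this
    exact this.symm
  rw [← hQJ, hbar] at h1
  simp_rw [h3]
  rw [h1]

end Continuous

end Squashed

end

theorem corollary2 {HA : Type*} {HB : Type*}
    [NormedAddCommGroup HA] [InnerProductSpace ℂ HA] [CompleteSpace HA]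
    [TopologicalSpace.SeparableSpace HA]
    [NormedAddCommGroup HB] [InnerProductSpace ℂ HB] [CompleteSpace HB]
    [TopologicalSpace.SeparableSpace HB]
    (ω : Squashed.Op (Squashed.HTensor HA HB))
    (hω : ω ∈ Squashed.states (Squashed.HTensor HA HB)) :
    Squashed.squashed ω ≤ Squashed.formationDiscrete ω ∧
      Squashed.squashedHat ω ≤ Squashed.formationContinuous ω := by
  refine ⟨Squashed.squashed_le_formationDiscrete ω,
    Squashed.squashedHat_le_formationContinuous fun h => ?_⟩
  have h1 := hω.2
  rw [h, Squashed.trace] at h1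
  simp at h1
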